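/- Let $M$ be a simply connected smooth $4$-manifold with a hypercomplex structure, that is, with smooth endomorphisms $J_1,J_2,J_3$ of $TM$ such that $J_\alpha^2=-I$, $J_1J_2=-J_2J_1=J_3$, and the Nijenhuis tensor of each $J_\alpha$ vanishes. Let $h$ be a hyper-Kähler metric on $(M,\{J_\alpha\})$, that is, a smooth Riemannian metric with $h(J_\alpha\cdot,J_\alpha\cdot)=h$ and $d\omega_\alpha=0$ for $\omega_\alpha(X,Y)=h(X,J_\alpha Y)$, $\alpha=1,2,3$. Assume that the conformal class $[h]=\{e^f h: f\in C^\infty(M)\}$ contains a metric $g$ for which there is a Lie group $G$ of isometries of $(M,g)$ whose differentials commute with $J_1,J_2,J_3$, acting smoothly and simply transitively on $M$. (Lie groups are finite-dimensional and second countable.) Then $(M,h)$ is homothetic, i.e. isometric after multiplication of $h$ by a positive constant, to one of the following Riemannian manifolds: 1. $\mathbb{R}^4$ with the Euclidean metric; 2. $\mathbb{R}^4\setminus\{0\}$ with the metric $r^{-4}(dx^2+dy^2+dz^2+dt^2)$, where $r^2=x^2+y^2+z^2+t^2$; 3. $\mathbb{R}^2\times(\mathbb{R}^+\times\mathbb{R})$,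 with coordinates $x,y,s,t$ and $s>0$, with the metric $(dx^2+dy^2)+(ds^2+s^2\,dt^2)$; 4. $\mathbb{R}^+\times\mathbb{R}^3$, with coordinates $s,x,y,z$ and $s>0$, with the metric $ds^2+dx^2+dy^2+dz^2$; 5. $\mathbb{R}^+\times\mathbb{R}^3$, with coordinates $s,x,y,z$ and $s>0$, with the metric $s(ds^2+dx^2+dy^2)+s^{-1}\bigl(dz-\tfrac12(x\,dy-y\,dx)\bigr)^2$. -/

import Mathlib

open scoped Manifold ContDiff

noncomputable section

/-- The Euclidean space `ℝ⁴`, on which all the 4-manifolds below are modelled. -/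
abbrev E4 : Type := EuclideanSpace ℝ (Fin 4)

section Manifolds

variable (M : Type*) [TopologicalSpace M] [ChartedSpace E4 M] [IsManifold 𝓘(ℝ, E4) ∞ M]

/-- Smooth Riemannian metrics on a 4-manifold. -/
abbrev RiemMetric : Type _ :=
  Bundle.ContMDiffRiemannianMetric 𝓘(ℝ, E4) ∞ E4 (fun x : M => TangentSpace 𝓘(ℝ, E4) x)

variable {M}

/-- A global vector field is smooth. -/
def SmoothVF (X : ∀ x : M, TangentSpace 𝓘(ℝ, E4) x) : Prop :=
  ContMDiff 𝓘(ℝ, E4) 𝓘(ℝ, E4).tangent ∞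
    (fun x => (⟨x, X x⟩ : TangentBundle 𝓘(ℝ, E4) M))

/-- The Nijenhuis tensor `[JX, JY] - [X, Y] - J([X, JY] + [JX, Y])` of a field of endomorphisms
`J` of the tangent bundle, evaluated on vector fields `X`, `Y` at the point `x`. -/
def nijenhuis (J : ∀ x : M, TangentSpace 𝓘(ℝ, E4) x →L[ℝ] TangentSpace 𝓘(ℝ, E4) x)
    (X Y : ∀ x : M, TangentSpace 𝓘(ℝ, E4) x) (x : M) : TangentSpace 𝓘(ℝ, E4) x :=
  VectorField.mlieBracket 𝓘(ℝ, E4) (fun y => J y (X y)) (fun y => J y (Y y)) x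
    - VectorField.mlieBracket 𝓘(ℝ, E4) X Y x
    - J x (VectorField.mlieBracket 𝓘(ℝ, E4) X (fun y => J y (Y y)) x
        + VectorField.mlieBracket 𝓘(ℝ, E4) (fun y => J y (X y)) Y x)

variable (M) in
/-- A hypercomplex structure on a 4-manifold: three smooth fields `J 0`, `J 1`, `J 2` of
endomorphisms of the tangent bundle, satisfying the quaternionic relations, with vanishing
Nijenhuis tensors. -/
structure HypercomplexStructure where
  /-- The three endomorphism fields. -/
  J : Fin 3 → ∀ x : M, TangentSpace 𝓘(ℝ, E4) x →L[ℝ] TangentSpace 𝓘(ℝ, E4) x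
  smooth : ∀ a : Fin 3,
    ContMDiff 𝓘(ℝ, E4) (𝓘(ℝ, E4).prod 𝓘(ℝ, E4 →L[ℝ] E4)) ∞
      (fun x => Bundle.TotalSpace.mk' (E4 →L[ℝ] E4)
        (E := fun x : M => TangentSpace 𝓘(ℝ, E4) x →L[ℝ] TangentSpace 𝓘(ℝ, E4) x) x (J a x))
  sq : ∀ (a : Fin 3) (x : M) (v : TangentSpace 𝓘(ℝ, E4) x), J a x (J a x v) = -v
  mul : ∀ (x : M) (v : TangentSpace 𝓘(ℝ, E4) x), J 0 x (J 1 x v) = J 2 x v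
  mul_anti : ∀ (x : M) (v : TangentSpace 𝓘(ℝ, E4) x), J 1 x (J 0 x v) = -J 2 x v
  integrable : ∀ (a : Fin 3) (X Y : ∀ x : M, TangentSpace 𝓘(ℝ, E4) x),
    SmoothVF X → SmoothVF Y → ∀ x, nijenhuis (J a) X Y x = 0

/-- `g(J_α v, J_α w) = g(v, w)` for `α = 1, 2, 3`. -/
def IsHyperHermitian (H : HypercomplexStructure M) (g : RiemMetric M) : Prop :=
  ∀ (a : Fin 3) (x : M) (v w : TangentSpace 𝓘(ℝ, E4) x),
    g.inner x (H.J a x v) (H.J a x w) = g.inner x v w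

/-- The form `ω_α(v, w) = g(v, J_α w)` at the point `x`. -/
def omegaForm (H : HypercomplexStructure M) (g : RiemMetric M) (a : Fin 3) (x : M)
    (v w : TangentSpace 𝓘(ℝ, E4) x) : ℝ :=
  g.inner x v (H.J a x w)

/-- The derivative `X(f)` of a function `f` along a vector field `X`, at `x`. -/
def derivAlong (X : ∀ x : M, TangentSpace 𝓘(ℝ, E4) x) (f : M → ℝ) (x : M) : ℝ :=
  (mfderiv 𝓘(ℝ, E4) 𝓘(ℝ, ℝ) f x (X x) : ℝ)

/-- The exterior derivative of a 2-form `om`, by the invariant formula, evaluated on vector fields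
`X`, `Y`, `Z` at the point `x`. -/
def extD (om : ∀ x : M, TangentSpace 𝓘(ℝ, E4) x → TangentSpace 𝓘(ℝ, E4) x → ℝ)
    (X Y Z : ∀ x : M, TangentSpace 𝓘(ℝ, E4) x) (x : M) : ℝ :=
  derivAlong X (fun y => om y (Y y) (Z y)) x
    - derivAlong Y (fun y => om y (X y) (Z y)) x
    + derivAlong Z (fun y => om y (X y) (Y y)) x
    - om x (VectorField.mlieBracket 𝓘(ℝ, E4) X Y x) (Z x)
    + om x (VectorField.mlieBracket 𝓘(ℝ, E4) X Z x) (Y x)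
    - om x (VectorField.mlieBracket 𝓘(ℝ, E4) Y Z x) (X x)

/-- A metric is hyper-Kähler when it is hyper-Hermitian and `dω_α = 0` for `α = 1, 2, 3`. -/
def IsHyperKahler (H : HypercomplexStructure M) (g : RiemMetric M) : Prop :=
  IsHyperHermitian H g ∧
    ∀ (a : Fin 3) (X Y Z : ∀ x : M, TangentSpace 𝓘(ℝ, E4) x),
      SmoothVF X → SmoothVF Y → SmoothVF Z → ∀ x, extD (omegaForm H g a) X Y Z x = 0

/-- `g` lies in the conformal class of `h`: `g = e^f h` for a smooth function `f`. -/
def IsConformalTo (g h : RiemMetric M) : Prop :=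
  ∃ f : M → ℝ, ContMDiff 𝓘(ℝ, E4) 𝓘(ℝ, ℝ) ∞ f ∧
    ∀ (x : M) (v w : TangentSpace 𝓘(ℝ, E4) x),
      g.inner x v w = Real.exp (f x) * h.inner x v w

/-- The map `φ` preserves the metric `g`. -/
def PreservesMetric (g : RiemMetric M) (φ : M → M) : Prop :=
  ∀ (x : M) (v w : TangentSpace 𝓘(ℝ, E4) x),
    g.inner (φ x) (mfderiv 𝓘(ℝ, E4) 𝓘(ℝ, E4) φ x v) (mfderiv 𝓘(ℝ, E4) 𝓘(ℝ, E4) φ x w)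
      = g.inner x v w

/-- The map `φ` is hypercomplex: its differential commutes with `J_α` for `α = 1, 2, 3`. -/
def IsHypercomplexMap (H : HypercomplexStructure M) (φ : M → M) : Prop :=
  ∀ (a : Fin 3) (x : M) (v : TangentSpace 𝓘(ℝ, E4) x),
    mfderiv 𝓘(ℝ, E4) 𝓘(ℝ, E4) φ x (H.J a x v)
      = H.J a (φ x) (mfderiv 𝓘(ℝ, E4) 𝓘(ℝ, E4) φ x v)

/-- `(M, h)` is homothetic to the open set `U` of `ℝ⁴` with the metric `k` (where `k p u v` is the
product of the tangent vectors `u`, `v` at `p`): there is a diffeomorphism `φ` of `M` onto `U`,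
with inverse `ψ`, such that `φ^* k = c h` for a constant `c > 0`. -/
def IsHomotheticTo (h : RiemMetric M) (U : Set E4) (k : E4 → E4 → E4 → ℝ) : Prop :=
  ∃ (φ : M → E4) (ψ : E4 → M) (c : ℝ),
    ContMDiff 𝓘(ℝ, E4) 𝓘(ℝ, E4) ∞ φ ∧ ContMDiffOn 𝓘(ℝ, E4) 𝓘(ℝ, E4) ∞ ψ U ∧
    (∀ x, φ x ∈ U) ∧ (∀ x, ψ (φ x) = x) ∧ (∀ p ∈ U, φ (ψ p) = p) ∧
    0 < c ∧
    ∀ (x : M) (v w : TangentSpace 𝓘(ℝ, E4) x),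
      k (φ x) (mfderiv 𝓘(ℝ, E4) 𝓘(ℝ, E4) φ x v) (mfderiv 𝓘(ℝ, E4) 𝓘(ℝ, E4) φ x w)
        = c * h.inner x v w

end Manifolds

/-- The Lie group `G` acts smoothly and simply transitively on `M`, by hypercomplex isometries
of `g`. -/
structure ActsSimplyTransitivelyByHypercomplexIsometries
    {M : Type*} [TopologicalSpace M] [ChartedSpace E4 M] [IsManifold 𝓘(ℝ, E4) ∞ M]
    (H : HypercomplexStructure M) (g : RiemMetric M)
    {E : Type*} [NormedAddCommGroup E] [NormedSpace ℝ E]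
    (G : Type*) [TopologicalSpace G] [ChartedSpace E G] [Group G] [MulAction G M] : Prop where
  smooth : ContMDiff (𝓘(ℝ, E).prod 𝓘(ℝ, E4)) 𝓘(ℝ, E4) ∞ (fun p : G × M => p.1 • p.2)
  simplyTransitive : ∀ x y : M, ∃! a : G, a • x = y
  isometric : ∀ a : G, PreservesMetric g (fun x => a • x)
  hypercomplex : ∀ a : G, IsHypercomplexMap H (fun x => a • x)

/-- The Euclidean metric. -/
def euclideanMetric (_p u v : E4) : ℝ :=
  u 0 * v 0 + u 1 * v 1 + u 2 * v 2 + u 3 * v 3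

/-- The metric `r⁻⁴ (dx² + dy² + dz² + dt²)`. -/
def invertedMetric (p u v : E4) : ℝ :=
  (‖p‖ ^ 4)⁻¹ * euclideanMetric p u v

/-- The metric `(dx² + dy²) + (ds² + s² dt²)`, in the coordinates `(x, y, s, t)`. -/
def planeTimesConeMetric (p u v : E4) : ℝ :=
  u 0 * v 0 + u 1 * v 1 + (u 2 * v 2 + p 2 ^ 2 * (u 3 * v 3))

/-- The 1-form `dz - (1/2) (x dy - y dx)`, in the coordinates `(s, x, y, z)`. -/
def connectionForm (p u : E4) : ℝ :=
  u 3 - (1 / 2) * (p 1 * u 2 - p 2 * u 1)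

/-- The metric `s (ds² + dx² + dy²) + s⁻¹ (dz - (1/2) (x dy - y dx))²`, in the coordinates
`(s, x, y, z)`. -/
def gibbonsHawkingMetric (p u v : E4) : ℝ :=
  p 0 * (u 0 * v 0 + u 1 * v 1 + u 2 * v 2)
    + (p 0)⁻¹ * (connectionForm p u * connectionForm p v)

end

/-!
The simply transitive action identifies `M` with the acting group, so that `M` itself becomes a Lie
group for which `g` and the complex structures are left-invariant
(`exists_lieGroup_of_simplyTransitive`). The orbit map is an immersion because it is injective, and
it is onto, so the group has dimension four because smooth maps do not raise Hausdorff dimension.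

Write `g = e^f h`. Evaluated on left-invariant fields, the closedness of the three Kähler forms of
`h` expresses `df` through the structure constants; hence `df` is left-invariant
(`IsLeftInvariant.lieD_eq`). The remaining linear equations say that, in a basis
`v, J₁ v, J₂ v, J₃ v` identified with the quaternion units, the bracket is
`[X, Y] = Y p(X) - X p(Y)` for a quaternion-valued form `p` with `df = -2 Re p`: the connection
`D_X Y = Y p(X)`, which commutes with the complex structures, is torsion-free
(`IsQuatStruct.exists_connection`).

If `df = 0`, then `p` is imaginary and has a kernel; taking `v` in the kernel, the Jacobi identity
forces the bracket to vanish (`IsQuatStruct.eq_zero`). If `df ≠ 0`, take `v` along the gradient of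
`f`, scaled so that `df v = 2`. Since `df` vanishes on brackets, the bracket is then described by a
symmetric `3 × 3` matrix; in an orthonormal basis of eigenvectors the Jacobi identity leaves four
possibilities (`modelConstants`, `IsLeftInvariant.exists_frame`).

Each of the five brackets is realised by a frame on the domain of one of the five listed metrics. The
frame is orthogonal with vectors of equal length, and invariant under a group acting simply
transitively on the domain: translations, affine groups, or the multiplication of non-zero
quaternions (`IsModel`). A germ of a map carrying the invariant frame of `M` to that of the
model is found by successive integration of closed forms (`IsStructFrame.exists_local_primitive`); for
the quaternions, whose Lie algebra is not solvable, it is read off from the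
adjoint representation (`lieD_adInv`, `exists_germ_quaternion`). Frame-preserving germs are
determined by one value and can be moved by the translations on both sides, so they form a covering
and the germ extends to all of `M` by monodromy (`exists_global_of_uniquely_continuable`). The same
applies to the inverse germ, since the domains of the models are simply connected, and the result is
a diffeomorphism (`HomogeneousFrame.exists_diffeomorphism`). It is a homothety from `h` to the model
metric: both metrics are conformal to the one with orthonormal frame, with factors having the same
logarithmic derivatives along the frame (`IsModel.isHomotheticTo`).
-/

/-! ### Monodromy for uniquely continuable germs -/

/-- Every covering of `X` has a continuous section through each of its points. -/
def HasCoveringSections.{u, v} (X : Type u) [TopologicalSpace X] : Prop :=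
  ∀ (N : Type v) [TopologicalSpace N] (p : N → X), IsCoveringMap p →
    ∀ n : N, ∃ s : X → N, Continuous s ∧ (∀ x, p (s x) = x) ∧ s (p n) = n

theorem hasCoveringSections_of_simplyConnected (X : Type*) [TopologicalSpace X]
    [SimplyConnectedSpace X] [LocallyPathConnectedSpace X] : HasCoveringSections X := by
  intro N _ p hp n
  obtain ⟨s, ⟨h1, h2⟩, -⟩ :=
    hp.existsUnique_continuousMap_lifts (ContinuousMap.id X) (p n) n rfl
  exact ⟨s, s.continuous, fun x => congrFun h2 x, h1⟩

open Set Filter Topology in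
/-- Monodromy principle. Let `S x F` say that the germ at `x` of the map `F` is admissible.
If two admissible germs at a point agree as soon as their values agree, and if near every point
admissible maps exist on a common neighbourhood with every prescribed value, then on a space whose
coverings have sections there is a global map, with prescribed value at a point, all of whose germs
are admissible: the set `X × Y` of admissible germs, with the topology generated by the graphs of
admissible maps, is a covering of `X`. -/
theorem exists_global_of_uniquely_continuable.{u, v}
    {X : Type u} {Y : Type v} [TopologicalSpace X] (hX : HasCoveringSections.{u, max u v} X)
    (S : X → (X → Y) → Prop)
    (congr : ∀ x F F', F =ᶠ[𝓝 x] F' → S x F → S x F')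
    (uniq : ∀ x F F', S x F → S x F' → F x = F' x → F =ᶠ[𝓝 x] F')
    (exist : ∀ x, ∃ W : Set X, IsOpen W ∧ x ∈ W ∧ ∃ Φ : Y → X → Y,
      ∀ z ∈ W, (∀ y, S z (Φ y)) ∧ Function.Bijective (fun y => Φ y z))
    (x₀ : X) (y₀ : Y) :
    ∃ F : X → Y, F x₀ = y₀ ∧ ∀ x, S x F := by
  let : TopologicalSpace (X × Y) :=
    { IsOpen := fun s => ∀ p ∈ s, ∀ F, S p.1 F → F p.1 = p.2 → ∀ᶠ z in 𝓝 p.1, (z, F z) ∈ s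
      isOpen_univ := fun _ _ _ _ _ => Eventually.of_forall fun _ => mem_univ _
      isOpen_inter := fun s t hs ht p hp F hF hFp =>
        (hs p hp.1 F hF hFp).and (ht p hp.2 F hF hFp)
      isOpen_sUnion := fun c hc p ⟨s, hs, hp⟩ F hF hFp =>
        (hc s hs p hp F hF hFp).mono fun _ hz => ⟨s, hs, hz⟩ }
  have isOpen_def : ∀ s : Set (X × Y), IsOpen s ↔
      ∀ p ∈ s, ∀ F, S p.1 F → F p.1 = p.2 → ∀ᶠ z in 𝓝 p.1, (z, F z) ∈ s := fun _ => Iff.rfl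
  let : TopologicalSpace Y := ⊥
  have : DiscreteTopology Y := ⟨rfl⟩
  have : Nonempty Y := ⟨y₀⟩
  have : Nonempty (X → X × Y) := ⟨fun x => (x, y₀)⟩
  choose W W_open W_mem Φ hΦ using exist
  have graph_open : ∀ x y s, s ⊆ W x →
      (IsOpen s ↔ IsOpen ((Prod.fst : X × Y → X) ⁻¹' s ∩ {p | p.1 ∈ W x ∧ Φ x y p.1 = p.2})) := by
    intro x y s hs
    constructor
    · intro h
      rw [isOpen_def]
      rintro ⟨z, v⟩ ⟨hz, hzW, hv⟩ F hF hFz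
      obtain rfl : Φ x y z = v := hv
      have h1 := uniq z F (Φ x y) hF ((hΦ x z hzW).1 y) hFz
      filter_upwards [h1, h.mem_nhds hz] with z' h1 h2
      exact ⟨h2, hs h2, h1.symm⟩
    · intro h
      rw [isOpen_iff_mem_nhds]
      intro z hz
      have := h (z, Φ x y z) ⟨hz, hs hz, rfl⟩ (Φ x y) ((hΦ x z (hs hz)).1 y) rfl
      exact this.mono fun z' hz' => hz'.1
  have cov : IsCoveringMap (Prod.fst : X × Y → X) := by
    refine IsCoveringMap.mk _ (fun _ => Y) (fun x => IsOpen.trivializationDiscrete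
      (fun y => {p : X × Y | p.1 ∈ W x ∧ Φ x y p.1 = p.2}) (W x) (W_open x)
      (fun y s hs => graph_open x y s hs) ?_ ?_ ?_ ?_) ?_
    · rintro y ⟨z, v⟩ ⟨-, h1⟩ ⟨z', v'⟩ ⟨-, h2⟩ h
      obtain rfl : z = z' := h
      exact Prod.ext rfl (h1.symm.trans h2)
    · intro y z hz
      exact ⟨(z, Φ x y z), ⟨hz, rfl⟩, rfl⟩
    · intro y y' hne
      rw [Function.onFun, Set.disjoint_left]
      rintro ⟨z, v⟩ ⟨hz, h1⟩ ⟨-, h2⟩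
      exact hne ((hΦ x z hz).2.1 (h1.trans h2.symm))
    · rintro ⟨z, v⟩ hz
      obtain ⟨y, hy⟩ := (hΦ x z hz).2.2 v
      exact mem_iUnion.2 ⟨y, hz, hy⟩
    · exact W_mem
  obtain ⟨L, hLc, hL1, hL0⟩ := hX (X × Y) Prod.fst cov (x₀, y₀)
  replace hL0 : L x₀ = (x₀, y₀) := hL0
  refine ⟨fun x => (L x).2, by simp only [hL0], fun x => ?_⟩
  obtain ⟨y, hy⟩ := (hΦ x x (W_mem x)).2.2 (L x).2
  refine congr x (Φ x y) _ ?_ ((hΦ x x (W_mem x)).1 y)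
  have h1 := (graph_open x y (W x) subset_rfl).1 (W_open x)
  have h2 : L x ∈ (Prod.fst : X × Y → X) ⁻¹' W x ∩ {p | p.1 ∈ W x ∧ Φ x y p.1 = p.2} := by
    simp only [mem_inter_iff, mem_preimage, mem_ofPred_eq, hL1]
    exact ⟨W_mem x, W_mem x, hy⟩
  have h3 := hLc.continuousAt.preimage_mem_nhds (h1.mem_nhds h2)
  filter_upwards [h3] with z hz
  have := hz.2.2
  rwa [hL1] at this

open Set in
theorem hasCoveringSections_of_starConvex {V : Type*} [NormedAddCommGroup V] [NormedSpace ℝ V]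
    {U : Set V} (hU : IsOpen U) {x : V} (hx : StarConvex ℝ x U) (hne : U.Nonempty) :
    HasCoveringSections U := by
  have := hx.contractibleSpace hne
  have := hU.locallyPathConnectedSpace
  exact hasCoveringSections_of_simplyConnected U

open Set Topology in
/-- Sections over two open sets covering `X`, both through the same point, glue when the
intersection of the two sets is connected. -/
theorem hasCoveringSections_union.{u, v} {X : Type u} [TopologicalSpace X] {A B : Set X}
    (hA : IsOpen A) (hB : IsOpen B) (hAB : A ∪ B = univ) (hconn : IsConnected (A ∩ B))
    (sA : HasCoveringSections.{u, v} A) (sB : HasCoveringSections.{u, v} B) :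
    HasCoveringSections.{u, v} X := by
  classical
  intro N _ p hp n
  -- a section over an open set `C`, extended by a junk value
  have key : ∀ C : Set X, IsOpen C → HasCoveringSections.{u, v} C → ∀ m : N, p m ∈ C →
      ∃ s : X → N, ContinuousOn s C ∧ (∀ x ∈ C, p (s x) = x) ∧ s (p m) = m := by
    intro C hC sC m hm
    obtain ⟨s, hs, h1, h2⟩ := sC (p ⁻¹' C) (C.restrictPreimage p) (hp.restrictPreimage C) ⟨m, hm⟩
    refine ⟨fun x => if h : x ∈ C then s ⟨x, h⟩ else m, ?_, ?_, ?_⟩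
    · rw [continuousOn_iff_continuous_domRestrict]
      refine (continuous_subtype_val.comp hs).congr fun x => ?_
      simp
    · intro x hx
      simpa [hx] using congrArg Subtype.val (h1 ⟨x, hx⟩)
    · simpa [hm] using congrArg Subtype.val h2
  have glue : ∀ C D : Set X, IsOpen C → IsOpen D → C ∪ D = univ → IsConnected (C ∩ D) →
      HasCoveringSections.{u, v} C → HasCoveringSections.{u, v} D → p n ∈ C →
      ∃ s : X → N, Continuous s ∧ (∀ x, p (s x) = x) ∧ s (p n) = n := by
    intro C D hC hD hCD hconn sC sD hn
    obtain ⟨s, hs, h1, h2⟩ := key C hC sC n hn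
    obtain ⟨x, hxC, hxD⟩ := hconn.nonempty
    obtain ⟨t, ht, h3, h4⟩ := key D hD sD (s x) (by rwa [h1 x hxC])
    rw [h1 x hxC] at h4
    have hst : EqOn s t (C ∩ D) := by
      refine hp.eqOn_of_comp_eqOn hconn.isPreconnected (hs.mono inter_subset_left)
        (ht.mono inter_subset_right) (fun y hy => ?_) ⟨hxC, hxD⟩ h4.symm
      simp [h1 y hy.1, h3 y hy.2]
    have hD' : ∀ y, y ∉ C → y ∈ D := fun y hy =>
      ((eq_univ_iff_forall.1 hCD) y).resolve_left hy
    refine ⟨fun y => if y ∈ C then s y else t y, ?_, fun y => ?_, by simp [hn, h2]⟩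
    · rw [continuous_iff_continuousAt]
      intro y
      by_cases hy : y ∈ C
      · refine (hs.continuousAt (hC.mem_nhds hy)).congr ?_
        filter_upwards [hC.mem_nhds hy] with z hz
        simp [hz]
      · refine (ht.continuousAt (hD.mem_nhds (hD' y hy))).congr ?_
        filter_upwards [hD.mem_nhds (hD' y hy)] with z hz
        by_cases hzC : z ∈ C
        · simp [hzC, hst ⟨hzC, hz⟩]
        · simp [hzC]
    · by_cases hy : y ∈ C
      · simp [hy, h1]
      · simp [hy, h3 y (hD' y hy)]
  rcases (eq_univ_iff_forall.1 hAB) (p n) with h | h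
  · exact glue A B hA hB hAB hconn sA sB h
  · exact glue B A hB hA (by rw [union_comm, hAB]) (by rwa [inter_comm]) sB sA h

theorem HasCoveringSections.of_homeomorph.{u, v} {X Y : Type u} [TopologicalSpace X]
    [TopologicalSpace Y] (h : HasCoveringSections.{u, v} X) (e : X ≃ₜ Y) :
    HasCoveringSections.{u, v} Y := by
  intro N _ p hp n
  obtain ⟨s, hs, h1, h2⟩ := h N _ (hp.homeomorph_comp e.symm) n
  refine ⟨s ∘ e.symm, hs.comp e.symm.continuous, fun y => ?_, h2⟩
  exact e.symm.injective (h1 (e.symm y))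

open Set in
/-- The punctured space is the union of two star-shaped open sets, the complements of two opposite
closed rays; their intersection is the complement of a line, which is connected. -/
theorem hasCoveringSections_compl_zero : HasCoveringSections {p : E4 | p ≠ 0} := by
  let A : ℝ → Set E4 := fun c => {p | p 1 ≠ 0 ∨ p 2 ≠ 0 ∨ p 3 ≠ 0 ∨ c * p 0 < 0}
  have A_open : ∀ c, IsOpen (A c) := by
    intro c
    have h : ∀ i : Fin 4, IsOpen {p : E4 | p i ≠ 0} := fun i =>
      isOpen_ne_fun (by fun_prop) continuous_const
    have h' : IsOpen {p : E4 | c * p 0 < 0} := isOpen_lt (by fun_prop) continuous_const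
    exact (h 1).union ((h 2).union ((h 3).union h'))
  have A_sub : ∀ c, A c ⊆ {p : E4 | p ≠ 0} := by
    rintro c p hp rfl
    simp [A] at hp
  have A_star : ∀ c, c ≠ 0 → StarConvex ℝ (EuclideanSpace.single 0 (-c) : E4) (A c) := by
    intro c hc p hp a b ha hb hab
    simp only [A, mem_ofPred_eq, PiLp.add_apply, PiLp.smul_apply, smul_eq_mul,
      PiLp.single_apply] at hp ⊢
    have hcc : 0 < c * c := mul_self_pos.2 hc
    rcases hb.eq_or_lt with rfl | hb
    · have : a = 1 := by linarith
      subst this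
      right; right; right
      simp
      nlinarith
    · rcases hp with h | h | h | h
      · left; simp [h, hb.ne']
      · right; left; simp [h, hb.ne']
      · right; right; left; simp [h, hb.ne']
      · right; right; right
        simp
        nlinarith [mul_pos hb (neg_pos.2 h), mul_nonneg ha hcc.le]
  have A_sec : ∀ c, c ≠ 0 →
      HasCoveringSections ((Subtype.val : {p : E4 | p ≠ 0} → E4) ⁻¹' A c) := by
    intro c hc
    have h1 : HasCoveringSections (A c) := hasCoveringSections_of_starConvex (A_open c)
      (A_star c hc) ⟨EuclideanSpace.single 0 (-c), by
        right; right; right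
        have hcc : 0 < c * c := mul_self_pos.2 hc
        simp
        nlinarith⟩
    refine h1.of_homeomorph
      { toFun := fun p => ⟨⟨p.1, A_sub c p.2⟩, p.2⟩
        invFun := fun p => ⟨p.1.1, p.2⟩
        left_inv := fun _ => rfl
        right_inv := fun _ => rfl
        continuous_toFun := by fun_prop
        continuous_invFun := by fun_prop }
  refine hasCoveringSections_union ((A_open 1).preimage continuous_subtype_val)
    ((A_open (-1)).preimage continuous_subtype_val) ?_ ?_ (A_sec 1 (by norm_num))
    (A_sec (-1) (by norm_num))
  · rw [← preimage_union, preimage_eq_univ_iff, Subtype.range_coe_subtype]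
    intro p hp
    by_contra hne
    simp only [A, mem_union, mem_ofPred_eq, not_or, not_not, not_lt] at hne
    obtain ⟨⟨h1, h2, h3, h4⟩, -, -, -, h5⟩ := hne
    apply hp
    ext i
    have h0 : p 0 = 0 := by linarith
    fin_cases i <;> simp [h0, h1, h2, h3]
  · have hE : Submodule.span ℝ {(EuclideanSpace.single 0 1 : E4)} =
        {p : E4 | p 1 = 0 ∧ p 2 = 0 ∧ p 3 = 0} := by
      ext p
      rw [SetLike.mem_coe, Submodule.mem_span_singleton]
      constructor
      · rintro ⟨a, rfl⟩
        simp
      · rintro ⟨h1, h2, h3⟩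
        refine ⟨p 0, ?_⟩
        ext i
        fin_cases i <;> simp [h1, h2, h3]
    have hAB : A 1 ∩ A (-1) = (Submodule.span ℝ {(EuclideanSpace.single 0 1 : E4)} : Set E4)ᶜ := by
      rw [hE]
      ext p
      simp only [A, mem_inter_iff, mem_ofPred_eq, mem_compl_iff]
      constructor
      · rintro ⟨h, h'⟩ ⟨h1, h2, h3⟩
        simp only [h1, h2, h3, ne_eq, not_true_eq_false, false_or] at h h'
        linarith
      · intro h
        by_cases h1 : p 1 = 0 <;> by_cases h2 : p 2 = 0 <;> by_cases h3 : p 3 = 0 <;>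
          simp_all
    have hconn : IsConnected (A 1 ∩ A (-1)) := by
      rw [hAB]
      apply isConnected_compl_of_one_lt_codim
      have h1 := Submodule.finrank_quotient_add_finrank
        (Submodule.span ℝ {(EuclideanSpace.single 0 1 : E4)})
      rw [finrank_span_singleton (by simp), finrank_euclideanSpace_fin] at h1
      rw [← Module.finrank_eq_rank, Nat.one_lt_cast]
      linarith
    rw [← preimage_inter]
    refine ⟨?_, ?_⟩
    · obtain ⟨p, hp⟩ := hconn.nonempty
      exact ⟨⟨p, A_sub _ hp.1⟩, hp⟩
    · rw [← Topology.IsInducing.subtypeVal.isPreconnected_image, Subtype.image_preimage_coe,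
        inter_eq_right.2 (inter_subset_left.trans (A_sub 1))]
      exact hconn.isPreconnected

/-! ### Derivatives along vector fields -/

section LieDerivative

open Set Filter Topology VectorField

variable {M : Type*} [TopologicalSpace M] [ChartedSpace E4 M]
  {F : Type*} [NormedAddCommGroup F] [NormedSpace ℝ F]
  {F' : Type*} [NormedAddCommGroup F'] [NormedSpace ℝ F']

/-- The derivative of a map between manifolds modelled on normed spaces, regarded as a continuous
linear map between the model spaces. -/
noncomputable def mD (E : Type*) [NormedAddCommGroup E] [NormedSpace ℝ E]
    (E' : Type*) [NormedAddCommGroup E'] [NormedSpace ℝ E']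
    {N : Type*} [TopologicalSpace N] [ChartedSpace E N]
    {N' : Type*} [TopologicalSpace N'] [ChartedSpace E' N'] (f : N → N') (x : N) : E →L[ℝ] E' :=
  mfderiv 𝓘(ℝ, E) 𝓘(ℝ, E') f x

section General

variable {E₁ : Type*} [NormedAddCommGroup E₁] [NormedSpace ℝ E₁]
  {E₂ : Type*} [NormedAddCommGroup E₂] [NormedSpace ℝ E₂]
  {E₃ : Type*} [NormedAddCommGroup E₃] [NormedSpace ℝ E₃]
  {N₁ : Type*} [TopologicalSpace N₁] [ChartedSpace E₁ N₁]
  {N₂ : Type*} [TopologicalSpace N₂] [ChartedSpace E₂ N₂]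
  {N₃ : Type*} [TopologicalSpace N₃] [ChartedSpace E₃ N₃]

theorem mD_comp {f : N₁ → N₂} {g : N₂ → N₃} {x : N₁}
    (hg : MDifferentiableAt 𝓘(ℝ, E₂) 𝓘(ℝ, E₃) g (f x))
    (hf : MDifferentiableAt 𝓘(ℝ, E₁) 𝓘(ℝ, E₂) f x) :
    mD E₁ E₃ (fun y => g (f y)) x = (mD E₂ E₃ g (f x)).comp (mD E₁ E₂ f x) :=
  mfderiv_comp x hg hf

theorem mD_eq_of_hasMFDerivAt {f : N₁ → N₂} {x : N₁} {L : E₁ →L[ℝ] E₂}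
    (h : HasMFDerivAt 𝓘(ℝ, E₁) 𝓘(ℝ, E₂) f x L) : mD E₁ E₂ f x = L :=
  h.mfderiv

theorem mD_congr {f g : N₁ → N₂} {x : N₁} (h : f =ᶠ[𝓝 x] g) : mD E₁ E₂ f x = mD E₁ E₂ g x :=
  h.mfderiv_eq

theorem mD_eq_fderiv {f : E₁ → E₂} {x : E₁} : mD E₁ E₂ f x = fderiv ℝ f x :=
  mfderiv_eq_fderiv

theorem mD_id {x : N₁} : mD E₁ E₁ (fun y : N₁ => y) x = ContinuousLinearMap.id ℝ E₁ :=
  mfderiv_id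

theorem mD_const {x : N₁} {c : N₂} : mD E₁ E₂ (fun _ : N₁ => c) x = 0 :=
  mfderiv_const

/-- If `g` is a local left inverse of `f`, then so are the derivatives. -/
theorem mD_comp_eq_id {f : N₁ → N₂} {g : N₂ → N₁} {x : N₁}
    (hg : MDifferentiableAt 𝓘(ℝ, E₂) 𝓘(ℝ, E₁) g (f x))
    (hf : MDifferentiableAt 𝓘(ℝ, E₁) 𝓘(ℝ, E₂) f x) (h : ∀ᶠ y in 𝓝 x, g (f y) = y) :
    (mD E₂ E₁ g (f x)).comp (mD E₁ E₂ f x) = ContinuousLinearMap.id ℝ E₁ := by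
  rw [← mD_comp hg hf, mD_congr h, mD_id]

end General

/-- The derivative at `x` of a function `f` with values in a normed space along the vector
field `X`. -/
noncomputable def lieD (X : M → E4) (f : M → F) (x : M) : F := mD E4 F f x (X x)

theorem derivAlong_eq_lieD (X : M → E4) (f : M → ℝ) (x : M) :
    derivAlong X f x = lieD X f x := rfl

theorem lieD_congr {X : M → E4} {f g : M → F} {x : M}
    (h : f =ᶠ[𝓝 x] g) : lieD X f x = lieD X g x := by
  rw [lieD, lieD, mD_congr h]

theorem lieD_const (X : M → E4) (c : F) (x : M) : lieD X (fun _ => c) x = 0 := by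
  rw [lieD, mD_const, zero_apply]

theorem lieD_comp {X : M → E4} {f : M → F} {g : F → F'} {x : M}
    (hg : DifferentiableAt ℝ g (f x)) (hf : MDifferentiableAt 𝓘(ℝ, E4) 𝓘(ℝ, F) f x) :
    lieD X (fun y => g (f y)) x = fderiv ℝ g (f x) (lieD X f x) := by
  rw [lieD, mD_comp hg.mdifferentiableAt hf, mD_eq_fderiv]
  rfl

theorem lieD_comp_deriv {X : M → E4} {f : M → ℝ} {g : ℝ → ℝ} {g' : ℝ}
    {x : M} (hg : HasDerivAt g g' (f x)) (hf : MDifferentiableAt 𝓘(ℝ, E4) 𝓘(ℝ, ℝ) f x) :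
    lieD X (fun y => g (f y)) x = g' * lieD X f x := by
  rw [lieD_comp hg.differentiableAt hf, hg.hasFDerivAt.fderiv]
  simp [mul_comm]

theorem lieD_clm {X : M → E4} {f : M → F} {x : M} (L : F →L[ℝ] F')
    (hf : MDifferentiableAt 𝓘(ℝ, E4) 𝓘(ℝ, F) f x) :
    lieD X (fun y => L (f y)) x = L (lieD X f x) := by
  rw [lieD_comp L.differentiableAt hf, L.fderiv]

theorem lieD_add {X : M → E4} {f g : M → F} {x : M}
    (hf : MDifferentiableAt 𝓘(ℝ, E4) 𝓘(ℝ, F) f x)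
    (hg : MDifferentiableAt 𝓘(ℝ, E4) 𝓘(ℝ, F) g x) :
    lieD X (fun y => f y + g y) x = lieD X f x + lieD X g x := by
  rw [lieD, show mD E4 F (fun y => f y + g y) x = mD E4 F f x + mD E4 F g x from
    mD_eq_of_hasMFDerivAt (hf.hasMFDerivAt.add hg.hasMFDerivAt)]
  rfl

theorem lieD_mul {X : M → E4} {f g : M → ℝ} {x : M}
    (hf : MDifferentiableAt 𝓘(ℝ, E4) 𝓘(ℝ, ℝ) f x)
    (hg : MDifferentiableAt 𝓘(ℝ, E4) 𝓘(ℝ, ℝ) g x) :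
    lieD X (fun y => f y * g y) x = f x * lieD X g x + g x * lieD X f x := by
  rw [lieD, show mD E4 ℝ (fun y => f y * g y) x = f x • mD E4 ℝ g x + g x • mD E4 ℝ f x from
    mD_eq_of_hasMFDerivAt (hf.hasMFDerivAt.mul hg.hasMFDerivAt)]
  rfl

theorem lieD_const_mul {X : M → E4} {f : M → ℝ} {x : M} (c : ℝ)
    (hf : MDifferentiableAt 𝓘(ℝ, E4) 𝓘(ℝ, ℝ) f x) :
    lieD X (fun y => c * f y) x = c * lieD X f x := by
  rw [lieD_mul mdifferentiableAt_const hf, lieD_const, mul_zero, add_zero]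

/-- The Lie bracket of two vector fields, regarded as maps to the model space. -/
noncomputable def bracket (X Y : M → E4) (x : M) : E4 := mlieBracket 𝓘(ℝ, E4) X Y x

/-- The expression of the vector field `X` in the preferred chart at `x₀`. -/
noncomputable def chartField (X : M → E4) (x₀ : M) (y : E4) : E4 :=
  (mD E4 E4 (extChartAt 𝓘(ℝ, E4) x₀).symm y).inverse (X ((extChartAt 𝓘(ℝ, E4) x₀).symm y))

theorem chartField_eq_mpullbackWithin (X : M → E4) (x₀ : M) :
    chartField X x₀ = mpullbackWithin 𝓘(ℝ, E4) 𝓘(ℝ, E4) (extChartAt 𝓘(ℝ, E4) x₀).symm X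
      (range 𝓘(ℝ, E4)) := by
  have h : range 𝓘(ℝ, E4) = univ := by simp
  rw [h]
  exact (mpullbackWithin_univ (I := 𝓘(ℝ, E4)) (I' := 𝓘(ℝ, E4))).symm

variable [IsManifold 𝓘(ℝ, E4) ∞ M]

theorem contMDiffAt_chart_symm {x₀ : M} {y : E4} (hy : y ∈ (extChartAt 𝓘(ℝ, E4) x₀).target) :
    ContMDiffAt 𝓘(ℝ, E4) 𝓘(ℝ, E4) ∞ (extChartAt 𝓘(ℝ, E4) x₀).symm y :=
  (contMDiffOn_extChartAt_symm x₀).contMDiffAt ((isOpen_extChartAt_target x₀).mem_nhds hy)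

theorem isInvertible_mD_chart_symm {x₀ : M} {y : E4}
    (hy : y ∈ (extChartAt 𝓘(ℝ, E4) x₀).target) :
    (mD E4 E4 (extChartAt 𝓘(ℝ, E4) x₀).symm y).IsInvertible := by
  have h1 := isInvertible_mfderivWithin_extChartAt_symm (I := 𝓘(ℝ, E4)) hy
  rw [show range 𝓘(ℝ, E4) = univ by simp, mfderivWithin_univ] at h1
  exact h1

theorem isInvertible_mD_chart (x₀ : M) :
    (mD E4 E4 (extChartAt 𝓘(ℝ, E4) x₀) x₀).IsInvertible :=
  isInvertible_mfderiv_extChartAt (I := 𝓘(ℝ, E4)) (mem_extChartAt_source (I := 𝓘(ℝ, E4)) x₀)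

theorem mD_chart_symm_chartField (X : M → E4) {x₀ : M} {y : E4}
    (hy : y ∈ (extChartAt 𝓘(ℝ, E4) x₀).target) :
    mD E4 E4 (extChartAt 𝓘(ℝ, E4) x₀).symm y (chartField X x₀ y)
      = X ((extChartAt 𝓘(ℝ, E4) x₀).symm y) :=
  (isInvertible_mD_chart_symm hy).self_apply_inverse _

/-- Differentiation along a vector field, in a chart. -/
theorem fderiv_chart_eq_lieD (X : M → E4) {x₀ : M} {y : E4}
    (hy : y ∈ (extChartAt 𝓘(ℝ, E4) x₀).target) {f : M → F}
    (hf : MDifferentiableAt 𝓘(ℝ, E4) 𝓘(ℝ, F) f ((extChartAt 𝓘(ℝ, E4) x₀).symm y)) :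
    fderiv ℝ (fun z => f ((extChartAt 𝓘(ℝ, E4) x₀).symm z)) y (chartField X x₀ y)
      = lieD X f ((extChartAt 𝓘(ℝ, E4) x₀).symm y) := by
  rw [← mD_eq_fderiv, mD_comp hf ((contMDiffAt_chart_symm hy).mdifferentiableAt (by simp)),
    ContinuousLinearMap.comp_apply, mD_chart_symm_chartField X hy, lieD]

theorem contDiffAt_chartField {X : M → E4} (hX : SmoothVF X) (x₀ : M) :
    ContDiffAt ℝ ∞ (chartField X x₀) (extChartAt 𝓘(ℝ, E4) x₀ x₀) := by
  have h := contMDiffWithinAt_mpullbackWithin_extChartAt_symm (n := ∞) (m := ∞)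
    (hX.contMDiffAt (x := x₀)).contMDiffWithinAt uniqueMDiffOn_univ (mem_univ x₀) (by simp)
  have h2 := contMDiffWithinAt_vectorSpace_iff_contDiffWithinAt.1 h
  rw [← chartField_eq_mpullbackWithin] at h2
  refine ContDiffWithinAt.contDiffAt h2 ?_
  rw [preimage_univ, inter_univ]
  exact (isOpen_extChartAt_target x₀).mem_nhds (mem_extChartAt_target x₀)

theorem contDiffAt_comp_chart_symm {f : M → F} {x₀ : M}
    (hf : ContMDiffAt 𝓘(ℝ, E4) 𝓘(ℝ, F) ∞ f x₀) :
    ContDiffAt ℝ ∞ (fun z => f ((extChartAt 𝓘(ℝ, E4) x₀).symm z))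
      (extChartAt 𝓘(ℝ, E4) x₀ x₀) := by
  rw [← contMDiffAt_iff_contDiffAt]
  refine ContMDiffAt.comp (g := f) _ ?_ (contMDiffAt_chart_symm (mem_extChartAt_target x₀))
  rwa [extChartAt_to_inv]

theorem eventually_mdifferentiableAt {f : M → F} {x₀ : M}
    (hf : ContMDiffAt 𝓘(ℝ, E4) 𝓘(ℝ, F) ∞ f x₀) :
    ∀ᶠ x in 𝓝 x₀, MDifferentiableAt 𝓘(ℝ, E4) 𝓘(ℝ, F) f x := by
  filter_upwards [(contMDiffAt_iff_contMDiffAt_nhds (n := 1) (by simp)).1 (hf.of_le (by simp))] with x hx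
  exact hx.mdifferentiableAt (by simp)

theorem tendsto_chart_symm (x₀ : M) :
    Tendsto (extChartAt 𝓘(ℝ, E4) x₀).symm (𝓝 (extChartAt 𝓘(ℝ, E4) x₀ x₀)) (𝓝 x₀) := by
  have h := (contMDiffAt_chart_symm (mem_extChartAt_target (I := 𝓘(ℝ, E4)) x₀)).continuousAt
  rwa [ContinuousAt, extChartAt_to_inv] at h

theorem eventually_fderiv_chart_eq_lieD (X : M → E4) {f : M → F} {x₀ : M}
    (hf : ContMDiffAt 𝓘(ℝ, E4) 𝓘(ℝ, F) ∞ f x₀) :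
    (fun y => fderiv ℝ (fun z => f ((extChartAt 𝓘(ℝ, E4) x₀).symm z)) y (chartField X x₀ y))
      =ᶠ[𝓝 (extChartAt 𝓘(ℝ, E4) x₀ x₀)]
        fun y => lieD X f ((extChartAt 𝓘(ℝ, E4) x₀).symm y) := by
  filter_upwards [(tendsto_chart_symm x₀).eventually (eventually_mdifferentiableAt hf),
    (isOpen_extChartAt_target x₀).mem_nhds (mem_extChartAt_target (I := 𝓘(ℝ, E4)) x₀)]
    with y hy hy'
  exact fderiv_chart_eq_lieD X hy' hy

theorem contMDiffAt_of_comp_chart_symm {f : M → F} {x₀ : M}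
    (h : ContDiffAt ℝ ∞ (fun z => f ((extChartAt 𝓘(ℝ, E4) x₀).symm z))
      (extChartAt 𝓘(ℝ, E4) x₀ x₀)) : ContMDiffAt 𝓘(ℝ, E4) 𝓘(ℝ, F) ∞ f x₀ := by
  have h1 := (contMDiffAt_iff_contDiffAt.2 h).comp x₀
    (contMDiffAt_extChartAt (I := 𝓘(ℝ, E4)) (n := ∞) (x := x₀))
  refine h1.congr_of_eventuallyEq ?_
  filter_upwards [extChartAt_source_mem_nhds (I := 𝓘(ℝ, E4)) x₀] with x hx
  simp only [Function.comp_apply, (extChartAt 𝓘(ℝ, E4) x₀).left_inv hx]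

theorem contMDiffAt_lieD {X : M → E4} (hX : SmoothVF X) {f : M → F}
    {x₀ : M} (hf : ContMDiffAt 𝓘(ℝ, E4) 𝓘(ℝ, F) ∞ f x₀) :
    ContMDiffAt 𝓘(ℝ, E4) 𝓘(ℝ, F) ∞ (lieD X f) x₀ := by
  apply contMDiffAt_of_comp_chart_symm
  refine ContDiffAt.congr_of_eventuallyEq ?_ (eventually_fderiv_chart_eq_lieD X hf).symm
  exact ((contDiffAt_comp_chart_symm hf).fderiv_right (by simp)).clm_apply
    (contDiffAt_chartField hX x₀)

theorem bracket_eq_chart (X Y : M → E4) (x₀ : M) :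
    bracket X Y x₀ = (mD E4 E4 (extChartAt 𝓘(ℝ, E4) x₀) x₀).inverse
      (lieBracket ℝ (chartField X x₀) (chartField Y x₀) (extChartAt 𝓘(ℝ, E4) x₀ x₀)) := by
  have h : ∀ V W : ∀ x : M, TangentSpace 𝓘(ℝ, E4) x, (mlieBracket 𝓘(ℝ, E4) V W x₀ : E4) =
      (mD E4 E4 (extChartAt 𝓘(ℝ, E4) x₀) x₀).inverse
        (lieBracket ℝ
          (mpullbackWithin 𝓘(ℝ, E4) 𝓘(ℝ, E4) (extChartAt 𝓘(ℝ, E4) x₀).symm V (range 𝓘(ℝ, E4)))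
          (mpullbackWithin 𝓘(ℝ, E4) 𝓘(ℝ, E4) (extChartAt 𝓘(ℝ, E4) x₀).symm W (range 𝓘(ℝ, E4)))
          (extChartAt 𝓘(ℝ, E4) x₀ x₀)) := by
    intro V W
    rw [← mlieBracketWithin_univ, mlieBracketWithin_apply, preimage_univ, univ_inter]
    nth_rw 3 [show range 𝓘(ℝ, E4) = univ by simp]
    exact congrArg (fun B : E4 → E4 => (mD E4 E4 (extChartAt 𝓘(ℝ, E4) x₀) x₀).inverse
      (B (extChartAt 𝓘(ℝ, E4) x₀ x₀))) lieBracketWithin_univ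
  rw [chartField_eq_mpullbackWithin, chartField_eq_mpullbackWithin]
  exact h X Y

/-- Differentiation along `[X, Y]` is the commutator of the differentiations along `X`
and `Y`. -/
theorem lieD_bracket {X Y : M → E4} (hX : SmoothVF X) (hY : SmoothVF Y) {f : M → F}
    {x₀ : M} (hf : ContMDiffAt 𝓘(ℝ, E4) 𝓘(ℝ, F) ∞ f x₀) :
    lieD (bracket X Y) f x₀ = lieD X (lieD Y f) x₀ - lieD Y (lieD X f) x₀ := by
  set c := extChartAt 𝓘(ℝ, E4) x₀ with hc
  have hx : c x₀ ∈ c.target := mem_extChartAt_target x₀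
  have hcx : c.symm (c x₀) = x₀ := extChartAt_to_inv x₀
  have h0 := contDiffAt_comp_chart_symm hf
  have h1 := fderiv_apply_lieBracket (n := ∞) h0
    (by rw [minSmoothness_of_isRCLikeNormedField]; exact WithTop.coe_le_coe.2 le_top)
    ((contDiffAt_chartField hY x₀).differentiableAt (by simp))
    ((contDiffAt_chartField hX x₀).differentiableAt (by simp))
  rw [(eventually_fderiv_chart_eq_lieD Y hf).fderiv_eq,
    (eventually_fderiv_chart_eq_lieD X hf).fderiv_eq,
    fderiv_chart_eq_lieD X hx (by
      rw [hcx]; exact (contMDiffAt_lieD hY hf).mdifferentiableAt (by simp)),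
    fderiv_chart_eq_lieD Y hx (by
      rw [hcx]; exact (contMDiffAt_lieD hX hf).mdifferentiableAt (by simp)), hcx] at h1
  rw [← h1]
  have h2 : lieBracket ℝ (chartField X x₀) (chartField Y x₀) (c x₀)
      = mD E4 E4 c x₀ (bracket X Y x₀) := by
    rw [bracket_eq_chart, (isInvertible_mD_chart x₀).self_apply_inverse]
  rw [h2, ← mD_eq_fderiv, ← ContinuousLinearMap.comp_apply,
    ← mD_comp (g := fun z => f (c.symm z)) (f := c)]
  · rw [lieD]
    congr 1
    refine mD_congr ?_
    filter_upwards [extChartAt_source_mem_nhds (I := 𝓘(ℝ, E4)) x₀] with x hx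
    rw [c.left_inv hx]
  · exact ((contMDiffAt_iff_contDiffAt.2 h0).mdifferentiableAt (by simp))
  · exact (contMDiffAt_extChartAt (I := 𝓘(ℝ, E4)) (n := ∞) (x := x₀)).mdifferentiableAt (by simp)

end LieDerivative

/-! ### Frames and the Poincaré lemma -/

section Frames

open Set Filter Topology VectorField

variable {M : Type*} [TopologicalSpace M] [ChartedSpace E4 M]
  {F : Type*} [NormedAddCommGroup F] [NormedSpace ℝ F]

/-- The linear map sending the standard basis of `E4` to the given vectors. -/
noncomputable def frameMap (v : Fin 4 → F) : E4 →L[ℝ] F :=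
  ∑ i, (EuclideanSpace.proj i : E4 →L[ℝ] ℝ).smulRight (v i)

theorem frameMap_apply (v : Fin 4 → F) (p : E4) : frameMap v p = ∑ i, p i • v i := by
  simp [frameMap]

theorem frameMap_single (v : Fin 4 → F) (i : Fin 4) :
    frameMap v (EuclideanSpace.single i 1) = v i := by
  simp [frameMap_apply, PiLp.single_apply]

theorem isInvertible_frameMap {v : Fin 4 → E4} (hv : LinearIndependent ℝ v) :
    (frameMap v).IsInvertible := by
  have hinj : Function.Injective (frameMap v) := by
    rw [injective_iff_map_eq_zero]
    intro p hp
    rw [frameMap_apply] at hp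
    ext i
    exact Fintype.linearIndependent_iff.1 hv _ hp i
  exact ⟨(LinearEquiv.ofInjectiveEndo (frameMap v : E4 →ₗ[ℝ] E4) hinj).toContinuousLinearEquiv,
    by ext; rfl⟩

theorem frameMap_inverse {v : Fin 4 → E4} (hv : LinearIndependent ℝ v) (i : Fin 4) :
    (frameMap v).inverse (v i) = EuclideanSpace.single i 1 := by
  rw [← frameMap_single v i, (isInvertible_frameMap hv).inverse_apply_self]

theorem eq_sum_of_linearIndependent {v : Fin 4 → E4} (hv : LinearIndependent ℝ v) (w : E4) :
    w = ∑ i, (frameMap v).inverse w i • v i := by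
  rw [← frameMap_apply, (isInvertible_frameMap hv).self_apply_inverse]

theorem contDiffAt_frameMap {E : Type*} [NormedAddCommGroup E] [NormedSpace ℝ E]
    {v : Fin 4 → E → F} {y : E} (hv : ∀ i, ContDiffAt ℝ ∞ (v i) y) :
    ContDiffAt ℝ ∞ (fun z => frameMap (fun i => v i z)) y := by
  unfold frameMap
  refine ContDiffAt.sum fun i _ => ?_
  exact ((ContinuousLinearMap.smulRightL ℝ E4 F
    (EuclideanSpace.proj i : E4 →L[ℝ] ℝ)).contDiff.contDiffAt).comp y (hv i)

theorem contDiffAt_frameMap_inverse {E : Type*} [NormedAddCommGroup E] [NormedSpace ℝ E]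
    {v : Fin 4 → E → E4} {y : E} (hv : ∀ i, ContDiffAt ℝ ∞ (v i) y)
    (hy : LinearIndependent ℝ (fun i => v i y)) :
    ContDiffAt ℝ ∞ (fun z => (frameMap (fun i => v i z)).inverse) y := by
  obtain ⟨L, hL⟩ := isInvertible_frameMap hy
  exact ContDiffAt.comp y (hL ▸ contDiffAt_map_inverse L) (contDiffAt_frameMap hv)

variable [IsManifold 𝓘(ℝ, E4) ∞ M]

/-- The vector fields `e i` form a smooth frame. -/
structure IsSmoothFrame (e : Fin 4 → M → E4) : Prop where
  smooth : ∀ i, SmoothVF (e i)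
  linearIndependent : ∀ x, LinearIndependent ℝ (fun i => e i x)

/-- The vector fields `e i` form a smooth frame with constant structure functions `c`. -/
structure IsStructFrame (e : Fin 4 → M → E4) (c : Fin 4 → Fin 4 → Fin 4 → ℝ) : Prop
    extends IsSmoothFrame e where
  bracket_eq : ∀ i j x, bracket (e i) (e j) x = ∑ k, c i j k • e k x

theorem contDiffAt_comp_chart_symm' {f : M → F} {x₀ : M} {y : E4}
    (hy : y ∈ (extChartAt 𝓘(ℝ, E4) x₀).target)
    (hf : ContMDiffAt 𝓘(ℝ, E4) 𝓘(ℝ, F) ∞ f ((extChartAt 𝓘(ℝ, E4) x₀).symm y)) :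
    ContDiffAt ℝ ∞ (fun z => f ((extChartAt 𝓘(ℝ, E4) x₀).symm z)) y := by
  rw [← contMDiffAt_iff_contDiffAt]
  exact ContMDiffAt.comp (g := f) _ hf (contMDiffAt_chart_symm hy)

theorem lieD_sum_smul {n : ℕ} (X : Fin n → M → E4) (a : Fin n → ℝ) (Y : M → E4) (f : M → F)
    (x : M) (h : Y x = ∑ i, a i • X i x) : lieD Y f x = ∑ i, a i • lieD (X i) f x := by
  simp only [lieD, h, map_sum, map_smul]

/-- Poincaré lemma in a frame: the equations `e_i u = a_i` have a local solution if
`e_i a_j - e_j a_i = [e_i, e_j] u` holds formally. -/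
theorem IsStructFrame.exists_local_primitive {e : Fin 4 → M → E4}
    {c : Fin 4 → Fin 4 → Fin 4 → ℝ} (he : IsStructFrame e c) {x₀ : M} {a : Fin 4 → M → ℝ}
    (ha : ∀ᶠ x in 𝓝 x₀, ∀ i, ContMDiffAt 𝓘(ℝ, E4) 𝓘(ℝ, ℝ) ∞ (a i) x)
    (hclosed : ∀ᶠ x in 𝓝 x₀, ∀ i j,
      lieD (e i) (a j) x - lieD (e j) (a i) x = ∑ k, c i j k * a k x) (t : ℝ) :
    ∃ u : M → ℝ, u x₀ = t ∧ ∀ᶠ x in 𝓝 x₀,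
      ContMDiffAt 𝓘(ℝ, E4) 𝓘(ℝ, ℝ) ∞ u x ∧ ∀ i, lieD (e i) u x = a i x := by
  set φ := extChartAt 𝓘(ℝ, E4) x₀ with hφ
  have hφs : ∀ y ∈ φ.target, ContMDiffAt 𝓘(ℝ, E4) 𝓘(ℝ, E4) ∞ φ (φ.symm y) := fun y hy =>
    contMDiffAt_extChartAt' (by
      have := φ.map_target hy
      rwa [hφ, extChartAt_source] at this)
  -- the frame in the chart
  let V : Fin 4 → E4 → E4 := fun i y => lieD (e i) φ (φ.symm y)
  have hV : ∀ i, ∀ y ∈ φ.target, V i y = chartField (e i) x₀ y := by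
    intro i y hy
    have h1 := fderiv_chart_eq_lieD (e i) hy ((hφs y hy).mdifferentiableAt (by simp))
    have h2 : (fun z => φ (φ.symm z)) =ᶠ[𝓝 y] fun z => z := by
      filter_upwards [(isOpen_extChartAt_target x₀).mem_nhds hy] with z hz
      exact φ.right_inv hz
    rw [← hφ, h2.fderiv_eq] at h1
    simpa using h1.symm
  have hVs : ∀ y ∈ φ.target, ∀ i, ContDiffAt ℝ ∞ (V i) y := fun y hy i =>
    contDiffAt_comp_chart_symm' hy (contMDiffAt_lieD (he.smooth i) (hφs y hy))
  have hVli : ∀ y ∈ φ.target, LinearIndependent ℝ (fun i => V i y) := by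
    intro y hy
    have h1 := he.linearIndependent (φ.symm y)
    rw [Fintype.linearIndependent_iff] at h1 ⊢
    intro g hg
    apply h1 g
    simp_rw [hV _ y hy] at hg
    have h2 := congrArg (mD E4 E4 φ.symm y) hg
    rw [map_sum, map_zero] at h2
    rw [← h2]
    refine Finset.sum_congr rfl fun i _ => ?_
    rw [map_smul, mD_chart_symm_chartField (e i) hy]
  have hVbr : ∀ y ∈ φ.target, ∀ i j,
      fderiv ℝ (V j) y (V i y) - fderiv ℝ (V i) y (V j y) = ∑ k, c i j k • V k y := by
    intro y hy i j
    have h3 : ∀ i j, fderiv ℝ (V j) y (V i y) = lieD (e i) (lieD (e j) φ) (φ.symm y) := by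
      intro i j
      rw [hV i y hy]
      exact fderiv_chart_eq_lieD (e i) hy
        ((contMDiffAt_lieD (he.smooth j) (hφs y hy)).mdifferentiableAt (by simp))
    rw [h3, h3, ← lieD_bracket (he.smooth i) (he.smooth j) (hφs y hy)]
    exact lieD_sum_smul e (c i j) _ φ _ (he.bracket_eq i j _)
  obtain ⟨r, hr, hball⟩ : ∃ r > 0, ∀ y ∈ Metric.ball (φ x₀) r, y ∈ φ.target ∧
      (∀ i, ContMDiffAt 𝓘(ℝ, E4) 𝓘(ℝ, ℝ) ∞ (a i) (φ.symm y)) ∧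
      ∀ i j, lieD (e i) (a j) (φ.symm y) - lieD (e j) (a i) (φ.symm y)
        = ∑ k, c i j k * a k (φ.symm y) := by
    rw [← Metric.eventually_nhds_iff_ball]
    have h := (tendsto_chart_symm x₀).eventually (ha.and hclosed)
    have h' : ∀ᶠ y in 𝓝 (φ x₀), y ∈ φ.target :=
      (isOpen_extChartAt_target x₀).mem_nhds (mem_extChartAt_target x₀)
    exact h'.and h
  set s := Metric.ball (φ x₀) r
  let η : E4 → E4 →L[ℝ] ℝ := fun y =>
    (frameMap (fun i => a i (φ.symm y))).comp (frameMap (fun i => V i y)).inverse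
  have hηs : ∀ y ∈ s, ContDiffAt ℝ ∞ η y := fun y hy =>
    (contDiffAt_frameMap fun i => contDiffAt_comp_chart_symm' (hball y hy).1
      ((hball y hy).2.1 i)).clm_comp
      (contDiffAt_frameMap_inverse (hVs y (hball y hy).1) (hVli y (hball y hy).1))
  have hηV : ∀ y ∈ s, ∀ i, η y (V i y) = a i (φ.symm y) := by
    intro y hy i
    simp only [η, ContinuousLinearMap.comp_apply]
    rw [frameMap_inverse (hVli y (hball y hy).1) i, frameMap_single]
  have hsym : ∀ y ∈ s, ∀ p q, fderiv ℝ η y p q = fderiv ℝ η y q p := by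
    intro y hy
    have hyt := (hball y hy).1
    have hbasis : ∀ i j, fderiv ℝ η y (V i y) (V j y)
        = lieD (e i) (a j) (φ.symm y) - η y (fderiv ℝ (V j) y (V i y)) := by
      intro i j
      have h1 : (fun z => η z (V j z)) =ᶠ[𝓝 y] fun z => a j (φ.symm z) := by
        filter_upwards [Metric.isOpen_ball.mem_nhds hy] with z hz
        exact hηV z hz j
      have h2 := fderiv_chart_eq_lieD (e i) hyt (((hball y hy).2.1 j).mdifferentiableAt (by simp))
      rw [← hφ, ← h1.fderiv_eq, ← hV i y hyt, fderiv_clm_apply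
        ((hηs y hy).differentiableAt (by simp)) ((hVs y hyt j).differentiableAt (by simp))] at h2
      rw [← h2]
      simp
    have hsymB : ∀ i j, fderiv ℝ η y (V i y) (V j y) = fderiv ℝ η y (V j y) (V i y) := by
      intro i j
      have h1 := (hball y hy).2.2 i j
      have h2 := congrArg (η y) (hVbr y hyt i j)
      rw [map_sub, map_sum] at h2
      simp only [map_smul, hηV y hy, smul_eq_mul] at h2
      rw [hbasis, hbasis]
      linarith
    intro p q
    rw [eq_sum_of_linearIndependent (hVli y hyt) p, eq_sum_of_linearIndependent (hVli y hyt) q]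
    simp only [map_sum, map_smul, sum_apply, smul_apply,
      smul_eq_mul, Finset.mul_sum]
    rw [Finset.sum_comm]
    refine Finset.sum_congr rfl fun i _ => Finset.sum_congr rfl fun j _ => ?_
    rw [hsymB]
    ring
  obtain ⟨f, hf⟩ := (convex_ball (φ x₀) r).exists_forall_hasFDerivAt_of_fderiv_symmetric
    Metric.isOpen_ball (fun y hy => ((hηs y hy).differentiableAt (by simp)).differentiableWithinAt)
    hsym
  have hfs : ContDiffOn ℝ ∞ f s := by
    rw [contDiffOn_infty_iff_fderiv_of_isOpen Metric.isOpen_ball]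
    refine ⟨fun y hy => (hf y hy).differentiableAt.differentiableWithinAt, ?_⟩
    refine ContDiffOn.congr (fun y hy => (hηs y hy).contDiffWithinAt) fun y hy => (hf y hy).fderiv
  refine ⟨fun x => f (φ x) + (t - f (φ x₀)), by ring, ?_⟩
  have hnear : ∀ᶠ x in 𝓝 x₀, φ x ∈ s ∧ x ∈ φ.source :=
    ((continuousAt_extChartAt x₀).eventually (Metric.ball_mem_nhds _ hr)).and
      (extChartAt_source_mem_nhds x₀)
  filter_upwards [hnear] with x ⟨hx, hxs⟩
  have hφx : ContMDiffAt 𝓘(ℝ, E4) 𝓘(ℝ, E4) ∞ φ x := by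
    have := hφs (φ x) (φ.map_source hxs)
    rwa [φ.left_inv hxs] at this
  have hfx : ContMDiffAt 𝓘(ℝ, E4) 𝓘(ℝ, ℝ) ∞ (fun x => f (φ x)) x :=
    ((hfs.contDiffAt (Metric.isOpen_ball.mem_nhds hx)).contMDiffAt).comp x hφx
  refine ⟨hfx.add contMDiffAt_const, fun i => ?_⟩
  rw [lieD_add (hfx.mdifferentiableAt (by simp)) mdifferentiableAt_const, lieD_const, add_zero,
    lieD_comp (hf _ hx).differentiableAt (hφx.mdifferentiableAt (by simp)), (hf _ hx).fderiv]
  have := hηV (φ x) hx i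
  simp only [V, φ.left_inv hxs] at this
  exact this

end Frames

/-! ### Local inverses -/

section LocalInverse

open Set Filter Topology

variable {N : Type*} [TopologicalSpace N] [ChartedSpace E4 N] [IsManifold 𝓘(ℝ, E4) ∞ N]
  {N' : Type*} [TopologicalSpace N'] [ChartedSpace E4 N'] [IsManifold 𝓘(ℝ, E4) ∞ N']

theorem contMDiffAt_chart {x₀ x : N} (hx : x ∈ (extChartAt 𝓘(ℝ, E4) x₀).source) :
    ContMDiffAt 𝓘(ℝ, E4) 𝓘(ℝ, E4) ∞ (extChartAt 𝓘(ℝ, E4) x₀) x :=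
  contMDiffAt_extChartAt' (by rwa [extChartAt_source] at hx)

/-- A smooth map, read in charts, is smooth near the base point. -/
theorem eventually_contDiffAt_chart {f : N → N'} {x : N}
    (hf : ∀ᶠ y in 𝓝 x, ContMDiffAt 𝓘(ℝ, E4) 𝓘(ℝ, E4) ∞ f y) :
    ∀ᶠ y in 𝓝 (extChartAt 𝓘(ℝ, E4) x x), ContDiffAt ℝ ∞ (fun y =>
      extChartAt 𝓘(ℝ, E4) (f x) (f ((extChartAt 𝓘(ℝ, E4) x).symm y))) y := by
  have h1 : ∀ᶠ y in 𝓝 x, f y ∈ (extChartAt 𝓘(ℝ, E4) (f x)).source :=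
    hf.self_of_nhds.continuousAt.eventually (extChartAt_source_mem_nhds (f x))
  filter_upwards [(tendsto_chart_symm x).eventually (hf.and h1),
    (isOpen_extChartAt_target x).mem_nhds (mem_extChartAt_target (I := 𝓘(ℝ, E4)) x)]
    with y ⟨hy, hys⟩ hyt
  rw [← contMDiffAt_iff_contDiffAt]
  exact (contMDiffAt_chart hys).comp y (hy.comp y (contMDiffAt_chart_symm hyt))

/-- The inverse function theorem. -/
theorem exists_local_inverse {f : N → N'} {x : N}
    (hf : ∀ᶠ y in 𝓝 x, ContMDiffAt 𝓘(ℝ, E4) 𝓘(ℝ, E4) ∞ f y)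
    (hinv : (mD E4 E4 f x).IsInvertible) :
    ∃ ψ : N' → N, ψ (f x) = x ∧ (∀ᶠ z in 𝓝 (f x), f (ψ z) = z ∧
      ContMDiffAt 𝓘(ℝ, E4) 𝓘(ℝ, E4) ∞ ψ z) ∧ ∀ᶠ y in 𝓝 x, ψ (f y) = y := by
  set φ := extChartAt 𝓘(ℝ, E4) x with hφ
  set φ' := extChartAt 𝓘(ℝ, E4) (f x) with hφ'
  set g : E4 → E4 := fun y => φ' (f (φ.symm y)) with hg
  have hgs : ∀ᶠ y in 𝓝 (φ x), ContDiffAt ℝ ∞ g y := eventually_contDiffAt_chart hf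
  have hxx : φ.symm (φ x) = x := extChartAt_to_inv x
  have hginv : (fderiv ℝ g (φ x)).IsInvertible := by
    have hs := contMDiffAt_chart_symm (mem_extChartAt_target (I := 𝓘(ℝ, E4)) x)
    have hc := contMDiffAt_chart (mem_extChartAt_source (I := 𝓘(ℝ, E4)) (f x))
    rw [← mD_eq_fderiv, mD_comp (f := fun y => f (φ.symm y)) (g := φ')
      (by rw [hxx]; exact hc.mdifferentiableAt (by simp))
      (by
        refine MDifferentiableAt.comp (g := f) _ ?_ (hs.mdifferentiableAt (by simp))
        rw [hxx]; exact hf.self_of_nhds.mdifferentiableAt (by simp)),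
      mD_comp (g := f) (by rw [hxx]; exact hf.self_of_nhds.mdifferentiableAt (by simp))
        (hs.mdifferentiableAt (by simp)), hxx]
    exact (isInvertible_mD_chart (f x)).comp (hinv.comp
      (isInvertible_mD_chart_symm (mem_extChartAt_target x)))
  obtain ⟨L, hL⟩ := hginv
  have hgx : HasFDerivAt g (L : E4 →L[ℝ] E4) (φ x) := by
    rw [hL]; exact (hgs.self_of_nhds.differentiableAt (by simp)).hasFDerivAt
  set P := hgs.self_of_nhds.toOpenPartialHomeomorph g hgx (by simp) with hP
  have hPg : ∀ y, P y = g y := fun y => rfl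
  have hPs : φ x ∈ P.source := hgs.self_of_nhds.mem_toOpenPartialHomeomorph_source hgx (by simp)
  have hPx : P.symm (g (φ x)) = φ x := P.left_inv hPs
  have hgφ : g (φ x) = φ' (f x) := by simp only [hg, hxx]
  -- the local inverse of `g` is smooth near `g (φ x)`
  have hinvs : ∀ᶠ y in 𝓝 (φ x), (fderiv ℝ g y).IsInvertible := by
    have hc : ContinuousAt (fderiv ℝ g) (φ x) :=
      (hgs.self_of_nhds.fderiv_right (m := ∞) (by simp)).continuousAt
    exact hc.eventually (ContinuousLinearEquiv.isOpen.mem_nhds ⟨L, hL⟩)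
  have hPt : ∀ᶠ z in 𝓝 (φ' (f x)), z ∈ P.target :=
    P.open_target.mem_nhds (by rw [← hgφ]; exact P.map_source hPs)
  have hPc : Tendsto P.symm (𝓝 (φ' (f x))) (𝓝 (φ x)) := by
    have := P.continuousAt_symm (P.map_source hPs)
    rwa [ContinuousAt, hPg, hPx, hgφ] at this
  have hsm : ∀ᶠ z in 𝓝 (φ' (f x)), ContDiffAt ℝ ∞ P.symm z := by
    filter_upwards [hPt, hPc.eventually (hgs.and hinvs)] with z hz ⟨h1, L', hL'⟩
    refine P.contDiffAt_symm (f₀' := L') hz ?_ h1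
    rw [hL']
    exact (h1.differentiableAt (by simp)).hasFDerivAt
  have hφc : Tendsto φ' (𝓝 (f x)) (𝓝 (φ' (f x))) := continuousAt_extChartAt (f x)
  have hsrc' : ∀ᶠ z in 𝓝 (f x), z ∈ φ'.source := extChartAt_source_mem_nhds (f x)
  have htgt : ∀ᶠ y in 𝓝 (φ x), y ∈ φ.target :=
    (isOpen_extChartAt_target x).mem_nhds (mem_extChartAt_target (I := 𝓘(ℝ, E4)) x)
  have hfc := hf.self_of_nhds.continuousAt
  refine ⟨fun z => φ.symm (P.symm (φ' z)), by
    show φ.symm (P.symm (φ' (f x))) = x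
    rw [← hgφ, hPx, hxx], ?_, ?_⟩
  · have h2 : ∀ᶠ y in 𝓝 (φ x), f (φ.symm y) ∈ φ'.source :=
      (tendsto_chart_symm x).eventually (hfc.eventually hsrc')
    filter_upwards [hsrc', hφc.eventually (hPt.and (hsm.and (hPc.eventually (htgt.and h2))))]
      with z hz ⟨hzt, hzs, hzt', hz2⟩
    constructor
    · have h3 : φ' (f (φ.symm (P.symm (φ' z)))) = φ' z := P.right_inv hzt
      exact φ'.injOn hz2 hz h3
    · exact (contMDiffAt_chart_symm hzt').comp z
        (ContMDiffAt.comp (g := P.symm) z hzs.contMDiffAt (contMDiffAt_chart hz))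
  · have h2 : ∀ᶠ y in 𝓝 x, φ y ∈ P.source :=
      (continuousAt_extChartAt x).eventually (P.open_source.mem_nhds hPs)
    have h3 : ∀ᶠ y in 𝓝 x, y ∈ φ.source := extChartAt_source_mem_nhds x
    filter_upwards [h2, h3] with y hy hys
    have h4 : φ' (f y) = P (φ y) := by
      rw [hPg]
      simp only [hg, φ.left_inv hys]
    rw [h4, P.left_inv hy, φ.left_inv hys]

end LocalInverse

/-! ### Maps preserving frames -/

section FrameMaps

open Set Filter Topology

variable {N : Type*} [TopologicalSpace N] [ChartedSpace E4 N]
  {N' : Type*} [TopologicalSpace N'] [ChartedSpace E4 N']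
  {N'' : Type*} [TopologicalSpace N''] [ChartedSpace E4 N'']
  {e : Fin 4 → N → E4} {e' : Fin 4 → N' → E4} {e'' : Fin 4 → N'' → E4}

/-- Near `x` the map `F` is smooth and its differential sends the vector fields `e i` to the vector
fields `e' i`. -/
def PreservesFrame (e : Fin 4 → N → E4) (e' : Fin 4 → N' → E4) (F : N → N') (x : N) : Prop :=
  ∀ᶠ y in 𝓝 x, ContMDiffAt 𝓘(ℝ, E4) 𝓘(ℝ, E4) ∞ F y ∧ ∀ i, mD E4 E4 F y (e i y) = e' i (F y)

theorem PreservesFrame.congr {F F' : N → N'} {x : N} (h : PreservesFrame e e' F x)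
    (hF : F =ᶠ[𝓝 x] F') : PreservesFrame e e' F' x := by
  filter_upwards [h, hF.eventuallyEq_nhds] with y ⟨h1, h2⟩ hy
  refine ⟨h1.congr_of_eventuallyEq hy.symm, fun i => ?_⟩
  rw [← mD_congr hy, h2, hy.eq_of_nhds]

theorem preservesFrame_id (x : N) : PreservesFrame e e (fun y => y) x :=
  Eventually.of_forall fun y => ⟨contMDiffAt_id, fun i => by rw [mD_id]; rfl⟩

theorem PreservesFrame.continuousAt {F : N → N'} {x : N} (h : PreservesFrame e e' F x) :
    ContinuousAt F x :=
  h.self_of_nhds.1.continuousAt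

theorem PreservesFrame.eventually {F : N → N'} {x : N} (h : PreservesFrame e e' F x) :
    ∀ᶠ y in 𝓝 x, PreservesFrame e e' F y :=
  eventually_eventually_nhds.2 h

theorem PreservesFrame.comp {F : N → N'} {F' : N' → N''} {x : N}
    (h' : PreservesFrame e' e'' F' (F x)) (h : PreservesFrame e e' F x) :
    PreservesFrame e e'' (fun y => F' (F y)) x := by
  filter_upwards [h, h.continuousAt.eventually h'] with y ⟨h1, h2⟩ ⟨h3, h4⟩
  refine ⟨h3.comp y h1, fun i => ?_⟩
  rw [mD_comp (h3.mdifferentiableAt (by simp)) (h1.mdifferentiableAt (by simp)),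
    ContinuousLinearMap.comp_apply, h2, h4]

theorem mD_eq_of_preservesFrame {F : N → N'} {x : N} (h : PreservesFrame e e' F x)
    (he : LinearIndependent ℝ (fun i => e i x)) :
    mD E4 E4 F x = (frameMap (fun i => e' i (F x))).comp (frameMap (fun i => e i x)).inverse := by
  ext1 w
  conv_lhs => rw [eq_sum_of_linearIndependent he w]
  simp only [map_sum, map_smul, h.self_of_nhds.2, ContinuousLinearMap.comp_apply, frameMap_apply]

variable [IsManifold 𝓘(ℝ, E4) ∞ N] [IsManifold 𝓘(ℝ, E4) ∞ N']

/-- A local inverse of a frame-preserving map preserves the frames. -/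
theorem PreservesFrame.exists_inverse {F : N → N'} {x : N} (h : PreservesFrame e e' F x)
    (he : LinearIndependent ℝ (fun i => e i x))
    (he' : LinearIndependent ℝ (fun i => e' i (F x))) :
    ∃ F' : N' → N, F' (F x) = x ∧ PreservesFrame e' e F' (F x) := by
  obtain ⟨ψ, h1, h2, h3⟩ := exists_local_inverse (h.mono fun y hy => hy.1) (by
    rw [mD_eq_of_preservesFrame h he]
    obtain ⟨L, hL⟩ := isInvertible_frameMap he
    rw [← hL, ContinuousLinearMap.inverse_equiv]
    exact (isInvertible_frameMap he').comp ⟨L.symm, rfl⟩)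
  refine ⟨ψ, h1, ?_⟩
  have hψ : Tendsto ψ (𝓝 (F x)) (𝓝 x) := by
    have := h2.self_of_nhds.2.continuousAt
    rwa [ContinuousAt, h1] at this
  filter_upwards [h2, hψ.eventually h, hψ.eventually (eventually_eventually_nhds.2 h3)]
    with z ⟨hz, hzs⟩ ⟨h4, h5⟩ h6
  refine ⟨hzs, fun i => ?_⟩
  have h7 := mD_comp_eq_id (f := F) (g := ψ) (by rw [hz]; exact hzs.mdifferentiableAt (by simp))
    (h4.mdifferentiableAt (by simp)) h6
  have h8 := congrArg (fun A : E4 →L[ℝ] E4 => A (e i (ψ z))) h7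
  simp only [ContinuousLinearMap.comp_apply, h5, hz] at h8
  exact h8

/-- In charts, the derivative of a frame-preserving map is determined by its values. -/
theorem PreservesFrame.fderiv_chart {F : N → N'} {x : N} (h : PreservesFrame e e' F x) :
    ∀ᶠ y in 𝓝 (extChartAt 𝓘(ℝ, E4) x x), ∀ i,
      fderiv ℝ (fun y => extChartAt 𝓘(ℝ, E4) (F x) (F ((extChartAt 𝓘(ℝ, E4) x).symm y))) y
          (chartField (e i) x y)
        = chartField (e' i) (F x)
          (extChartAt 𝓘(ℝ, E4) (F x) (F ((extChartAt 𝓘(ℝ, E4) x).symm y))) := by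
  set φ := extChartAt 𝓘(ℝ, E4) x with hφ
  set φ' := extChartAt 𝓘(ℝ, E4) (F x) with hφ'
  have h1 : ∀ᶠ y in 𝓝 x, F y ∈ φ'.source :=
    h.continuousAt.eventually (extChartAt_source_mem_nhds (F x))
  filter_upwards [(tendsto_chart_symm x).eventually (h.and h1),
    (isOpen_extChartAt_target x).mem_nhds (mem_extChartAt_target (I := 𝓘(ℝ, E4)) x)]
    with y ⟨⟨hy, hye⟩, hys⟩ hyt i
  have hc : ContMDiffAt 𝓘(ℝ, E4) 𝓘(ℝ, E4) ∞ φ' (F (φ.symm y)) := contMDiffAt_chart hys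
  rw [fderiv_chart_eq_lieD (f := fun z => φ' (F z)) (e i) hyt
    (hc.mdifferentiableAt (by simp) |>.comp _ (hy.mdifferentiableAt (by simp))),
    lieD, mD_comp (hc.mdifferentiableAt (by simp)) (hy.mdifferentiableAt (by simp)),
    ContinuousLinearMap.comp_apply, hye]
  have ht := φ'.map_source hys
  have h2 := fderiv_chart_eq_lieD (f := φ') (e' i) ht (by
    rw [φ'.left_inv hys]; exact hc.mdifferentiableAt (by simp))
  rw [φ'.left_inv hys, lieD] at h2
  rw [← h2]
  have h3 : (fun z => φ' (φ'.symm z)) =ᶠ[𝓝 (φ' (F (φ.symm y)))] fun z => z := by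
    filter_upwards [(isOpen_extChartAt_target (F x)).mem_nhds ht] with z hz
    exact φ'.right_inv hz
  rw [h3.fderiv_eq, fderiv_fun_id]
  rfl

theorem linearIndependent_chartField {x : N} {y : E4}
    (hy : y ∈ (extChartAt 𝓘(ℝ, E4) x).target)
    (h : LinearIndependent ℝ (fun i => e i ((extChartAt 𝓘(ℝ, E4) x).symm y))) :
    LinearIndependent ℝ (fun i => chartField (e i) x y) := by
  rw [Fintype.linearIndependent_iff] at h ⊢
  intro g hg
  apply h g
  have h2 := congrArg (mD E4 E4 (extChartAt 𝓘(ℝ, E4) x).symm y) hg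
  rw [map_sum, map_zero] at h2
  rw [← h2]
  refine Finset.sum_congr rfl fun i _ => ?_
  rw [map_smul, mD_chart_symm_chartField (e i) hy]

/-- A frame-preserving germ is determined by its value: by Grönwall's inequality along the rays in
a chart. -/
theorem PreservesFrame.eventuallyEq {F F' : N → N'} {x : N} (hes : ∀ i, SmoothVF (e i))
    (hes' : ∀ i, SmoothVF (e' i)) (hli : LinearIndependent ℝ (fun i => e i x))
    (h : PreservesFrame e e' F x) (h' : PreservesFrame e e' F' x) (hx : F x = F' x) :
    F =ᶠ[𝓝 x] F' := by
  set φ := extChartAt 𝓘(ℝ, E4) x with hφ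
  set φ' := extChartAt 𝓘(ℝ, E4) (F x) with hφ'
  set f : E4 → E4 := fun y => φ' (F (φ.symm y)) with hf
  set f' : E4 → E4 := fun y => φ' (F' (φ.symm y)) with hf'
  have hxx : φ.symm (φ x) = x := extChartAt_to_inv x
  have hd := h.fderiv_chart
  have hd' := h'.fderiv_chart
  have hs := eventually_contDiffAt_chart (h.mono fun y hy => hy.1)
  have hs' := eventually_contDiffAt_chart (h'.mono fun y hy => hy.1)
  rw [← hx] at hd' hs'
  -- the coframe is bounded, the target frame is Lipschitz
  set A : E4 → E4 →L[ℝ] E4 := fun z => frameMap (fun i => chartField (e' i) (F x) z) with hA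
  set B : E4 → E4 →L[ℝ] E4 := fun y => (frameMap (fun i => chartField (e i) x y)).inverse with hB
  have hl0 : LinearIndependent ℝ (fun i => chartField (e i) x (φ x)) :=
    linearIndependent_chartField (mem_extChartAt_target x) (by rw [hxx]; exact hli)
  have hAs : ContDiffAt ℝ ∞ A (φ' (F x)) :=
    contDiffAt_frameMap fun i => contDiffAt_chartField (hes' i) (F x)
  have hBs : ContDiffAt ℝ ∞ B (φ x) :=
    contDiffAt_frameMap_inverse (fun i => contDiffAt_chartField (hes i) x) hl0
  obtain ⟨K, t, ht, hK⟩ := (hAs.of_le (m := 1) (by simp)).exists_lipschitzOnWith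
  have hfx : f (φ x) = φ' (F x) := by simp only [hf, hxx]
  have hfx' : f' (φ x) = φ' (F x) := by simp only [hf', hxx, hx]
  have hli' : ∀ᶠ y in 𝓝 (φ x), LinearIndependent ℝ (fun i => chartField (e i) x y) := by
    have hc : ContinuousAt (fun y i => chartField (e i) x y) (φ x) :=
      continuousAt_pi.2 fun i => (contDiffAt_chartField (hes i) x).continuousAt
    exact hc.eventually (isOpen_setOfPred_linearIndependent.mem_nhds hl0)
  have hBb : ∀ᶠ y in 𝓝 (φ x), ‖B y‖ < ‖B (φ x)‖ + 1 :=
    hBs.continuousAt.norm.eventually (gt_mem_nhds (by linarith))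
  have htf : ∀ᶠ y in 𝓝 (φ x), f y ∈ t :=
    (hs.self_of_nhds.continuousAt).eventually (by rw [← hfx] at ht; exact ht)
  have htf' : ∀ᶠ y in 𝓝 (φ x), f' y ∈ t :=
    (hs'.self_of_nhds.continuousAt).eventually (by rw [← hfx'] at ht; exact ht)
  obtain ⟨r, hr, hball⟩ := Metric.eventually_nhds_iff_ball.1
    ((hd.and hd').and ((hs.and hs').and (hli'.and (hBb.and (htf.and htf')))))
  have hderiv : ∀ y ∈ Metric.ball (φ x) r, ‖fderiv ℝ f y - fderiv ℝ f' y‖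
      ≤ K * (‖B (φ x)‖ + 1) * ‖f y - f' y‖ := by
    intro y hy
    obtain ⟨⟨h1, h1'⟩, ⟨h2, h2'⟩, h3, h4, h5, h5'⟩ := hball y hy
    have e1 : ∀ g : E4 → E4, (∀ i, fderiv ℝ g y (chartField (e i) x y)
        = chartField (e' i) (F x) (g y)) → fderiv ℝ g y = (A (g y)).comp (B y) := by
      intro g hg
      ext1 w
      conv_lhs => rw [eq_sum_of_linearIndependent h3 w]
      simp only [map_sum, map_smul, hg, ContinuousLinearMap.comp_apply, hA, hB, frameMap_apply]
    rw [e1 f h1, e1 f' h1', ← ContinuousLinearMap.sub_comp]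
    calc _ ≤ ‖A (f y) - A (f' y)‖ * ‖B y‖ := ContinuousLinearMap.opNorm_comp_le _ _
      _ ≤ (K * ‖f y - f' y‖) * (‖B (φ x)‖ + 1) := by
        refine mul_le_mul ?_ h4.le (norm_nonneg _) (by positivity)
        rw [← dist_eq_norm, ← dist_eq_norm]
        exact hK.dist_le_mul _ h5 _ h5'
      _ = _ := by ring
  have heq : ∀ y ∈ Metric.ball (φ x) r, f y = f' y := by
    intro y hy
    have hseg : ∀ s ∈ Icc (0 : ℝ) 1, φ x + s • (y - φ x) ∈ Metric.ball (φ x) r := by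
      intro s hs
      rw [Metric.mem_ball, dist_eq_norm] at hy ⊢
      rw [add_sub_cancel_left, norm_smul, Real.norm_of_nonneg hs.1]
      exact (mul_le_of_le_one_left (norm_nonneg _) hs.2).trans_lt hy
    have hdf : ∀ s ∈ Icc (0 : ℝ) 1, HasDerivAt
        (fun s : ℝ => f (φ x + s • (y - φ x)) - f' (φ x + s • (y - φ x)))
        ((fderiv ℝ f (φ x + s • (y - φ x)) - fderiv ℝ f' (φ x + s • (y - φ x))) (y - φ x)) s := by
      intro s hs
      obtain ⟨-, ⟨h2, h2'⟩, -⟩ := hball _ (hseg s hs)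
      have hl : HasDerivAt (fun s : ℝ => φ x + s • (y - φ x)) (y - φ x) s := by
        simpa using ((hasDerivAt_id s).smul_const (y - φ x)).const_add (φ x)
      exact ((h2.differentiableAt (by simp)).hasFDerivAt.comp_hasDerivAt s hl).sub
        ((h2'.differentiableAt (by simp)).hasFDerivAt.comp_hasDerivAt s hl)
    have := eq_zero_of_abs_deriv_le_mul_abs_self_of_eq_zero_right
      (f := fun s : ℝ => f (φ x + s • (y - φ x)) - f' (φ x + s • (y - φ x)))
      (K := K * (‖B (φ x)‖ + 1) * ‖y - φ x‖) (a := 0) (b := 1)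
      (fun s hs => (hdf s hs).continuousAt.continuousWithinAt)
      (fun s hs => (hdf s ⟨hs.1, hs.2.le⟩).hasDerivWithinAt)
      (by simp only [zero_smul, add_zero, hfx, hfx', sub_self])
      (fun s hs => by
        refine (ContinuousLinearMap.le_opNorm _ _).trans ?_
        have := hderiv _ (hseg s ⟨hs.1, hs.2.le⟩)
        calc _ ≤ _ := mul_le_mul_of_nonneg_right this (norm_nonneg _)
          _ = _ := by ring) 1 ⟨zero_le_one, le_rfl⟩
    simpa [sub_eq_zero] using this
  have hsrc : ∀ᶠ y in 𝓝 x, F y ∈ φ'.source :=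
    h.continuousAt.eventually (extChartAt_source_mem_nhds (F x))
  have hsrc' : ∀ᶠ y in 𝓝 x, F' y ∈ φ'.source :=
    h'.continuousAt.eventually (by rw [hφ', hx]; exact extChartAt_source_mem_nhds (F' x))
  filter_upwards [hsrc, hsrc', extChartAt_source_mem_nhds (I := 𝓘(ℝ, E4)) x,
    (continuousAt_extChartAt (I := 𝓘(ℝ, E4)) x).eventually (Metric.ball_mem_nhds _ hr)]
    with y h1 h2 h3 h4
  have h5 := heq _ h4
  simp only [hf, hf'] at h5
  rw [φ.left_inv h3] at h5
  exact φ'.injOn h1 h2 h5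

end FrameMaps

/-! ### Homogeneous frames -/

section HomogeneousFrames

open Set Filter Topology

universe u v

variable {N : Type u} [TopologicalSpace N] [ChartedSpace E4 N] [IsManifold 𝓘(ℝ, E4) ∞ N]
  {N' : Type v} [TopologicalSpace N'] [ChartedSpace E4 N'] [IsManifold 𝓘(ℝ, E4) ∞ N']
  {e : Fin 4 → N → E4} {e' : Fin 4 → N' → E4} {V : Set N} {V' : Set N'}

/-- The vector fields `e i` restrict to a frame on the open set `V`, and the maps `T y`, `y ∈ V`,
form a simply transitive family of frame-preserving transformations of `V` (the left translations
of a Lie group structure on `V` for which the `e i` are left-invariant). -/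
structure HomogeneousFrame (V : Set N) (e : Fin 4 → N → E4) : Prop where
  isOpen : IsOpen V
  smooth : ∀ i, SmoothVF (e i)
  linearIndependent : ∀ x ∈ V, LinearIndependent ℝ (fun i => e i x)
  exists_translations : ∃ T : N → N → N,
    (∀ y ∈ V, ∀ z ∈ V, T y z ∈ V ∧ PreservesFrame e e (T y) z) ∧
    ∀ z ∈ V, BijOn (fun y => T y z) V V

/-- Frame-preserving germs continue to global frame-preserving maps. -/
theorem HomogeneousFrame.exists_global (hV : HomogeneousFrame V e) (hV' : HomogeneousFrame V' e')
    (hcov : HasCoveringSections.{u, max u v} V) {F₀ : N → N'} {x₀ : N} (hx₀ : x₀ ∈ V)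
    (h₀ : PreservesFrame e e' F₀ x₀) (hF₀ : F₀ x₀ ∈ V') :
    ∃ F : N → N', F x₀ = F₀ x₀ ∧ ∀ x ∈ V, F x ∈ V' ∧ PreservesFrame e e' F x := by
  classical
  obtain ⟨T, hT, hTb⟩ := hV.exists_translations
  obtain ⟨T', hT', hTb'⟩ := hV'.exists_translations
  have tval : ∀ x : V, Tendsto (Subtype.val : V → N) (𝓝 x) (𝓝 (x : N)) := fun x =>
    continuous_subtype_val.continuousAt
  obtain ⟨F, hF0, hF⟩ : ∃ F : V → V', F ⟨x₀, hx₀⟩ = ⟨F₀ x₀, hF₀⟩ ∧ ∀ x : V, ∃ F' : N → N',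
      (∀ᶠ z : V in 𝓝 x, F' z = F z) ∧ PreservesFrame e e' F' x := by
    refine exists_global_of_uniquely_continuable hcov
      (fun (x : V) (F : V → V') => ∃ F' : N → N', (∀ᶠ z : V in 𝓝 x, F' z = F z) ∧
        PreservesFrame e e' F' x) ?_ ?_ ?_ _ _
    · rintro x F F' hFF ⟨G, h1, h2⟩
      exact ⟨G, by filter_upwards [h1, hFF] with z h3 h4 using h3.trans (congrArg _ h4), h2⟩
    · rintro x F F' ⟨G, h1, h2⟩ ⟨G', h1', h2'⟩ hx
      have h3 := h2.eventuallyEq hV.smooth hV'.smooth (hV.linearIndependent x x.2) h2'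
        (by rw [h1.self_of_nhds, h1'.self_of_nhds, hx])
      filter_upwards [h1, h1', (tval x).eventually h3] with z h4 h5 h6
      exact Subtype.ext (h4.symm.trans (h6.trans h5))
    · rintro ⟨x, hx⟩
      obtain ⟨y, hyV, hy⟩ := (hTb x hx).surjOn hx₀
      replace hy : T y x = x₀ := hy
      have h1 : PreservesFrame e e' (fun z => F₀ (T y z)) x :=
        PreservesFrame.comp (by rwa [hy]) (hT y hyV x hx).2
      have h2 : ∀ᶠ z in 𝓝 x, F₀ (T y z) ∈ V' :=
        h1.continuousAt.eventually (hV'.isOpen.mem_nhds (by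
        show F₀ (T y x) ∈ V'
        rwa [hy]))
      obtain ⟨W, hW, hWo, hxW⟩ := eventually_nhds_iff.1
        ((tval ⟨x, hx⟩).eventually (h1.eventually.and h2))
      refine ⟨W, hWo, hxW, fun y' z => if h : T' y' (F₀ (T y z)) ∈ V' then ⟨_, h⟩ else y', ?_⟩
      have hmem : ∀ (y' : V'), ∀ z ∈ W, T' y' (F₀ (T y z)) ∈ V' := fun y' z hz =>
        (hT' y' y'.2 _ (hW z hz).2).1
      intro z hz
      refine ⟨fun y' => ⟨fun w => T' y' (F₀ (T y w)), ?_, ?_⟩, ?_, ?_⟩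
      · filter_upwards [hWo.mem_nhds hz] with w hw
        simp [hmem y' w hw]
      · exact PreservesFrame.comp (F := fun w => F₀ (T y w)) (F' := T' y')
          (hT' y' y'.2 _ (hW z hz).2).2 (hW z hz).1
      · intro y' y'' h
        simp only [hmem _ z hz, dif_pos, Subtype.mk.injEq] at h
        exact Subtype.ext ((hTb' _ (hW z hz).2).injOn y'.2 y''.2 h)
      · intro w
        obtain ⟨y', h3, h4⟩ := (hTb' _ (hW z hz).2).surjOn w.2
        refine ⟨⟨y', h3⟩, ?_⟩
        simp only [hmem ⟨y', h3⟩ z hz, dif_pos]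
        exact Subtype.ext h4
  refine ⟨fun x => if h : x ∈ V then F ⟨x, h⟩ else F₀ x₀, by simp [hx₀, hF0], ?_⟩
  intro x hx
  refine ⟨by simp [hx], ?_⟩
  obtain ⟨F', h1, h2⟩ := hF ⟨x, hx⟩
  refine h2.congr ?_
  have h3 := hV.isOpen.isOpenEmbedding_subtypeVal.map_nhds_eq ⟨x, hx⟩
  rw [← h3]
  refine eventually_map.2 (h1.mono fun z hz => ?_)
  simp [hz]

theorem HomogeneousFrame.eqOn [T2Space N'] (hV : HomogeneousFrame V e)
    (hV' : HomogeneousFrame V' e') (hconn : IsPreconnected V) {F F' : N → N'}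
    (hF : ∀ x ∈ V, PreservesFrame e e' F x) (hF' : ∀ x ∈ V, PreservesFrame e e' F' x)
    {x₀ : N} (hx₀ : x₀ ∈ V) (h : F x₀ = F' x₀) : EqOn F F' V := by
  have := isPreconnected_iff_preconnectedSpace.1 hconn
  have tval : ∀ x : V, Tendsto (Subtype.val : V → N) (𝓝 x) (𝓝 (x : N)) := fun x =>
    continuous_subtype_val.continuousAt
  have hclopen : IsClopen {x : V | F x = F' x} := by
    constructor
    · exact isClosed_eq
        (continuous_iff_continuousAt.2 fun x => (hF x x.2).continuousAt.tendsto.comp (tval x))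
        (continuous_iff_continuousAt.2 fun x => (hF' x x.2).continuousAt.tendsto.comp (tval x))
    · rw [isOpen_iff_mem_nhds]
      intro x hx
      exact (tval x).eventually ((hF x x.2).eventuallyEq hV.smooth hV'.smooth
        (hV.linearIndependent x x.2) (hF' x x.2) hx)
  have h1 := hclopen.eq_univ ⟨⟨x₀, hx₀⟩, h⟩
  intro x hx
  exact (h1 ▸ mem_univ (⟨x, hx⟩ : V) : (⟨x, hx⟩ : V) ∈ {x : V | F x = F' x})

/-- A frame-preserving germ between homogeneous frames extends to a global diffeomorphism. -/
theorem HomogeneousFrame.exists_diffeomorphism [T2Space N] [T2Space N']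
    (hV : HomogeneousFrame V e) (hV' : HomogeneousFrame V' e')
    (hconn : IsPreconnected V) (hconn' : IsPreconnected V')
    (hcov : HasCoveringSections.{u, max u v} V) (hcov' : HasCoveringSections.{v, max u v} V')
    {F₀ : N → N'} {x₀ : N} (hx₀ : x₀ ∈ V) (h₀ : PreservesFrame e e' F₀ x₀) (hF₀ : F₀ x₀ ∈ V') :
    ∃ (F : N → N') (F' : N' → N),
      (∀ x ∈ V, F x ∈ V' ∧ PreservesFrame e e' F x ∧ F' (F x) = x) ∧
      ∀ y ∈ V', F' y ∈ V ∧ PreservesFrame e' e F' y ∧ F (F' y) = y := by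
  obtain ⟨G₀, hG1, hG2⟩ := h₀.exists_inverse (hV.linearIndependent x₀ hx₀)
    (hV'.linearIndependent _ hF₀)
  obtain ⟨F, hF0, hF⟩ := hV.exists_global hV' hcov hx₀ h₀ hF₀
  obtain ⟨G, hG0, hG⟩ := hV'.exists_global hV (F₀ := G₀) hcov' hF₀ hG2 (by rwa [hG1])
  rw [hG1] at hG0
  have h1 : EqOn (fun x => G (F x)) (fun x => x) V :=
    hV.eqOn hV hconn (fun x hx => (hG _ (hF x hx).1).2.comp (hF x hx).2)
      (fun x _ => preservesFrame_id x) hx₀ (by simp only [hF0, hG0])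
  have h2 : EqOn (fun x => F (G x)) (fun x => x) V' :=
    hV'.eqOn hV' hconn' (fun x hx => (hF _ (hG x hx).1).2.comp (hG x hx).2)
      (fun x _ => preservesFrame_id x) hF₀ (by simp only [hF0, hG0])
  exact ⟨F, G, fun x hx => ⟨(hF x hx).1, (hF x hx).2, h1 hx⟩,
    fun y hy => ⟨(hG y hy).1, (hG y hy).2, h2 hy⟩⟩

end HomogeneousFrames

/-! ### Left-invariant vector fields -/

section LieGroups

open Set Filter Topology VectorField Bundle

variable {E : Type*} [NormedAddCommGroup E] [NormedSpace ℝ E]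
  {G : Type*} [TopologicalSpace G] [ChartedSpace E G] [Group G] [LieGroup 𝓘(ℝ, E) ∞ G]

/-- The left-invariant vector field with value `v` at the identity. -/
noncomputable def leftField (v : E) (x : G) : E := mD E E (fun y : G => x * y) 1 v

theorem contMDiff_leftField (v : E) : ContMDiff 𝓘(ℝ, E) 𝓘(ℝ, E).tangent ∞
    (fun x : G => (⟨x, leftField (E := E) v x⟩ : TangentBundle 𝓘(ℝ, E) G)) := by
  have : IsManifold 𝓘(ℝ, E) ∞ G := ContMDiffMul.toIsManifold
  let fg : G → TangentBundle 𝓘(ℝ, E) G := fun g => TotalSpace.mk' E g 0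
  have sfg : ContMDiff 𝓘(ℝ, E) 𝓘(ℝ, E).tangent ∞ fg := contMDiff_zeroSection _ _
  let fv : G → TangentBundle 𝓘(ℝ, E) G := fun _ => TotalSpace.mk' E 1 v
  have sfv : ContMDiff 𝓘(ℝ, E) 𝓘(ℝ, E).tangent ∞ fv := contMDiff_const
  have S₂ : ContMDiff (𝓘(ℝ, E).tangent.prod 𝓘(ℝ, E).tangent)
      (𝓘(ℝ, E).prod 𝓘(ℝ, E)).tangent ∞ (equivTangentBundleProd 𝓘(ℝ, E) G 𝓘(ℝ, E) G).symm :=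
    contMDiff_equivTangentBundleProd_symm
  have S₃ : ContMDiff (𝓘(ℝ, E).prod 𝓘(ℝ, E)).tangent 𝓘(ℝ, E).tangent ∞
      (tangentMap (𝓘(ℝ, E).prod 𝓘(ℝ, E)) 𝓘(ℝ, E) (fun (p : G × G) => p.1 * p.2)) :=
    (contMDiff_mul 𝓘(ℝ, E) ∞).contMDiff_tangentMap (m := ∞) (by simp)
  have S := (S₃.comp S₂).comp (sfg.prodMk sfv)
  have heq : ∀ g : G, tangentMap (𝓘(ℝ, E).prod 𝓘(ℝ, E)) 𝓘(ℝ, E) (fun (p : G × G) => p.1 * p.2)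
      ((equivTangentBundleProd 𝓘(ℝ, E) G 𝓘(ℝ, E) G).symm (fg g, fv g))
      = (⟨g * 1, leftField (E := E) v g⟩ : TangentBundle 𝓘(ℝ, E) G) := by
    intro g
    have h1 : mfderiv (𝓘(ℝ, E).prod 𝓘(ℝ, E)) 𝓘(ℝ, E) (fun (p : G × G) => p.1 * p.2) (g, 1)
        ((0, v) : E × E) = leftField v g := by
      have h2 := mfderiv_prod_eq_add_apply (I := 𝓘(ℝ, E)) (I' := 𝓘(ℝ, E)) (I'' := 𝓘(ℝ, E))
        (f := fun (p : G × G) => p.1 * p.2) (p := (g, 1)) (v := ((0, v) : E × E))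
        ((contMDiff_mul 𝓘(ℝ, E) ∞).mdifferentiable (by simp) _)
      refine h2.trans ?_
      have h3 : (mD E E (fun z : G => z * 1) g 0 : E) + leftField v g = leftField v g := by
        rw [map_zero, zero_add]
      exact h3
    exact congrArg (fun w : E => (⟨g * 1, w⟩ : TangentBundle 𝓘(ℝ, E) G)) h1
  refine S.congr fun g => ?_
  refine Eq.trans ?_ (heq g).symm
  rw [mul_one]

end LieGroups

/-! ### Simply transitive actions -/

section Actions

open Set Filter Topology

variable {M : Type*} [TopologicalSpace M] [ChartedSpace E4 M] [IsManifold 𝓘(ℝ, E4) ∞ M]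
  {E : Type*} [NormedAddCommGroup E] [NormedSpace ℝ E] [FiniteDimensional ℝ E]
  {G : Type*} [TopologicalSpace G] [ChartedSpace E G] [Group G] [LieGroup 𝓘(ℝ, E) ∞ G]
  [MulAction G M]

theorem contMDiff_smul_const
    (hsm : ContMDiff (𝓘(ℝ, E).prod 𝓘(ℝ, E4)) 𝓘(ℝ, E4) ∞ (fun p : G × M => p.1 • p.2)) (x : M) :
    ContMDiff 𝓘(ℝ, E) 𝓘(ℝ, E4) ∞ (fun a : G => a • x) :=
  hsm.comp (contMDiff_id.prodMk contMDiff_const)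

theorem contMDiff_const_smul'
    (hsm : ContMDiff (𝓘(ℝ, E).prod 𝓘(ℝ, E4)) 𝓘(ℝ, E4) ∞ (fun p : G × M => p.1 • p.2)) (a : G) :
    ContMDiff 𝓘(ℝ, E4) 𝓘(ℝ, E4) ∞ (fun x : M => a • x) :=
  hsm.comp (contMDiff_const.prodMk contMDiff_id)

theorem mD_orbit_leftField
    (hsm : ContMDiff (𝓘(ℝ, E).prod 𝓘(ℝ, E4)) 𝓘(ℝ, E4) ∞ (fun p : G × M => p.1 • p.2)) (x : M)
    (v : E) (a : G) : mD E E4 (fun b : G => b • x) a (leftField v a)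
      = mD E4 E4 (fun y : M => a • y) x (mD E E4 (fun b : G => b • x) 1 v) := by
  have : IsManifold 𝓘(ℝ, E) ∞ G := ContMDiffMul.toIsManifold
  have h1 : mD E E4 (fun b : G => (a * b) • x) 1 = _ :=
    mD_comp (g := fun b : G => b • x) (f := fun b => a * b)
    ((contMDiff_smul_const hsm x).mdifferentiable (by simp) _)
    ((contMDiff_mul_left (I := 𝓘(ℝ, E)) (n := ∞)).mdifferentiable (by simp) _)
  have h2 : mD E E4 (fun b : G => a • b • x) 1 = _ :=
    mD_comp (g := fun y : M => a • y) (f := fun b : G => b • x)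
    ((contMDiff_const_smul' hsm a).mdifferentiable (by simp) _)
    ((contMDiff_smul_const hsm x).mdifferentiable (by simp) _)
  simp only [mul_smul, one_smul, mul_one] at h1 h2
  rw [h1] at h2
  exact congrArg (fun A : E →L[ℝ] E4 => A v) h2

theorem hasMFDerivAt_comp_of_eq {E₁ E₂ E₃ : Type*} [NormedAddCommGroup E₁] [NormedSpace ℝ E₁]
    [NormedAddCommGroup E₂] [NormedSpace ℝ E₂] [NormedAddCommGroup E₃] [NormedSpace ℝ E₃]
    {N₁ N₂ N₃ : Type*} [TopologicalSpace N₁] [ChartedSpace E₁ N₁] [TopologicalSpace N₂]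
    [ChartedSpace E₂ N₂] [TopologicalSpace N₃] [ChartedSpace E₃ N₃] {g : N₂ → N₃} {f : N₁ → N₂}
    {x : N₁} {L : E₁ →L[ℝ] E₂} {A : E₁ →L[ℝ] E₃}
    (hg : MDifferentiableAt 𝓘(ℝ, E₂) 𝓘(ℝ, E₃) g (f x))
    (hf : HasMFDerivAt 𝓘(ℝ, E₁) 𝓘(ℝ, E₂) f x L) (hA : (mD E₂ E₃ g (f x)).comp L = A) :
    HasMFDerivAt 𝓘(ℝ, E₁) 𝓘(ℝ, E₃) (fun y => g (f y)) x A := by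
  subst hA
  exact hg.hasMFDerivAt.comp x hf

/-- A curve in a manifold with zero velocity is locally constant. -/
theorem eventually_eq_of_mD_eq_zero {γ : ℝ → M} {t : ℝ}
    (h : ∀ᶠ s in 𝓝 t, HasMFDerivAt 𝓘(ℝ, ℝ) 𝓘(ℝ, E4) γ s (0 : ℝ →L[ℝ] E4)) :
    ∀ᶠ s in 𝓝 t, γ s = γ t := by
  set φ := extChartAt 𝓘(ℝ, E4) (γ t)
  have hs : ∀ᶠ s in 𝓝 t, γ s ∈ φ.source :=
    h.self_of_nhds.continuousAt.eventually (extChartAt_source_mem_nhds (γ t))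
  obtain ⟨r, hr, hball⟩ := Metric.eventually_nhds_iff_ball.1 (h.and hs)
  have hd : ∀ s ∈ Metric.ball t r, HasFDerivAt (fun s => φ (γ s)) (0 : ℝ →L[ℝ] E4) s := by
    intro s hs
    obtain ⟨h1, h2⟩ := hball s hs
    exact (hasMFDerivAt_comp_of_eq ((contMDiffAt_chart h2).mdifferentiableAt (by simp)) h1
      (ContinuousLinearMap.comp_zero _)).hasFDerivAt
  filter_upwards [Metric.ball_mem_nhds t hr] with s hs
  have h1 : φ (γ s) = φ (γ t) := by
    refine (convex_ball t r).is_const_of_fderivWithin_eq_zero (𝕜 := ℝ)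
      (f := fun s => φ (γ s)) (fun s hs => (hd s hs).differentiableAt.differentiableWithinAt)
      (fun s hs => ?_) hs (Metric.mem_ball_self hr)
    exact (hd s hs).hasFDerivWithinAt.fderivWithin (Metric.isOpen_ball.uniqueDiffWithinAt hs)
  exact φ.injOn (hball s hs).2 (hball t (Metric.mem_ball_self hr)).2 h1

/-- A free orbit map is an immersion: otherwise it would collapse an integral curve of a
left-invariant field. -/
theorem mD_orbit_injective [T2Space M]
    (hsm : ContMDiff (𝓘(ℝ, E).prod 𝓘(ℝ, E4)) 𝓘(ℝ, E4) ∞ (fun p : G × M => p.1 • p.2)) (x : M)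
    (hinj : Function.Injective (fun a : G => a • x)) :
    Function.Injective (mD E E4 (fun a : G => a • x) 1) := by
  have : IsManifold 𝓘(ℝ, E) ∞ G := ContMDiffMul.toIsManifold
  have : IsManifold 𝓘(ℝ, E) 1 G := IsManifold.of_le (n := ∞) (by simp)
  rw [injective_iff_map_eq_zero]
  intro v hv
  obtain ⟨γ, h0, hγ⟩ := exists_isMIntegralCurveAt_of_contMDiffAt_boundaryless (I := 𝓘(ℝ, E))
    (t₀ := 0) (((contMDiff_leftField (G := G) v).of_le (m := 1) (by simp)).contMDiffAt (x := 1))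
  have h1 : ∀ᶠ s in 𝓝 (0 : ℝ),
      HasMFDerivAt 𝓘(ℝ, ℝ) 𝓘(ℝ, E4) (fun s => γ s • x) s (0 : ℝ →L[ℝ] E4) := by
    filter_upwards [hγ] with s hs
    have h3 : mD E E4 (fun b : G => b • x) (γ s) (leftField v (γ s)) = 0 := by
      rw [mD_orbit_leftField hsm, hv, map_zero]
    have h4 : (mD E E4 (fun b : G => b • x) (γ s)).comp
        ((1 : ℝ →L[ℝ] ℝ).smulRight (leftField v (γ s))) = 0 := by
      ext1
      simp [h3]
    exact hasMFDerivAt_comp_of_eq (g := fun b : G => b • x)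
      ((contMDiff_smul_const hsm x).mdifferentiable (by simp) (γ s)) hs h4
  have h2 : ∀ᶠ s in 𝓝 (0 : ℝ), γ s = γ 0 :=
    (eventually_eq_of_mD_eq_zero h1).mono fun s hs => hinj hs
  have h3 : (1 : ℝ →L[ℝ] ℝ).smulRight (leftField v (γ 0)) = 0 := by
    have h4 : HasMFDerivAt 𝓘(ℝ, ℝ) 𝓘(ℝ, E) γ 0 (0 : ℝ →L[ℝ] E) :=
      (hasMFDerivAt_const (γ 0) (0 : ℝ)).congr_of_eventuallyEq h2
    exact hasMFDerivAt_unique hγ.self_of_nhds h4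
  have h5 := congrArg (fun A : ℝ →L[ℝ] E => A 1) h3
  rw [h0] at h5
  have h6 : leftField v (1 : G) = v := by
    have : (fun y : G => 1 * y) = fun y => y := by ext; simp
    rw [leftField, this, mD_id]
    rfl
  simpa [h6] using h5

end Actions

section LieGroupStructure

open Set Filter Topology

variable {M : Type*} [TopologicalSpace M] [ChartedSpace E4 M] [IsManifold 𝓘(ℝ, E4) ∞ M]
  {E : Type*} [NormedAddCommGroup E] [NormedSpace ℝ E] [FiniteDimensional ℝ E]
  {G : Type*} [TopologicalSpace G] [ChartedSpace E G]

/-- A smooth map from a second countable manifold cannot raise the dimension. -/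
theorem four_le_finrank_of_surjective [IsManifold 𝓘(ℝ, E) ∞ G] [SecondCountableTopology G]
    [Nonempty M] {f : G → M}
    (hf : ContMDiff 𝓘(ℝ, E) 𝓘(ℝ, E4) ∞ f) (hsurj : Function.Surjective f) :
    4 ≤ Module.finrank ℝ E := by
  obtain ⟨x₀⟩ := ‹Nonempty M›
  set φ := extChartAt 𝓘(ℝ, E4) x₀ with hφ
  let c : G → PartialEquiv G E := fun a => extChartAt 𝓘(ℝ, E) a
  let D : G → Set E := fun a => {y | y ∈ (c a).target ∧ f ((c a).symm y) ∈ φ.source}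
  let g : G → E → E4 := fun a y => φ (f ((c a).symm y))
  have hg : ∀ a, dimH (g a '' D a) ≤ Module.finrank ℝ E := by
    intro a
    refine (dimH_image_le_of_locally_lipschitzOn fun y hy => ?_).trans
      ((dimH_mono (subset_univ _)).trans (Real.dimH_univ_eq_finrank E).le)
    have h1 : ContMDiffAt 𝓘(ℝ, E) 𝓘(ℝ, E) ∞ (c a).symm y :=
      (contMDiffOn_extChartAt_symm a).contMDiffAt ((isOpen_extChartAt_target a).mem_nhds hy.1)
    have h2 : ContMDiffAt 𝓘(ℝ, E) 𝓘(ℝ, E4) ∞ (g a) y :=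
      (contMDiffAt_chart hy.2).comp y ((hf _).comp y h1)
    obtain ⟨K, t, ht, hK⟩ :=
      ((contMDiffAt_iff_contDiffAt.1 h2).of_le (m := 1) (by simp)).exists_lipschitzOnWith
    exact ⟨K, t, mem_nhdsWithin_of_mem_nhds ht, hK⟩
  obtain ⟨t, ht, htU⟩ := TopologicalSpace.countable_cover_nhds
    (f := fun a => (c a).source) (fun a => extChartAt_source_mem_nhds (I := 𝓘(ℝ, E)) a)
  have hsub : φ.target ⊆ ⋃ a ∈ t, g a '' D a := by
    intro p hp
    obtain ⟨b, hb⟩ := hsurj (φ.symm p)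
    obtain ⟨a, hat, hba⟩ := mem_iUnion₂.1 (htU ▸ mem_univ b : b ∈ ⋃ a ∈ t, (c a).source)
    refine mem_iUnion₂.2 ⟨a, hat, c a b, ⟨(c a).map_source hba, ?_⟩, ?_⟩
    · rw [(c a).left_inv hba, hb]
      exact φ.map_target hp
    · simp only [g, (c a).left_inv hba, hb]
      exact φ.right_inv hp
  have h4 : dimH φ.target = 4 := by
    rw [Real.dimH_of_mem_nhds ((isOpen_extChartAt_target x₀).mem_nhds (mem_extChartAt_target x₀))]
    simp
  have h5 := dimH_mono hsub
  rw [h4, dimH_bUnion ht] at h5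
  have h6 : (4 : ENNReal) ≤ Module.finrank ℝ E := h5.trans (iSup₂_le fun a _ => hg a)
  exact_mod_cast h6

variable [Group G] [LieGroup 𝓘(ℝ, E) ∞ G] [MulAction G M]

/-- The inverse of the orbit map of a simply transitive action is smooth. -/
theorem contMDiff_inverse_orbit [T2Space M] [SecondCountableTopology G]
    (hsm : ContMDiff (𝓘(ℝ, E).prod 𝓘(ℝ, E4)) 𝓘(ℝ, E4) ∞ (fun p : G × M => p.1 • p.2)) (x₀ : M)
    (hinj : Function.Injective (fun a : G => a • x₀)) {τ : M → G} (hτ : ∀ x, τ x • x₀ = x) :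
    ContMDiff 𝓘(ℝ, E4) 𝓘(ℝ, E) ∞ τ := by
  have : IsManifold 𝓘(ℝ, E) ∞ G := ContMDiffMul.toIsManifold
  have : Nonempty M := ⟨x₀⟩
  have hi := mD_orbit_injective hsm x₀ hinj
  have hs := contMDiff_smul_const hsm x₀
  have h4 : Module.finrank ℝ E = 4 := by
    refine le_antisymm ?_ (four_le_finrank_of_surjective hs fun x => ⟨τ x, hτ x⟩)
    simpa using LinearMap.finrank_le_finrank_of_injective
      (f := (mD E E4 (fun a : G => a • x₀) 1 : E →ₗ[ℝ] E4)) hi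
  let L : E4 ≃L[ℝ] E := ContinuousLinearEquiv.ofFinrankEq (by simp [h4])
  set c := extChartAt 𝓘(ℝ, E) (1 : G) with hc
  have hp : ∀ᶠ p in 𝓝 (L.symm (c 1)), L p ∈ c.target := by
    refine L.continuous.continuousAt.eventually ?_
    rw [L.apply_symm_apply]
    exact (isOpen_extChartAt_target (1 : G)).mem_nhds (mem_extChartAt_target 1)
  have hcs : ∀ y ∈ c.target, ContMDiffAt 𝓘(ℝ, E) 𝓘(ℝ, E) ∞ c.symm y := fun y hy =>
    (contMDiffOn_extChartAt_symm 1).contMDiffAt ((isOpen_extChartAt_target 1).mem_nhds hy)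
  have hcL : ∀ p, L p ∈ c.target → ContMDiffAt 𝓘(ℝ, E4) 𝓘(ℝ, E) ∞ (fun p => c.symm (L p)) p :=
    fun p hp => (hcs _ hp).comp p L.contDiff.contMDiff.contMDiffAt
  -- the orbit map read in a chart of the group
  let f : E4 → M := fun p => c.symm (L p) • x₀
  have hf : ∀ᶠ p in 𝓝 (L.symm (c 1)), ContMDiffAt 𝓘(ℝ, E4) 𝓘(ℝ, E4) ∞ f p :=
    hp.mono fun p hp => (hs _).comp p (hcL p hp)
  have hc1 : c.symm (c 1) = 1 := extChartAt_to_inv (I := 𝓘(ℝ, E)) (1 : G)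
  have hct : c 1 ∈ c.target := mem_extChartAt_target (1 : G)
  have hcinv : (mD E E c.symm (c 1)).IsInvertible := by
    have h1 := isInvertible_mfderivWithin_extChartAt_symm (I := 𝓘(ℝ, E)) hct
    rw [show range 𝓘(ℝ, E) = univ by simp, mfderivWithin_univ] at h1
    exact h1
  have hmD : mD E4 E4 f (L.symm (c 1)) = (mD E E4 (fun a : G => a • x₀) 1).comp
      ((mD E E c.symm (c 1)).comp (L : E4 →L[ℝ] E)) := by
    have h1 := mD_comp (f := fun p => c.symm (L p)) (x := L.symm (c 1)) (g := fun a : G => a • x₀)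
      ((hs _).mdifferentiableAt (by simp))
      ((hcL _ (by rw [L.apply_symm_apply]; exact hct)).mdifferentiableAt (by simp))
    have h2 := mD_comp (f := fun p => L p) (x := L.symm (c 1)) (g := c.symm)
      (by rw [L.apply_symm_apply]; exact (hcs _ hct).mdifferentiableAt (by simp))
      (L.contDiff.contMDiff.contMDiffAt.mdifferentiableAt (n := ∞) (by simp))
    have h3 : mD E4 E (fun p => L p) (L.symm (c 1)) = (L : E4 →L[ℝ] E) := by
      rw [mD_eq_fderiv]; exact (L : E4 →L[ℝ] E).fderiv
    rw [L.apply_symm_apply] at h2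
    rw [h2, h3] at h1
    simp only [L.apply_symm_apply, hc1] at h1
    exact h1
  have hinv : (mD E4 E4 f (L.symm (c 1))).IsInvertible := by
    have h1 : Function.Injective (mD E4 E4 f (L.symm (c 1))) := by
      obtain ⟨C, hC⟩ := hcinv
      rw [hmD, ← hC]
      exact hi.comp (C.injective.comp L.injective)
    exact ⟨(LinearEquiv.ofInjectiveEndo (mD E4 E4 f (L.symm (c 1)) : E4 →ₗ[ℝ] E4)
      h1).toContinuousLinearEquiv, by ext; rfl⟩
  obtain ⟨ψ, h1, h2, -⟩ := exists_local_inverse hf hinv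
  have hfx : f (L.symm (c 1)) = x₀ := by simp only [f, L.apply_symm_apply, hc1, one_smul]
  rw [hfx] at h1 h2
  have hτ0 : ContMDiffAt 𝓘(ℝ, E4) 𝓘(ℝ, E) ∞ τ x₀ := by
    have h3 : ContMDiffAt 𝓘(ℝ, E4) 𝓘(ℝ, E) ∞ (fun z => c.symm (L (ψ z))) x₀ :=
      ContMDiffAt.comp (g := fun p => c.symm (L p)) x₀
        (hcL _ (by rw [h1, L.apply_symm_apply]; exact hct)) h2.self_of_nhds.2
    refine h3.congr_of_eventuallyEq ?_
    filter_upwards [h2] with z hz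
    exact hinj ((hτ z).trans hz.1.symm)
  intro x
  have h5 : τ = fun z => τ x * τ ((τ x)⁻¹ • z) := by
    ext1 z
    refine hinj ((hτ z).trans ?_)
    show z = (τ x * τ ((τ x)⁻¹ • z)) • x₀
    rw [mul_smul, hτ, smul_inv_smul]
  have h6 : (τ x)⁻¹ • x = x₀ := by
    rw [inv_smul_eq_iff, hτ x]
  rw [h5]
  refine ContMDiffAt.comp (g := fun b => τ x * b) x
    ((contMDiff_mul_left (I := 𝓘(ℝ, E)) (n := ∞)) _) ?_
  refine ContMDiffAt.comp (g := τ) (f := fun z => (τ x)⁻¹ • z) x (by rw [h6]; exact hτ0)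
    (contMDiff_const_smul' hsm _ x)

/-- A manifold with a simply transitive smooth group action is a Lie group whose left translations
are the transformations of the action. -/
theorem exists_lieGroup_of_simplyTransitive [T2Space M] [SecondCountableTopology G]
    (hsm : ContMDiff (𝓘(ℝ, E).prod 𝓘(ℝ, E4)) 𝓘(ℝ, E4) ∞ (fun p : G × M => p.1 • p.2))
    (hst : ∀ x y : M, ∃! a : G, a • x = y) (x₀ : M) :
    ∃ _ : Group M, LieGroup 𝓘(ℝ, E4) ∞ M ∧ ∀ x : M, ∃ a : G, ∀ y : M, x * y = a • y := by
  choose τ hτ hτu using fun x => hst x₀ x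
  have hinj : Function.Injective (fun a : G => a • x₀) := fun a b hab =>
    (hτu _ a rfl).trans (hτu _ b hab.symm).symm
  have hτs : ContMDiff 𝓘(ℝ, E4) 𝓘(ℝ, E) ∞ τ := contMDiff_inverse_orbit hsm x₀ hinj hτ
  have hτm : ∀ a x, τ (a • x) = a * τ x := fun a x =>
    (hτu _ _ (by show (a * τ x) • x₀ = _; rw [mul_smul]; exact congrArg _ (hτ x))).symm
  have hτ1 : τ x₀ = 1 := (hτu _ _ (one_smul _ _)).symm
  let inst : Group M :=
    { mul := fun x y => τ x • y
      one := x₀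
      inv := fun x => (τ x)⁻¹ • x₀
      mul_assoc := fun x y z => by
        show τ (τ x • y) • z = τ x • τ y • z
        rw [hτm, mul_smul]
      one_mul := fun x => by
        show τ x₀ • x = x
        rw [hτ1, one_smul]
      mul_one := fun x => hτ x
      inv_mul_cancel := fun x => by
        show τ ((τ x)⁻¹ • x₀) • x = x₀
        rw [hτm, hτ1, mul_one]
        exact inv_smul_eq_iff.2 (hτ x).symm }
  refine ⟨inst, ?_, fun x => ⟨τ x, fun y => rfl⟩⟩
  exact
    { contMDiff_mul := hsm.comp ((hτs.comp contMDiff_fst).prodMk contMDiff_snd)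
      contMDiff_inv := (contMDiff_smul_const hsm x₀).comp ((contMDiff_inv 𝓘(ℝ, E) ∞).comp hτs) }

end LieGroupStructure

/-! ### The Lie algebra of left-invariant fields -/

section LeftInvariant

open Set Filter Topology VectorField

variable {M : Type*} [TopologicalSpace M] [ChartedSpace E4 M] [Group M] [LieGroup 𝓘(ℝ, E4) ∞ M]

theorem mdifferentiable_leftMul (x : M) : MDifferentiable 𝓘(ℝ, E4) 𝓘(ℝ, E4) (fun y : M => x * y) :=
  (contMDiff_mul_left (I := 𝓘(ℝ, E4)) (n := ∞)).mdifferentiable (by simp)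

theorem leftField_add (v w : E4) (x : M) : leftField (v + w) x = leftField v x + leftField w x :=
  map_add _ _ _

theorem leftField_smul (t : ℝ) (v : E4) (x : M) : leftField (t • v) x = t • leftField v x :=
  map_smul _ _ _

theorem leftField_sum {ι : Type*} (s : Finset ι) (v : ι → E4) (x : M) :
    leftField (∑ i ∈ s, v i) x = ∑ i ∈ s, leftField (v i) x :=
  map_sum _ _ _

theorem leftField_one (v : E4) : leftField v (1 : M) = v := by
  have : (fun y : M => 1 * y) = fun y => y := by ext; simp
  rw [leftField, this, mD_id]
  rfl

theorem mD_mul_left_leftField (v : E4) (a x : M) :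
    mD E4 E4 (fun y : M => a * y) x (leftField v x) = leftField v (a * x) := by
  have h : mD E4 E4 (fun y : M => a * (x * y)) 1 = _ :=
    mD_comp (g := fun y : M => a * y) (f := fun y => x * y)
      (mdifferentiable_leftMul a _) (mdifferentiable_leftMul x _)
  simp only [← mul_assoc, mul_one] at h
  rw [leftField, leftField, h]
  rfl

theorem leftField_injective (x : M) : Function.Injective (fun v : E4 => leftField v x) := by
  intro v w h
  have h1 := congrArg (mD E4 E4 (fun y : M => x⁻¹ * y) x) h
  simp only [mD_mul_left_leftField, inv_mul_cancel, leftField_one] at h1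
  exact h1

theorem linearIndependent_leftField {v : Fin 4 → E4} (hv : LinearIndependent ℝ v) (x : M) :
    LinearIndependent ℝ (fun i => leftField (v i) x) := by
  refine hv.map' (mD E4 E4 (fun y : M => x * y) 1 : E4 →ₗ[ℝ] E4) ?_
  exact LinearMap.ker_eq_bot.2 (leftField_injective x)

theorem smoothVF_leftField [IsManifold 𝓘(ℝ, E4) ∞ M] (v : E4) : SmoothVF (leftField (G := M) v) :=
  contMDiff_leftField v

/-- The Lie bracket on the tangent space at the identity. -/
noncomputable def lieBr (M : Type*) [TopologicalSpace M] [ChartedSpace E4 M] [Group M]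
    (v w : E4) : E4 :=
  bracket (leftField (G := M) v) (leftField w) 1

theorem lieGroup_minSmoothness : LieGroup 𝓘(ℝ, E4) (minSmoothness ℝ 3) M :=
  LieGroup.of_le (n := ∞)
    (by rw [minSmoothness_of_isRCLikeNormedField]; exact WithTop.coe_le_coe.2 le_top)

theorem bracket_leftField (v w : E4) (x : M) :
    bracket (leftField (G := M) v) (leftField w) x = leftField (lieBr M v w) x := by
  have := lieGroup_minSmoothness (M := M)
  exact (congrFun (mulInvariantVector_mlieBracket (I := 𝓘(ℝ, E4)) (G := M) v w) x).symm

theorem lieBr_add_left (u v w : E4) : lieBr M (u + v) w = lieBr M u w + lieBr M v w := by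
  have := lieGroup_minSmoothness (M := M)
  exact add_lie (L := GroupLieAlgebra 𝓘(ℝ, E4) M) (M := GroupLieAlgebra 𝓘(ℝ, E4) M) u v w

theorem lieBr_smul_left (t : ℝ) (v w : E4) : lieBr M (t • v) w = t • lieBr M v w := by
  have := lieGroup_minSmoothness (M := M)
  exact smul_lie (L := GroupLieAlgebra 𝓘(ℝ, E4) M) (M := GroupLieAlgebra 𝓘(ℝ, E4) M) t v w

theorem lieBr_add_right (u v w : E4) : lieBr M u (v + w) = lieBr M u v + lieBr M u w := by
  have := lieGroup_minSmoothness (M := M)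
  exact lie_add (L := GroupLieAlgebra 𝓘(ℝ, E4) M) (M := GroupLieAlgebra 𝓘(ℝ, E4) M) u v w

theorem lieBr_smul_right (t : ℝ) (v w : E4) : lieBr M v (t • w) = t • lieBr M v w := by
  have := lieGroup_minSmoothness (M := M)
  exact lie_smul (L := GroupLieAlgebra 𝓘(ℝ, E4) M) (M := GroupLieAlgebra 𝓘(ℝ, E4) M) t v w

theorem lieBr_self (v : E4) : lieBr M v v = 0 := by
  have := lieGroup_minSmoothness (M := M)
  exact lie_self (L := GroupLieAlgebra 𝓘(ℝ, E4) M) v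

theorem lieBr_jacobi (u v w : E4) :
    lieBr M u (lieBr M v w) = lieBr M (lieBr M u v) w + lieBr M v (lieBr M u w) := by
  have := lieGroup_minSmoothness (M := M)
  exact leibniz_lie (L₁ := GroupLieAlgebra 𝓘(ℝ, E4) M) (L₂ := GroupLieAlgebra 𝓘(ℝ, E4) M)
    (M := GroupLieAlgebra 𝓘(ℝ, E4) M) u v w

/-- The Lie bracket as a bilinear map. -/
noncomputable def lieBrₗ (M : Type*) [TopologicalSpace M] [ChartedSpace E4 M] [Group M]
    [LieGroup 𝓘(ℝ, E4) ∞ M] : E4 →ₗ[ℝ] E4 →ₗ[ℝ] E4 :=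
  LinearMap.mk₂ ℝ (lieBr M) lieBr_add_left lieBr_smul_left lieBr_add_right lieBr_smul_right

theorem homogeneousFrame_leftField [IsManifold 𝓘(ℝ, E4) ∞ M] {v : Fin 4 → E4}
    (hv : LinearIndependent ℝ v) : HomogeneousFrame (univ : Set M) (fun i => leftField (v i)) where
  isOpen := isOpen_univ
  smooth i := smoothVF_leftField _
  linearIndependent x _ := linearIndependent_leftField hv x
  exists_translations := by
    refine ⟨fun y z => y * z, fun y _ z _ => ⟨mem_univ _, Eventually.of_forall fun x =>
      ⟨contMDiff_mul_left (I := 𝓘(ℝ, E4)) (n := ∞) x, fun i => mD_mul_left_leftField _ _ _⟩⟩,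
      fun z _ => ⟨fun _ _ => mem_univ _, fun a _ b _ h => mul_right_cancel h,
        fun w _ => ⟨w * z⁻¹, mem_univ _, by simp⟩⟩⟩

end LeftInvariant

/-! ### Left-invariant hypercomplex structures -/

section LeftInvariantHypercomplex

open Set Filter Topology VectorField

variable {M : Type*} [TopologicalSpace M] [ChartedSpace E4 M] [IsManifold 𝓘(ℝ, E4) ∞ M]

/-- The inner product of two tangent vectors, regarded as elements of the model space. -/
noncomputable def ip (g : RiemMetric M) (x : M) (v w : E4) : ℝ := g.inner x v w

theorem ip_add_left (g : RiemMetric M) (x : M) (u v w : E4) :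
    ip g x (u + v) w = ip g x u w + ip g x v w :=
  congrArg (fun A : E4 →L[ℝ] ℝ => A w) (map_add (g.inner x : E4 →L[ℝ] E4 →L[ℝ] ℝ) u v)

theorem ip_smul_left (g : RiemMetric M) (x : M) (t : ℝ) (v w : E4) :
    ip g x (t • v) w = t * ip g x v w :=
  congrArg (fun A : E4 →L[ℝ] ℝ => A w) (map_smul (g.inner x : E4 →L[ℝ] E4 →L[ℝ] ℝ) t v)

theorem ip_comm (g : RiemMetric M) (x : M) (v w : E4) : ip g x v w = ip g x w v :=
  g.symm x v w

theorem ip_pos (g : RiemMetric M) (x : M) {v : E4} (hv : v ≠ 0) : 0 < ip g x v v :=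
  g.pos x v hv

/-- The inner product as a bilinear form. -/
noncomputable def ipₗ (g : RiemMetric M) (x : M) : E4 →ₗ[ℝ] E4 →ₗ[ℝ] ℝ :=
  LinearMap.mk₂ ℝ (ip g x) (ip_add_left g x) (ip_smul_left g x)
    (fun u v w => by rw [ip_comm, ip_add_left, ip_comm g x v, ip_comm g x w])
    (fun t v w => by rw [ip_comm, ip_smul_left, ip_comm g x w]; rfl)

theorem ipₗ_apply (g : RiemMetric M) (x : M) (v w : E4) : ipₗ g x v w = ip g x v w := rfl

/-- The endomorphism `J a` of the tangent space at `x`, regarded as an endomorphism of the model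
space. -/
noncomputable def Jmap (H : HypercomplexStructure M) (a : Fin 3) (x : M) : E4 →L[ℝ] E4 := H.J a x

/-- The orbit `(v, J₁ v, J₂ v, J₃ v)` of a tangent vector. -/
noncomputable def quatBasis (H : HypercomplexStructure M) (x : M) (v : E4) : Fin 4 → E4 :=
  ![v, Jmap H 0 x v, Jmap H 1 x v, Jmap H 2 x v]

/-- The matrices of `J₁, J₂, J₃` in a basis `(v, J₁ v, J₂ v, J₃ v)`: the entry `quatMat a j m` is
the coefficient of the `m`-th vector in the image of the `j`-th vector. -/
def quatMat : Fin 3 → Fin 4 → Fin 4 → ℝ :=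
  ![![![0, 1, 0, 0], ![-1, 0, 0, 0], ![0, 0, 0, 1], ![0, 0, -1, 0]],
    ![![0, 0, 1, 0], ![0, 0, 0, -1], ![-1, 0, 0, 0], ![0, 1, 0, 0]],
    ![![0, 0, 0, 1], ![0, 0, 1, 0], ![0, -1, 0, 0], ![-1, 0, 0, 0]]]

theorem Jmap_quatBasis (H : HypercomplexStructure M) (x : M) (v : E4) (a : Fin 3) (j : Fin 4) :
    Jmap H a x (quatBasis H x v j) = ∑ m, quatMat a j m • quatBasis H x v m := by
  have sq : ∀ a v, Jmap H a x (Jmap H a x v) = -v := fun a v => H.sq a x v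
  have h01 : ∀ v, Jmap H 0 x (Jmap H 1 x v) = Jmap H 2 x v := H.mul x
  have h10 : ∀ v, Jmap H 1 x (Jmap H 0 x v) = -Jmap H 2 x v := H.mul_anti x
  have h02 : ∀ v, Jmap H 0 x (Jmap H 2 x v) = -Jmap H 1 x v := fun v => by rw [← h01, sq]
  have h21 : ∀ v, Jmap H 2 x (Jmap H 1 x v) = -Jmap H 0 x v := fun v => by
    rw [← h01, sq, map_neg]
  have h20 : ∀ v, Jmap H 2 x (Jmap H 0 x v) = Jmap H 1 x v := fun v => by
    rw [← h01, h10, map_neg, h02, neg_neg]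
  have h12 : ∀ v, Jmap H 1 x (Jmap H 2 x v) = Jmap H 0 x v := fun v => by
    rw [← h01, h10, h21, neg_neg]
  fin_cases a <;> fin_cases j <;>
    simp [quatBasis, quatMat, Fin.sum_univ_four, sq, h01, h10, h02, h21, h20, h12]

theorem ip_quatBasis {H : HypercomplexStructure M} {g : RiemMetric M} (hg : IsHyperHermitian H g)
    (x : M) (v : E4) (i j : Fin 4) : ip g x (quatBasis H x v i) (quatBasis H x v j)
      = if i = j then ip g x v v else 0 := by
  have hJ : ∀ a v w, ip g x (Jmap H a x v) (Jmap H a x w) = ip g x v w := fun a v w => hg a x v w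
  have neg_right : ∀ v w, ip g x v (-w) = - ip g x v w := fun v w => map_neg (ipₗ g x v) w
  have hsq : ∀ a v, Jmap H a x (Jmap H a x v) = -v := fun a v => H.sq a x v
  have h01 : ∀ v, Jmap H 0 x (Jmap H 1 x v) = Jmap H 2 x v := H.mul x
  have h10 : ∀ v, Jmap H 1 x (Jmap H 0 x v) = -Jmap H 2 x v := H.mul_anti x
  have h0 : ∀ a v, ip g x v (Jmap H a x v) = 0 := by
    intro a v
    have h1 := hJ a v (Jmap H a x v)
    rw [hsq, neg_right, ip_comm] at h1
    linarith
  have h02 : ip g x (Jmap H 0 x v) (Jmap H 1 x v) = 0 := by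
    have h1 := hJ 0 (Jmap H 0 x v) (Jmap H 1 x v)
    rw [hsq, h01, ip_comm, neg_right, ip_comm, h0] at h1
    linarith
  have h03 : ip g x (Jmap H 0 x v) (Jmap H 2 x v) = 0 := by
    rw [← h01, hJ, h0]
  have h23 : ip g x (Jmap H 1 x v) (Jmap H 2 x v) = 0 := by
    have h1 := hJ 1 v (Jmap H 0 x v)
    rw [h10, neg_right, h0] at h1
    linarith
  fin_cases i <;> fin_cases j <;> simp [quatBasis, h0, h02, h03, h23, hJ, ip_comm g x _ v,
    ip_comm g x _ (Jmap H 0 x v), ip_comm g x (Jmap H 2 x v) (Jmap H 1 x v)]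

theorem linearIndependent_quatBasis {H : HypercomplexStructure M} {g : RiemMetric M}
    (hg : IsHyperHermitian H g) (x : M) {v : E4} (hv : v ≠ 0) :
    LinearIndependent ℝ (quatBasis H x v) := by
  rw [Fintype.linearIndependent_iff]
  intro t ht i
  have h1 := congrArg (fun w => ipₗ g x w (quatBasis H x v i)) ht
  simp only [map_sum, map_smul, LinearMap.sum_apply, LinearMap.smul_apply, ipₗ_apply,
    ip_quatBasis hg, smul_eq_mul, mul_ite, mul_zero, Finset.sum_ite_eq', Finset.mem_univ,
    if_true, map_zero, LinearMap.zero_apply] at h1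
  exact (mul_eq_zero.1 h1).resolve_right (ip_pos g x hv).ne'

variable [Group M] [LieGroup 𝓘(ℝ, E4) ∞ M]

/-- The left translations are hypercomplex isometries. -/
structure IsLeftInvariant (H : HypercomplexStructure M) (g : RiemMetric M) : Prop where
  metric : ∀ a : M, PreservesMetric g (fun x => a * x)
  hypercomplex : ∀ a : M, IsHypercomplexMap H (fun x => a * x)

variable {H : HypercomplexStructure M} {g h : RiemMetric M}

theorem IsLeftInvariant.ip_leftField (hl : IsLeftInvariant H g) (x : M) (v w : E4) :
    ip g x (leftField v x) (leftField w x) = ip g 1 v w := by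
  have h1 : ip g (x * 1) (leftField v x) (leftField w x) = ip g 1 v w := hl.metric x 1 v w
  rwa [mul_one] at h1

theorem IsLeftInvariant.Jmap_leftField (hl : IsLeftInvariant H g) (a : Fin 3) (x : M) (v : E4) :
    Jmap H a x (leftField v x) = leftField (Jmap H a 1 v) x := by
  have h1 : leftField (Jmap H a 1 v) x = Jmap H a (x * 1) (leftField v x) :=
    hl.hypercomplex x a 1 v
  rw [h1, mul_one]

/-- The closedness of the form `ω_a` of `h = e^{-f} g`, evaluated on left-invariant fields. -/
theorem IsLeftInvariant.closed (hl : IsLeftInvariant H g) (hh : IsHyperKahler H h) {f : M → ℝ}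
    (hf : ContMDiff 𝓘(ℝ, E4) 𝓘(ℝ, ℝ) ∞ f)
    (hgf : ∀ x v w, ip g x v w = Real.exp (f x) * ip h x v w) (a : Fin 3) (u v w : E4) (x : M) :
    -(lieD (leftField u) f x * ip g 1 v (Jmap H a 1 w))
      + lieD (leftField v) f x * ip g 1 u (Jmap H a 1 w)
      - lieD (leftField w) f x * ip g 1 u (Jmap H a 1 v)
      - ip g 1 (lieBr M u v) (Jmap H a 1 w) + ip g 1 (lieBr M u w) (Jmap H a 1 v)
      - ip g 1 (lieBr M v w) (Jmap H a 1 u) = 0 := by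
  have hom : ∀ y : M, ∀ v w : E4, omegaForm H h a y (leftField (E := E4) v y) (leftField (E := E4) w y)
      = Real.exp (-f y) * ip g 1 v (Jmap H a 1 w) := by
    intro y v w
    have h1 : omegaForm H h a y (leftField (E := E4) v y) (leftField (E := E4) w y)
      = ip h y (leftField v y) (Jmap H a y (leftField w y)) := rfl
    rw [h1, hl.Jmap_leftField, ← hl.ip_leftField y, hgf, ← mul_assoc, ← Real.exp_add]
    simp
  have hder : ∀ u v w : E4, derivAlong (leftField u)
      (fun y => omegaForm H h a y (leftField (E := E4) v y) (leftField (E := E4) w y)) x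
      = -(Real.exp (-f x) * lieD (leftField u) f x * ip g 1 v (Jmap H a 1 w)) := by
    intro u v w
    have h2 : (fun y => omegaForm H h a y (leftField (E := E4) v y) (leftField (E := E4) w y))
      = fun y => (fun t => Real.exp (-t) * ip g 1 v (Jmap H a 1 w)) (f y) := by
      ext y; exact hom y v w
    have h3 : HasDerivAt (fun t => Real.exp (-t) * ip g 1 v (Jmap H a 1 w))
        (-(Real.exp (-f x) * ip g 1 v (Jmap H a 1 w))) (f x) := by
      have h4 := ((hasDerivAt_neg (f x)).exp).mul_const (ip g 1 v (Jmap H a 1 w))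
      rwa [show Real.exp (-f x) * -1 * ip g 1 v (Jmap H a 1 w)
        = -(Real.exp (-f x) * ip g 1 v (Jmap H a 1 w)) by ring] at h4
    rw [h2, derivAlong_eq_lieD, lieD_comp_deriv h3 (hf.mdifferentiable (by simp) x)]
    ring
  have hbr : ∀ u v : E4, mlieBracket 𝓘(ℝ, E4) (leftField (G := M) u) (leftField v) x
      = leftField (lieBr M u v) x := fun u v => bracket_leftField u v x
  have h5 := hh.2 a (leftField u) (leftField v) (leftField w) (smoothVF_leftField u)
    (smoothVF_leftField v) (smoothVF_leftField w) x
  simp only [extD] at h5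
  rw [hder, hder, hder, hbr, hbr, hbr, hom, hom, hom] at h5
  have h6 := Real.exp_pos (-f x)
  refine (mul_eq_zero.1 (show Real.exp (-f x) * _ = 0 from ?_)).resolve_left h6.ne'
  linarith

theorem isHyperHermitian_of_conformal (hh : IsHyperHermitian H h) {f : M → ℝ}
    (hgf : ∀ x v w, ip g x v w = Real.exp (f x) * ip h x v w) : IsHyperHermitian H g := by
  intro a x (v : E4) (w : E4)
  have h1 : ip g x (Jmap H a x v) (Jmap H a x w) = ip g x v w := by
    have h2 : ip h x (Jmap H a x v) (Jmap H a x w) = ip h x v w := hh a x v w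
    rw [hgf, hgf, h2]
  exact h1

/-- The structure constants `c i j k` of a Lie bracket and the components `θ i` of a covector, in a
basis `(v, J₁ v, J₂ v, J₃ v)`, satisfy the linear equations expressing that the conformal change of
the metric by a function with differential `θ` is hyper-Kähler, and the quadratic ones. -/
structure IsQuatStruct (c : Fin 4 → Fin 4 → Fin 4 → ℝ) (θ : Fin 4 → ℝ) : Prop where
  antisymm : ∀ i j k, c i j k = - c j i k
  closed : ∀ a i j k, -(θ i * quatMat a k j) + θ j * quatMat a k i - θ k * quatMat a j i
    - ∑ m, c i j m * quatMat a k m + ∑ m, c i k m * quatMat a j m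
    - ∑ m, c j k m * quatMat a i m = 0
  grad : ∀ i j, ∑ k, c i j k * θ k = 0
  jacobi : ∀ i j k m, ∑ l, (c j k l * c i l m - c i j l * c l k m - c i k l * c j l m) = 0

/-- Coefficients of the Lie bracket in a basis. -/
noncomputable def structConst (M : Type*) [TopologicalSpace M] [ChartedSpace E4 M] [Group M]
    (v : Fin 4 → E4) (i j k : Fin 4) : ℝ := (frameMap v).inverse (lieBr M (v i) (v j)) k

theorem lieBr_eq_sum {v : Fin 4 → E4} (hv : LinearIndependent ℝ v) (i j : Fin 4) :
    lieBr M (v i) (v j) = ∑ k, structConst M v i j k • v k :=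
  eq_sum_of_linearIndependent hv _

theorem ip_Jmap_quatBasis (hg : IsHyperHermitian H g) (x : M) (v : E4) (a : Fin 3)
    (i j : Fin 4) : ip g x (quatBasis H x v i) (Jmap H a x (quatBasis H x v j))
      = ip g x v v * quatMat a j i := by
  rw [Jmap_quatBasis, ← ipₗ_apply, map_sum]
  simp [ipₗ_apply, ip_quatBasis hg, mul_comm]

/-- The closedness equations in a basis `(v, J₁ v, J₂ v, J₃ v)`. -/
theorem IsLeftInvariant.closed_quatBasis (hl : IsLeftInvariant H g) (hh : IsHyperKahler H h)
    {f : M → ℝ} (hf : ContMDiff 𝓘(ℝ, E4) 𝓘(ℝ, ℝ) ∞ f)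
    (hgf : ∀ x v w, ip g x v w = Real.exp (f x) * ip h x v w) {v : E4} (hv : v ≠ 0)
    (a : Fin 3) (i j k : Fin 4) (x : M) :
    -(lieD (leftField (quatBasis H 1 v i)) f x * quatMat a k j)
      + lieD (leftField (quatBasis H 1 v j)) f x * quatMat a k i
      - lieD (leftField (quatBasis H 1 v k)) f x * quatMat a j i
      - ∑ m, structConst M (quatBasis H 1 v) i j m * quatMat a k m
      + ∑ m, structConst M (quatBasis H 1 v) i k m * quatMat a j m
      - ∑ m, structConst M (quatBasis H 1 v) j k m * quatMat a i m = 0 := by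
  have hg := isHyperHermitian_of_conformal hh.1 hgf
  have hli := linearIndependent_quatBasis hg 1 hv
  have hbr : ∀ i j k, ip g 1 (lieBr M (quatBasis H 1 v i) (quatBasis H 1 v j))
      (Jmap H a 1 (quatBasis H 1 v k))
      = ip g 1 v v * ∑ m, structConst M (quatBasis H 1 v) i j m * quatMat a k m := by
    intro i j k
    rw [lieBr_eq_sum hli, ← ipₗ_apply, map_sum, LinearMap.sum_apply, Finset.mul_sum]
    refine Finset.sum_congr rfl fun m _ => ?_
    rw [map_smul, LinearMap.smul_apply, ipₗ_apply, ip_Jmap_quatBasis hg, smul_eq_mul]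
    ring
  have h1 := hl.closed hh hf hgf a (quatBasis H 1 v i) (quatBasis H 1 v j) (quatBasis H 1 v k) x
  rw [hbr, hbr, hbr, ip_Jmap_quatBasis hg, ip_Jmap_quatBasis hg, ip_Jmap_quatBasis hg] at h1
  refine (mul_eq_zero.1 (show ip g 1 v v * _ = 0 from ?_)).resolve_left (ip_pos g 1 hv).ne'
  linear_combination h1

theorem quatBasis_zero (H : HypercomplexStructure M) (x : M) (v : E4) : quatBasis H x v 0 = v :=
  rfl

/-- The logarithm of the conformal factor has constant derivative along left-invariant fields. -/
theorem IsLeftInvariant.lieD_eq (hl : IsLeftInvariant H g) (hh : IsHyperKahler H h)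
    {f : M → ℝ} (hf : ContMDiff 𝓘(ℝ, E4) 𝓘(ℝ, ℝ) ∞ f)
    (hgf : ∀ x v w, ip g x v w = Real.exp (f x) * ip h x v w) (v : E4) (x : M) :
    lieD (leftField v) f x = lieD (leftField v) f 1 := by
  rcases eq_or_ne v 0 with rfl | hv
  · have h0 : ∀ x : M, leftField (0 : E4) x = 0 := fun x => map_zero _
    simp only [lieD, h0, map_zero]
  -- on `v`, `J₂ v`, `J₃ v`, the closedness of `ω₁` expresses the derivative of `f` along `v`
  -- through the structure constants, independently of the point
  have h1 := fun x => hl.closed_quatBasis hh hf hgf hv 0 0 2 3 x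
  have h2 := h1 x
  have h3 := h1 1
  simp [quatMat, quatBasis_zero] at h2 h3
  linarith

/-- The differential of `f` has constant coefficients and is closed, so it vanishes on brackets. -/
theorem IsLeftInvariant.lieD_lieBr (hl : IsLeftInvariant H g) (hh : IsHyperKahler H h)
    {f : M → ℝ} (hf : ContMDiff 𝓘(ℝ, E4) 𝓘(ℝ, ℝ) ∞ f)
    (hgf : ∀ x v w, ip g x v w = Real.exp (f x) * ip h x v w) (v w : E4) :
    lieD (leftField (lieBr M v w)) f 1 = 0 := by
  have h1 := lieD_bracket (smoothVF_leftField (M := M) v) (smoothVF_leftField w)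
    (hf.contMDiffAt (x := 1))
  have h2 : ∀ v w : E4, lieD (leftField v) (lieD (leftField w) f) (1 : M) = 0 := by
    intro v w
    have h3 : lieD (leftField w) f = fun _ => lieD (leftField w) f (1 : M) :=
      funext fun x => hl.lieD_eq hh hf hgf w x
    rw [h3, lieD_const]
  rw [h2, h2, sub_zero] at h1
  have h4 : bracket (leftField (G := M) v) (leftField w) = leftField (lieBr M v w) :=
    funext fun x => bracket_leftField v w x
  rwa [h4] at h1

theorem lieD_leftField_sum (f : M → ℝ) (x : M) (t : Fin 4 → ℝ) (v : Fin 4 → E4) :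
    lieD (leftField (∑ i, t i • v i)) f x = ∑ i, t i * lieD (leftField (v i)) f x :=
  lieD_sum_smul (fun i => leftField (v i)) t (leftField (∑ i, t i • v i)) f x
    (by rw [leftField_sum]; simp only [leftField_smul])

theorem structConst_jacobi {v : Fin 4 → E4} (hv : LinearIndependent ℝ v) (i j k m : Fin 4) :
    ∑ l, (structConst M v j k l * structConst M v i l m
      - structConst M v i j l * structConst M v l k m
      - structConst M v i k l * structConst M v j l m) = 0 := by
  have hL : ∀ u w, lieBrₗ M u w = lieBr M u w := fun _ _ => rfl
  have h1 := lieBr_jacobi (M := M) (v i) (v j) (v k)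
  rw [lieBr_eq_sum hv j k, lieBr_eq_sum hv i j, lieBr_eq_sum hv i k, ← hL, ← hL, ← hL, map_sum,
    map_sum, map_sum, LinearMap.sum_apply] at h1
  simp only [map_smul, LinearMap.smul_apply] at h1
  simp only [hL, lieBr_eq_sum hv, Finset.smul_sum, smul_smul] at h1
  rw [Finset.sum_comm, Finset.sum_comm (s := Finset.univ) (t := Finset.univ)
    (f := fun x y => (structConst M v i j x * structConst M v x k y) • v y),
    Finset.sum_comm (s := Finset.univ) (t := Finset.univ)
    (f := fun x y => (structConst M v i k x * structConst M v j x y) • v y),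
    ← Finset.sum_add_distrib, ← sub_eq_zero, ← Finset.sum_sub_distrib] at h1
  simp only [← Finset.sum_smul, ← add_smul, ← sub_smul] at h1
  have h2 := Fintype.linearIndependent_iff.1 hv _ h1 m
  rw [Finset.sum_sub_distrib, Finset.sum_sub_distrib]
  linarith

theorem structConst_antisymm (v : Fin 4 → E4) (i j k : Fin 4) :
    structConst M v i j k = - structConst M v j i k := by
  have h1 : lieBr M (v i) (v j) + lieBr M (v j) (v i) = 0 := by
    have h2 := lieBr_self (M := M) (v i + v j)
    rw [lieBr_add_left, lieBr_add_right, lieBr_add_right, lieBr_self, lieBr_self] at h2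
    simpa using h2
  have h3 := congrArg (fun w => (frameMap v).inverse w k) h1
  simp only [map_add, map_zero, PiLp.add_apply, PiLp.zero_apply] at h3
  simp only [structConst]
  linarith

theorem IsLeftInvariant.isQuatStruct (hl : IsLeftInvariant H g) (hh : IsHyperKahler H h)
    {f : M → ℝ} (hf : ContMDiff 𝓘(ℝ, E4) 𝓘(ℝ, ℝ) ∞ f)
    (hgf : ∀ x v w, ip g x v w = Real.exp (f x) * ip h x v w) {v : E4} (hv : v ≠ 0) :
    IsQuatStruct (structConst M (quatBasis H 1 v))
      (fun i => lieD (leftField (quatBasis H 1 v i)) f 1) := by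
  have hli := linearIndependent_quatBasis (isHyperHermitian_of_conformal hh.1 hgf) 1 hv
  refine ⟨structConst_antisymm _, fun a i j k => hl.closed_quatBasis hh hf hgf hv a i j k 1,
    fun i j => ?_, structConst_jacobi hli⟩
  rw [← lieD_leftField_sum, ← lieBr_eq_sum hli]
  exact hl.lieD_lieBr hh hf hgf _ _

end LeftInvariantHypercomplex

/-! ### Structure constants -/

section Algebra

/-- The matrices of the right multiplications by `1, i, j, k` in the basis `1, i, j, k`: the entry
`rightMat a j m` is the coefficient of the `m`-th quaternion unit in the product of the `j`-th and
the `a`-th one. -/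
def rightMat : Fin 4 → Fin 4 → Fin 4 → ℝ :=
  ![![![1, 0, 0, 0], ![0, 1, 0, 0], ![0, 0, 1, 0], ![0, 0, 0, 1]],
    ![![0, 1, 0, 0], ![-1, 0, 0, 0], ![0, 0, 0, -1], ![0, 0, 1, 0]],
    ![![0, 0, 1, 0], ![0, 0, 0, 1], ![-1, 0, 0, 0], ![0, -1, 0, 0]],
    ![![0, 0, 0, 1], ![0, 0, -1, 0], ![0, 1, 0, 0], ![-1, 0, 0, 0]]]

variable {c : Fin 4 → Fin 4 → Fin 4 → ℝ} {θ : Fin 4 → ℝ}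

/-- The general solution of the linear equations: identifying the basis vectors with the quaternion
units, the bracket is `[X, Y] = Y p(X) - X p(Y)` for a quaternion-valued 1-form `p` with
`θ = -2 Re p`. This is the torsion-freeness of the connection `D_X Y = Y p(X)`. -/
theorem IsQuatStruct.exists_connection (hc : IsQuatStruct c θ) :
    ∃ p : Fin 4 → Fin 4 → ℝ, (∀ i, p i 0 = -(θ i / 2)) ∧
      ∀ i j k, c i j k = ∑ a, (p i a * rightMat a j k - p j a * rightMat a i k) := by
  have e := fun a => hc.closed a 0 1 2
  have e' := fun a => hc.closed a 0 1 3
  have e'' := fun a => hc.closed a 0 2 3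
  have e''' := fun a => hc.closed a 1 2 3
  have e1 := e 0
  have e2 := e 1
  have e3 := e 2
  have e4 := e' 0
  have e5 := e' 1
  have e6 := e' 2
  have e7 := e'' 0
  have e8 := e'' 1
  have e9 := e'' 2
  have e10 := e''' 0
  have e11 := e''' 1
  have e12 := e''' 2
  clear e e' e'' e'''
  simp [quatMat, Fin.sum_univ_four] at e1 e2 e3 e4 e5 e6 e7 e8 e9 e10 e11 e12
  -- the components of `p(e₀)`
  obtain ⟨x, hx⟩ : ∃ x, x = -c 0 1 0 + θ 1 / 2 := ⟨_, rfl⟩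
  obtain ⟨y, hy⟩ : ∃ y, y = -c 0 2 0 + θ 2 / 2 := ⟨_, rfl⟩
  obtain ⟨z, hz⟩ : ∃ z, z = -c 0 3 0 + θ 3 / 2 := ⟨_, rfl⟩
  refine ⟨![![-(θ 0 / 2), x, y, z],
    ![-(θ 1 / 2), -(θ 0 / 2) - c 0 1 1, -z - c 0 1 2, y - c 0 1 3],
    ![-(θ 2 / 2), z - c 0 2 1, -(θ 0 / 2) - c 0 2 2, -x - c 0 2 3],
    ![-(θ 3 / 2), -y - c 0 3 1, x - c 0 3 2, -(θ 0 / 2) - c 0 3 3]], ?_, ?_⟩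
  · intro i
    fin_cases i <;> rfl
  · have key : ∀ i j k, i < j → c i j k = ∑ a, (((![![-(θ 0 / 2), x, y, z],
        ![-(θ 1 / 2), -(θ 0 / 2) - c 0 1 1, -z - c 0 1 2, y - c 0 1 3],
        ![-(θ 2 / 2), z - c 0 2 1, -(θ 0 / 2) - c 0 2 2, -x - c 0 2 3],
        ![-(θ 3 / 2), -y - c 0 3 1, x - c 0 3 2, -(θ 0 / 2) - c 0 3 3]] :
          Fin 4 → Fin 4 → ℝ) i a) * rightMat a j k - ((![![-(θ 0 / 2), x, y, z],
        ![-(θ 1 / 2), -(θ 0 / 2) - c 0 1 1, -z - c 0 1 2, y - c 0 1 3],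
        ![-(θ 2 / 2), z - c 0 2 1, -(θ 0 / 2) - c 0 2 2, -x - c 0 2 3],
        ![-(θ 3 / 2), -y - c 0 3 1, x - c 0 3 2, -(θ 0 / 2) - c 0 3 3]] :
          Fin 4 → Fin 4 → ℝ) j a) * rightMat a i k) := by
      intro i j k hij
      fin_cases i <;> fin_cases j <;> first
        | exact absurd hij (by decide)
        | (fin_cases k <;> simp [rightMat, Fin.sum_univ_four] <;> linarith)
    intro i j k
    rcases lt_trichotomy i j with hij | rfl | hij
    · exact key i j k hij
    · have := hc.antisymm i i k
      simp only [sub_self, Finset.sum_const_zero]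
      linarith
    · rw [hc.antisymm, key j i k hij, ← Finset.sum_neg_distrib]
      exact Finset.sum_congr rfl fun a _ => by ring

/-- If `p(e₀) = 0` and the conformal factor is constant, the Jacobi identity makes the bracket
vanish: its `e₀`-component shows that the matrix of `p` is symmetric, and then its trace is a sum
of squares. -/
theorem IsQuatStruct.eq_zero (hc : IsQuatStruct c 0) (h0 : ∀ j, c j 0 0 = 0) (i j k : Fin 4) :
    c i j k = 0 := by
  obtain ⟨p, hp0, hp⟩ := hc.exists_connection
  have hp0' : ∀ i, p i 0 = 0 := fun i => by simp [hp0]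
  have e1 := h0 1
  have e2 := h0 2
  have e3 := h0 3
  rw [hp] at e1 e2 e3
  simp [rightMat, Fin.sum_univ_four, hp0'] at e1 e2 e3
  have j1 := hc.jacobi 1 2 3 0
  have j2 := hc.jacobi 0 1 2 3
  have j3 := hc.jacobi 0 1 3 2
  have j4 := hc.jacobi 0 2 3 1
  simp only [hp] at j1 j2 j3 j4
  simp [rightMat, Fin.sum_univ_four, hp0', e1, e2, e3] at j1 j2 j3 j4
  have s1 : (p 1 2 - p 2 1) ^ 2 + (p 1 3 - p 3 1) ^ 2 + (p 2 3 - p 3 2) ^ 2 = 0 := by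
    linear_combination j1
  have z : ∀ t : ℝ, t ^ 2 ≤ 0 → t = 0 := fun t ht => pow_eq_zero_iff (two_ne_zero) |>.1
    (le_antisymm ht (sq_nonneg t))
  have t12 := sq_nonneg (p 1 2 - p 2 1)
  have t13 := sq_nonneg (p 1 3 - p 3 1)
  have t23 := sq_nonneg (p 2 3 - p 3 2)
  have s12 := sub_eq_zero.1 (z (p 1 2 - p 2 1) (by linarith))
  have s13 := sub_eq_zero.1 (z (p 1 3 - p 3 1) (by linarith))
  have s23 := sub_eq_zero.1 (z (p 2 3 - p 3 2) (by linarith))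
  simp only [← s12, ← s13, ← s23] at j2 j3 j4
  have s2 : 2 * (p 1 2 ^ 2 + p 1 3 ^ 2 + p 2 3 ^ 2) + p 1 1 ^ 2 + p 2 2 ^ 2 + p 3 3 ^ 2 = 0 := by
    linear_combination (j3 - j2 - j4) / 2
  have q12 := sq_nonneg (p 1 2)
  have q13 := sq_nonneg (p 1 3)
  have q23 := sq_nonneg (p 2 3)
  have q11 := sq_nonneg (p 1 1)
  have q22 := sq_nonneg (p 2 2)
  have q33 := sq_nonneg (p 3 3)
  have z12 := z (p 1 2) (by linarith)
  have z13 := z (p 1 3) (by linarith)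
  have z23 := z (p 2 3) (by linarith)
  have z11 := z (p 1 1) (by linarith)
  have z22 := z (p 2 2) (by linarith)
  have z33 := z (p 3 3) (by linarith)
  rw [hp]
  have hz : ∀ i a, p i a = 0 := by
    intro i a
    fin_cases i <;> fin_cases a <;> simp [hp0', e1, e2, e3, z11, z12, z13, z22, z23, z33,
      ← s12, ← s13, ← s23]
  simp [hz]

/-- If the gradient is twice the first basis vector, the bracket is given by a symmetric matrix. -/
theorem IsQuatStruct.exists_symmetric (hc : IsQuatStruct c ![2, 0, 0, 0]) :
    ∃ A : Matrix (Fin 3) (Fin 3) ℝ, (∀ a b, A a b = A b a) ∧ (∀ i j, c i j 0 = 0) ∧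
      (∀ a b, c 0 a.succ b.succ = -(if a = b then 1 else 0) - A a b) ∧
      (∀ b, c 1 2 b.succ = ![A 2 0, A 2 1, -(A 0 0 + A 1 1)] b) ∧
      (∀ b, c 2 3 b.succ = ![-(A 1 1 + A 2 2), A 0 1, A 0 2] b) ∧
      (∀ b, c 3 1 b.succ = ![A 1 0, -(A 0 0 + A 2 2), A 1 2] b) := by
  obtain ⟨p, hp0, hp⟩ := hc.exists_connection
  have h0 : ∀ i j, c i j 0 = 0 := fun i j => by
    have := hc.grad i j
    simpa [Fin.sum_univ_four] using this
  have p00 := hp0 0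
  have p10 := hp0 1
  have p20 := hp0 2
  have p30 := hp0 3
  simp at p00 p10 p20 p30
  have e1 := h0 0 1
  have e2 := h0 0 2
  have e3 := h0 0 3
  have e4 := h0 1 2
  have e5 := h0 1 3
  have e6 := h0 2 3
  rw [hp] at e1 e2 e3 e4 e5 e6
  simp [rightMat, Fin.sum_univ_four, p00, p10, p20, p30] at e1 e2 e3 e4 e5 e6
  refine ⟨fun a b => p a.succ b.succ, ?_, h0, ?_, ?_, ?_, ?_⟩
  · intro a b
    fin_cases a <;> fin_cases b <;> simp <;> linarith
  · intro a b
    rw [hp]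
    fin_cases a <;> fin_cases b <;>
      simp [rightMat, Fin.sum_univ_four, p00, p10, p20, p30, e1, e2, e3]
  all_goals
    intro b
    rw [hp]
    fin_cases b <;> simp [rightMat, Fin.sum_univ_four, p10, p20, p30] <;> linarith

/-- If `p(n) = 0` for a vector `n`, then the bracket with `n` has no component along `n`. -/
theorem sum_bracket_eq_zero {p : Fin 4 → Fin 4 → ℝ} {b : Fin 4 → Fin 4 → Fin 4 → ℝ}
    (hp0 : ∀ i, p i 0 = 0)
    (hp : ∀ i j k, b i j k = ∑ a, (p i a * rightMat a j k - p j a * rightMat a i k))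
    {n : Fin 4 → ℝ} (hn : ∀ a, ∑ i, n i * p i a = 0) (l : Fin 4) :
    ∑ j, ∑ k, n j * n k * b l j k = 0 := by
  have h1 := hn 1
  have h2 := hn 2
  have h3 := hn 3
  simp only [Fin.sum_univ_four] at h1 h2 h3
  simp only [hp]
  fin_cases l <;> simp [rightMat, Fin.sum_univ_four, hp0]
  · linear_combination -n 1 * h1 - n 2 * h2 - n 3 * h3
  · linear_combination n 0 * h1 - n 3 * h2 + n 2 * h3
  · linear_combination n 3 * h1 + n 0 * h2 - n 1 * h3
  · linear_combination -n 2 * h1 + n 1 * h2 + n 0 * h3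

end Algebra

/-! ### Adapted left-invariant frames -/

section AdaptedFrames

open Set Filter Topology

variable {M : Type*} [TopologicalSpace M] [ChartedSpace E4 M] [IsManifold 𝓘(ℝ, E4) ∞ M]
  [Group M] [LieGroup 𝓘(ℝ, E4) ∞ M] {H : HypercomplexStructure M} {g h : RiemMetric M}

theorem quatBasis_succ (H : HypercomplexStructure M) (x : M) (v : E4) (a : Fin 3) :
    quatBasis H x v a.succ = Jmap H a x v := by
  fin_cases a <;> rfl

theorem linearIndependent_of_ip {g : RiemMetric M} {x : M} {v : Fin 4 → E4} {r : ℝ} (hr : 0 < r)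
    (hv : ∀ i j, ip g x (v i) (v j) = if i = j then r else 0) : LinearIndependent ℝ v := by
  rw [Fintype.linearIndependent_iff]
  intro t ht i
  have h1 := congrArg (fun w => ipₗ g x w (v i)) ht
  simp only [map_sum, map_smul, LinearMap.sum_apply, LinearMap.smul_apply, ipₗ_apply,
    hv, smul_eq_mul, mul_ite, mul_zero, Finset.sum_ite_eq', Finset.mem_univ,
    if_true, map_zero, LinearMap.zero_apply] at h1
  exact (mul_eq_zero.1 h1).resolve_right hr.ne'

/-- A suitable multiple of the gradient of the conformal factor, together with its images under the
three complex structures, is a frame of which only the first vector differentiates the factor. -/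
theorem exists_gradient_quatBasis (H : HypercomplexStructure M) (f : M → ℝ)
    (hf : ∃ v : E4, lieD (leftField v) f (1 : M) ≠ 0) :
    ∃ v : E4, v ≠ 0 ∧
      ∀ i, lieD (leftField (quatBasis H 1 v i)) f (1 : M) = (![2, 0, 0, 0] : Fin 4 → ℝ) i := by
  obtain ⟨u, hu⟩ := hf
  set t : Fin 4 → ℝ := fun i => lieD (leftField (quatBasis H 1 u i)) f (1 : M) with ht
  have hs : 0 < ∑ i, t i * t i := by
    have h0 : 0 < t 0 * t 0 := mul_self_pos.2 hu
    rw [Fin.sum_univ_four]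
    linarith [mul_self_nonneg (t 1), mul_self_nonneg (t 2), mul_self_nonneg (t 3)]
  set s := ∑ i, t i * t i with hs'
  set v : E4 := ∑ i, (2 / s * t i) • quatBasis H 1 u i with hv
  have hv2 : lieD (leftField v) f (1 : M) = 2 := by
    rw [hv, lieD_leftField_sum]
    have : ∀ i, 2 / s * t i * lieD (leftField (quatBasis H 1 u i)) f (1 : M)
        = 2 / s * (t i * t i) := fun i => by simp only [ht]; ring
    simp only [this]
    rw [← Finset.mul_sum, ← hs', div_mul_cancel₀ _ hs.ne']
  refine ⟨v, ?_, fun i => ?_⟩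
  · intro h0
    have h1 : leftField (0 : E4) (1 : M) = 0 := map_zero _
    rw [h0, lieD, h1, map_zero] at hv2
    exact two_ne_zero hv2.symm
  refine Fin.cases hv2 (fun a => ?_) i
  have h1 : (![2, 0, 0, 0] : Fin 4 → ℝ) a.succ = 0 := by fin_cases a <;> rfl
  rw [h1, quatBasis_succ, hv, map_sum]
  have h2 : ∀ i, Jmap H a 1 ((2 / s * t i) • quatBasis H 1 u i)
      = ∑ m, (2 / s * t i * quatMat a i m) • quatBasis H 1 u m := fun i => by
    rw [map_smul, Jmap_quatBasis, Finset.smul_sum]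
    simp only [smul_smul]
  simp only [h2]
  rw [Finset.sum_comm]
  simp only [← Finset.sum_smul]
  rw [lieD_leftField_sum]
  have h3 : ∀ m, (∑ i, 2 / s * t i * quatMat a i m)
      * lieD (leftField (quatBasis H 1 u m)) f (1 : M)
      = ∑ i, 2 / s * (t i * t m * quatMat a i m) := fun m => by
    rw [Finset.sum_mul]
    exact Finset.sum_congr rfl fun i _ => by simp only [ht]; ring
  simp only [h3]
  fin_cases a <;> simp [Fin.sum_univ_four, quatMat] <;> ring

/-- When the conformal factor is constant, the form `p` of `IsQuatStruct.exists_connection` takes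
values in the three-dimensional space of imaginary quaternions, so it has a kernel; for `v` in this
kernel no bracket `[w, v]` has a component along `v`. -/
theorem IsLeftInvariant.exists_parallel (hl : IsLeftInvariant H g) (hh : IsHyperKahler H h)
    {f : M → ℝ} (hf : ContMDiff 𝓘(ℝ, E4) 𝓘(ℝ, ℝ) ∞ f)
    (hgf : ∀ x v w, ip g x v w = Real.exp (f x) * ip h x v w)
    (h0 : ∀ v : E4, lieD (leftField v) f (1 : M) = 0) :
    ∃ v : E4, v ≠ 0 ∧ ∀ j, structConst M (quatBasis H 1 v) j 0 0 = 0 := by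
  have hg := isHyperHermitian_of_conformal hh.1 hgf
  obtain ⟨u, hu⟩ := exists_ne (0 : E4)
  set q := quatBasis H 1 u with hq
  have hli : LinearIndependent ℝ q := linearIndependent_quatBasis hg 1 hu
  obtain ⟨p, hp0, hp⟩ := (hl.isQuatStruct hh hf hgf hu).exists_connection
  simp only [h0, zero_div, neg_zero] at hp0
  obtain ⟨n, hn0, hn⟩ := Matrix.exists_vecMul_eq_zero_iff.2
    (Matrix.det_eq_zero_of_column_eq_zero (A := p) 0 hp0)
  have hn' : ∀ a, ∑ i, n i * p i a = 0 := fun a => congrFun hn a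
  set v : E4 := ∑ i, n i • q i with hv
  have hv0 : v ≠ 0 := fun h => hn0 (funext (Fintype.linearIndependent_iff.1 hli n h))
  have hli' := linearIndependent_quatBasis hg 1 hv0
  refine ⟨v, hv0, fun j => ?_⟩
  have hipq : ∀ i j, ip g 1 (q i) (q j) = if i = j then ip g 1 u u else 0 :=
    ip_quatBasis hg 1 u
  have hL : ∀ u w, lieBrₗ M u w = lieBr M u w := fun _ _ => rfl
  have h1 : ∀ w, ip g 1 (lieBr M w v) v = 0 := by
    intro w
    rw [eq_sum_of_linearIndependent hli w, ← hL, ← ipₗ_apply]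
    simp only [map_sum, map_smul, LinearMap.sum_apply, LinearMap.smul_apply]
    refine Finset.sum_eq_zero fun l _ => ?_
    have h2 : ipₗ g 1 (lieBrₗ M (q l) v) v
        = ip g 1 u u * ∑ j, ∑ k, n j * n k * structConst M q l j k := by
      rw [hv]
      simp only [map_sum, map_smul, LinearMap.sum_apply, LinearMap.smul_apply]
      simp only [hL, lieBr_eq_sum hli, map_sum, map_smul, LinearMap.sum_apply,
        LinearMap.smul_apply, ipₗ_apply, smul_eq_mul, hipq, mul_ite, mul_zero,
        Finset.sum_ite_eq', Finset.mem_univ, if_true, Finset.mul_sum]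
      rw [Finset.sum_comm]
      exact Finset.sum_congr rfl fun j _ => Finset.sum_congr rfl fun k _ => by ring
    rw [h2, sum_bracket_eq_zero hp0 hp hn', mul_zero, smul_zero]
  have h3 := h1 (quatBasis H 1 v j)
  have h4 := lieBr_eq_sum (M := M) hli' j 0
  rw [quatBasis_zero] at h4
  rw [h4, ← ipₗ_apply] at h3
  have h5 : ∀ i, ip g 1 (quatBasis H 1 v i) v = if i = 0 then ip g 1 v v else 0 := fun i => by
    rw [← ip_quatBasis hg 1 v i 0, quatBasis_zero]
  simp only [map_sum, map_smul, LinearMap.sum_apply, LinearMap.smul_apply, ipₗ_apply, h5,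
    smul_eq_mul, mul_ite, mul_zero, Finset.sum_ite_eq', Finset.mem_univ,
    if_true] at h3
  exact (mul_eq_zero.1 h3).resolve_right (ip_pos g 1 hv0).ne'

end AdaptedFrames

/-! ### Diagonalisation of the bracket -/

section Diagonalisation

open Matrix

/-- A real symmetric `3 × 3` matrix has a positively oriented orthonormal basis of eigenvectors. -/
theorem exists_oriented_eigenbasis {A : Matrix (Fin 3) (Fin 3) ℝ} (hA : ∀ a b, A a b = A b a) :
    ∃ (u : Fin 3 → Fin 3 → ℝ) (a : Fin 3 → ℝ),
      (∀ i j, u i ⬝ᵥ u j = if i = j then 1 else 0) ∧ (∀ i, A *ᵥ u i = a i • u i) ∧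
      crossProduct (u 0) (u 1) = u 2 ∧ crossProduct (u 1) (u 2) = u 0 ∧
      crossProduct (u 2) (u 0) = u 1 ∧ A 0 0 + A 1 1 + A 2 2 = a 0 + a 1 + a 2 := by
  have hH : A.IsHermitian := Matrix.IsHermitian.ext fun i j => by simp [hA i j]
  let x : Fin 3 → Fin 3 → ℝ := fun i => (hH.eigenvectorBasis i).ofLp
  have hx : ∀ i j, x i ⬝ᵥ x j = if i = j then 1 else 0 := by
    intro i j
    have h1 := orthonormal_iff_ite.1 hH.eigenvectorBasis.orthonormal j i
    rw [EuclideanSpace.inner_eq_star_dotProduct] at h1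
    simpa [x, eq_comm] using h1
  have hAx : ∀ i, A *ᵥ x i = hH.eigenvalues i • x i := hH.mulVec_eigenvectorBasis
  have hxs : ∀ w : Fin 3 → ℝ, w = ∑ i, (x i ⬝ᵥ w) • x i := by
    intro w
    have h1 := hH.eigenvectorBasis.sum_repr' (WithLp.toLp 2 w)
    have h2 := congrArg WithLp.ofLp h1
    simp only [EuclideanSpace.inner_eq_star_dotProduct] at h2
    rw [eq_comm]
    simpa [x, dotProduct_comm] using h2
  have h3 : crossProduct (x 0) (x 1) = (x 2 ⬝ᵥ crossProduct (x 0) (x 1)) • x 2 := by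
    conv_lhs => rw [hxs (crossProduct (x 0) (x 1))]
    simp [Fin.sum_univ_three, dot_self_cross, dot_cross_self]
  have d00 := hx 0 0
  have d01 := hx 0 1
  have d11 := hx 1 1
  simp only [dotProduct, Fin.sum_univ_three] at d00 d01 d11
  simp at d00 d01 d11
  refine ⟨![x 0, x 1, crossProduct (x 0) (x 1)], hH.eigenvalues, ?_, ?_, rfl, ?_, ?_, ?_⟩
  · have h4 : crossProduct (x 0) (x 1) ⬝ᵥ crossProduct (x 0) (x 1) = 1 := by
      rw [cross_dot_cross, hx, hx, hx, hx]
      simp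
    intro i j
    fin_cases i <;> fin_cases j <;>
      simp [hx, h4, dot_self_cross, dot_cross_self, dotProduct_comm (crossProduct (x 0) (x 1))]
  · intro i
    fin_cases i
    · exact hAx 0
    · exact hAx 1
    · show A *ᵥ (crossProduct (x 0) (x 1)) = hH.eigenvalues 2 • crossProduct (x 0) (x 1)
      rw [h3, mulVec_smul, hAx, smul_comm]
  · ext k
    fin_cases k <;> simp [crossProduct]
    · linear_combination x 0 0 * d11 - x 1 0 * d01
    · linear_combination x 0 1 * d11 - x 1 1 * d01
    · linear_combination x 0 2 * d11 - x 1 2 * d01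
  · ext k
    fin_cases k <;> simp [crossProduct]
    · linear_combination x 1 0 * d00 - x 0 0 * d01
    · linear_combination x 1 1 * d00 - x 0 1 * d01
    · linear_combination x 1 2 * d00 - x 0 2 * d01
  · have h5 := hH.trace_eq_sum_eigenvalues
    simpa [Matrix.trace, Fin.sum_univ_three] using h5

end Diagonalisation

section Classification

open Matrix

variable {M : Type*} [TopologicalSpace M] [ChartedSpace E4 M] [Group M] [LieGroup 𝓘(ℝ, E4) ∞ M]

/-- The bracket relations `[v₀, vₐ] = -αₐ vₐ` and `[v₁, v₂] = β₃ v₃`, cyclically, where the indices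
of `α` and `β` are shifted by one. -/
structure IsDiagFrame (M : Type*) [TopologicalSpace M] [ChartedSpace E4 M] [Group M]
    (v : Fin 4 → E4) (α β : Fin 3 → ℝ) : Prop where
  br01 : lieBr M (v 0) (v 1) = -(α 0) • v 1
  br02 : lieBr M (v 0) (v 2) = -(α 1) • v 2
  br03 : lieBr M (v 0) (v 3) = -(α 2) • v 3
  br12 : lieBr M (v 1) (v 2) = β 2 • v 3
  br23 : lieBr M (v 2) (v 3) = β 0 • v 1
  br31 : lieBr M (v 3) (v 1) = β 1 • v 2

theorem IsDiagFrame.rotate {v : Fin 4 → E4} {α β : Fin 3 → ℝ} (h : IsDiagFrame M v α β) :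
    IsDiagFrame M ![v 0, v 2, v 3, v 1] ![α 1, α 2, α 0] ![β 1, β 2, β 0] :=
  ⟨h.br02, h.br03, h.br01, h.br23, h.br31, h.br12⟩

theorem lieBr_skew (v w : E4) : lieBr M v w = -lieBr M w v := by
  have h2 := lieBr_self (M := M) (v + w)
  rw [lieBr_add_left, lieBr_add_right, lieBr_add_right, lieBr_self, lieBr_self] at h2
  rw [eq_neg_iff_add_eq_zero]
  simpa using h2

/-- The Jacobi identity for the first three vectors of a diagonal frame. -/
theorem IsDiagFrame.jacobi {v : Fin 4 → E4} {α β : Fin 3 → ℝ} (h : IsDiagFrame M v α β)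
    (h3 : v 3 ≠ 0) : β 2 * (α 0 + α 1 - α 2) = 0 := by
  have h1 := lieBr_jacobi (M := M) (v 0) (v 1) (v 2)
  rw [h.br12, h.br01, h.br02, lieBr_smul_right, lieBr_smul_left, lieBr_smul_right, h.br12,
    h.br03, smul_smul, smul_smul, smul_smul, ← add_smul, ← sub_eq_zero, ← sub_smul] at h1
  linear_combination (smul_eq_zero.1 h1).resolve_right h3

/-- A symmetric matrix describing the bracket in an orthonormal basis may be diagonalised. -/
theorem exists_diagFrame {q : Fin 4 → E4} (hq : LinearIndependent ℝ q)
    (hc : IsQuatStruct (structConst M q) ![2, 0, 0, 0]) :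
    ∃ (u : Fin 3 → Fin 3 → ℝ) (a : Fin 3 → ℝ), (∀ i j, u i ⬝ᵥ u j = if i = j then 1 else 0) ∧
      IsDiagFrame M ![q 0, ∑ k, u 0 k • q k.succ, ∑ k, u 1 k • q k.succ, ∑ k, u 2 k • q k.succ]
        ![1 + a 0, 1 + a 1, 1 + a 2] ![-(a 1 + a 2), -(a 0 + a 2), -(a 0 + a 1)] := by
  obtain ⟨A, hA, h0, h0a, h12, h23, h31⟩ := hc.exists_symmetric
  obtain ⟨u, a, hu, hAu, x01, x12, x20, hT⟩ := exists_oriented_eigenbasis hA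
  refine ⟨u, a, hu, ?_⟩
  have b0 : ∀ k : Fin 3, lieBr M (q 0) (q k.succ) = -q k.succ - ∑ l, A k l • q l.succ := by
    intro k
    rw [lieBr_eq_sum hq, Fin.sum_univ_succ, h0]
    simp only [h0a]
    fin_cases k <;> simp [Fin.sum_univ_three] <;> module
  have b12 : lieBr M (q 1) (q 2) = A 2 0 • q 1 + A 2 1 • q 2 - (A 0 0 + A 1 1) • q 3 := by
    rw [lieBr_eq_sum hq, Fin.sum_univ_succ, h0]
    simp only [h12, Fin.sum_univ_three]
    simp
    module
  have b23 : lieBr M (q 2) (q 3) = -(A 1 1 + A 2 2) • q 1 + A 0 1 • q 2 + A 0 2 • q 3 := by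
    rw [lieBr_eq_sum hq, Fin.sum_univ_succ, h0]
    simp only [h23, Fin.sum_univ_three]
    simp
  have b31 : lieBr M (q 3) (q 1) = A 1 0 • q 1 - (A 0 0 + A 2 2) • q 2 + A 1 2 • q 3 := by
    rw [lieBr_eq_sum hq, Fin.sum_univ_succ, h0]
    simp only [h31, Fin.sum_univ_three]
    simp
    module
  have hw : ∀ u w : Fin 3 → ℝ, lieBr M (∑ k, u k • q k.succ) (∑ k, w k • q k.succ)
      = ∑ k, ((A *ᵥ crossProduct u w) k
        - (A 0 0 + A 1 1 + A 2 2) * crossProduct u w k) • q k.succ := by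
    intro u w
    simp only [Fin.sum_univ_three, lieBr_add_left, lieBr_add_right, lieBr_smul_left,
      lieBr_smul_right, lieBr_self]
    rw [lieBr_skew (q (Fin.succ 1)) (q (Fin.succ 0)), lieBr_skew (q (Fin.succ 2)) (q (Fin.succ 1)),
      lieBr_skew (q (Fin.succ 0)) (q (Fin.succ 2))]
    have b12' : lieBr M (q (Fin.succ 0)) (q (Fin.succ 1)) = _ := b12
    have b23' : lieBr M (q (Fin.succ 1)) (q (Fin.succ 2)) = _ := b23
    have b31' : lieBr M (q (Fin.succ 2)) (q (Fin.succ 0)) = _ := b31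
    rw [b12', b23', b31', show q (Fin.succ 0) = q 1 from rfl, show q (Fin.succ 1) = q 2 from rfl,
      show q (Fin.succ 2) = q 3 from rfl]
    simp only [mulVec, dotProduct, Fin.sum_univ_three, crossProduct, LinearMap.mk₂_apply,
      cons_val_zero, cons_val_one, cons_val]
    rw [hA 1 0, hA 2 0, hA 2 1]
    module
  have hw0 : ∀ u : Fin 3 → ℝ, lieBr M (q 0) (∑ k, u k • q k.succ)
      = ∑ k, (-(u k) - (A *ᵥ u) k) • q k.succ := by
    intro u
    simp only [Fin.sum_univ_three, lieBr_add_right, lieBr_smul_right, b0, mulVec, dotProduct]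
    rw [hA 1 0, hA 2 0, hA 2 1]
    module
  have hdiag0 : ∀ i, lieBr M (q 0) (∑ k, u i k • q k.succ)
      = -(1 + a i) • ∑ k, u i k • q k.succ := by
    intro i
    rw [hw0, hAu, Finset.smul_sum]
    exact Finset.sum_congr rfl fun k _ => by rw [smul_smul, Pi.smul_apply, smul_eq_mul]; ring_nf
  have hdiag : ∀ i j k, crossProduct (u i) (u j) = u k →
      lieBr M (∑ l, u i l • q l.succ) (∑ l, u j l • q l.succ)
        = (a k - (a 0 + a 1 + a 2)) • ∑ l, u k l • q l.succ := by
    intro i j k hijk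
    rw [hw, hijk, hAu, hT, Finset.smul_sum]
    exact Finset.sum_congr rfl fun k _ => by rw [smul_smul, Pi.smul_apply, smul_eq_mul]; ring_nf
  refine ⟨hdiag0 0, hdiag0 1, hdiag0 2, (hdiag 0 1 2 x01).trans ?_, (hdiag 1 2 0 x12).trans ?_,
    (hdiag 2 0 1 x20).trans ?_⟩
  · show _ = (-(a 0 + a 1)) • ∑ l, u 2 l • q l.succ
    congr 1; ring
  · show _ = (-(a 1 + a 2)) • ∑ l, u 0 l • q l.succ
    congr 1; ring
  · show _ = (-(a 0 + a 2)) • ∑ l, u 1 l • q l.succ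
    congr 1; ring

end Classification

/-! ### The possible brackets -/

section Classification

open Matrix

variable {M : Type*} [TopologicalSpace M] [ChartedSpace E4 M] [IsManifold 𝓘(ℝ, E4) ∞ M]
  [Group M] [LieGroup 𝓘(ℝ, E4) ∞ M] {H : HypercomplexStructure M} {g h : RiemMetric M}

/-- The vectors `v i` are orthogonal of square length `r` at the identity, and `f` has derivative
`θ i` along the corresponding left-invariant fields. -/
structure IsConformalFrame (g : RiemMetric M) (f : M → ℝ) (v : Fin 4 → E4) (r : ℝ)
    (θ : Fin 4 → ℝ) : Prop where
  pos : 0 < r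
  ip_eq : ∀ i j, ip g 1 (v i) (v j) = if i = j then r else 0
  lieD_eq : ∀ i, lieD (leftField (v i)) f 1 = θ i

theorem IsConformalFrame.rotate {f : M → ℝ} {v : Fin 4 → E4} {r t : ℝ}
    (hv : IsConformalFrame g f v r ![t, 0, 0, 0]) :
    IsConformalFrame g f ![v 0, v 2, v 3, v 1] r ![t, 0, 0, 0] := by
  refine ⟨hv.pos, fun i j => ?_, fun i => ?_⟩
  · fin_cases i <;> fin_cases j <;> simp [hv.ip_eq]
  · fin_cases i <;> simp [hv.lieD_eq]

/-- The possible bracket relations of a normalised frame: those of the groups of the half-space,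
of the Gibbons–Hawking metric, of the product of a plane and a cone, and of the non-zero
quaternions. -/
def modelConstants : Set ((Fin 3 → ℝ) × (Fin 3 → ℝ)) :=
  {(![1, 1, 1], 0), (![4 / 3, 2 / 3, 2 / 3], ![2 / 3, 0, 0]), (![1, 1, 0], ![1, 1, 0]),
    (0, ![2, 2, 2])}

/-- The Jacobi identity leaves, up to cyclic permutation, four possibilities for the
eigenvalues. -/
theorem IsConformalFrame.exists_modelConstants {f : M → ℝ} {v : Fin 4 → E4} {r : ℝ}
    {a : Fin 3 → ℝ} (hv : IsConformalFrame g f v r ![2, 0, 0, 0])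
    (hd : IsDiagFrame M v ![1 + a 0, 1 + a 1, 1 + a 2]
      ![-(a 1 + a 2), -(a 0 + a 2), -(a 0 + a 1)]) :
    ∃ (w : Fin 4 → E4) (α β : Fin 3 → ℝ), IsConformalFrame g f w r ![2, 0, 0, 0] ∧
      IsDiagFrame M w α β ∧ (α, β) ∈ modelConstants := by
  have hli := linearIndependent_of_ip hv.pos hv.ip_eq
  have j2 := hd.jacobi (hli.ne_zero 3)
  have j0 := hd.rotate.jacobi (hli.ne_zero 1)
  have j1 := hd.rotate.rotate.jacobi (hli.ne_zero 2)
  simp at j0 j1 j2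
  have r1 := hd.rotate
  have r2 := hd.rotate.rotate
  have done : ∀ (w : Fin 4 → E4) (α β α' β' : Fin 3 → ℝ),
      IsConformalFrame g f w r ![2, 0, 0, 0] → IsDiagFrame M w α β → α = α' → β = β' →
      (α', β') ∈ modelConstants →
      ∃ (w : Fin 4 → E4) (α β : Fin 3 → ℝ), IsConformalFrame g f w r ![2, 0, 0, 0] ∧
        IsDiagFrame M w α β ∧ (α, β) ∈ modelConstants := by
    rintro w α β _ _ h1 h2 rfl rfl h3
    exact ⟨w, α, β, h1, h2, h3⟩
  have ext3 : ∀ (x y z x' y' z' : ℝ), x = x' → y = y' → z = z' →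
      (![x, y, z] : Fin 3 → ℝ) = ![x', y', z'] := by
    rintro x y z _ _ _ rfl rfl rfl
    rfl
  have ext0 : (0 : Fin 3 → ℝ) = ![0, 0, 0] := by ext i; fin_cases i <;> rfl
  rcases j0 with j0 | j0 <;> rcases j1 with j1 | j1 <;> rcases j2 with j2 | j2
  · exact done v _ _ ![1, 1, 1] 0 hv hd (ext3 _ _ _ _ _ _ (by linarith) (by linarith) (by linarith))
      (ext0 ▸ ext3 _ _ _ _ _ _ (by linarith) (by linarith) (by linarith)) (by simp [modelConstants])
  · exact done _ _ _ ![4 / 3, 2 / 3, 2 / 3] ![2 / 3, 0, 0] hv.rotate.rotate r2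
      (ext3 _ _ _ _ _ _ (by simp; linarith) (by simp; linarith) (by simp; linarith))
      (ext3 _ _ _ _ _ _ (by simp; linarith) (by simp; linarith) (by simp; linarith))
      (by simp [modelConstants])
  · exact done _ _ _ ![4 / 3, 2 / 3, 2 / 3] ![2 / 3, 0, 0] hv.rotate r1
      (ext3 _ _ _ _ _ _ (by simp; linarith) (by simp; linarith) (by simp; linarith))
      (ext3 _ _ _ _ _ _ (by simp; linarith) (by simp; linarith) (by simp; linarith))
      (by simp [modelConstants])
  · exact done _ _ _ ![1, 1, 0] ![1, 1, 0] hv.rotate r1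
      (ext3 _ _ _ _ _ _ (by simp; linarith) (by simp; linarith) (by simp; linarith))
      (ext3 _ _ _ _ _ _ (by simp; linarith) (by simp; linarith) (by simp; linarith))
      (by simp [modelConstants])
  · exact done _ _ _ ![4 / 3, 2 / 3, 2 / 3] ![2 / 3, 0, 0] hv hd
      (ext3 _ _ _ _ _ _ (by linarith) (by linarith) (by linarith))
      (ext3 _ _ _ _ _ _ (by linarith) (by linarith) (by linarith))
      (by simp [modelConstants])
  · exact done _ _ _ ![1, 1, 0] ![1, 1, 0] hv.rotate.rotate r2
      (ext3 _ _ _ _ _ _ (by simp; linarith) (by simp; linarith) (by simp; linarith))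
      (ext3 _ _ _ _ _ _ (by simp; linarith) (by simp; linarith) (by simp; linarith))
      (by simp [modelConstants])
  · exact done _ _ _ ![1, 1, 0] ![1, 1, 0] hv hd
      (ext3 _ _ _ _ _ _ (by linarith) (by linarith) (by linarith))
      (ext3 _ _ _ _ _ _ (by linarith) (by linarith) (by linarith))
      (by simp [modelConstants])
  · exact done _ _ _ 0 ![2, 2, 2] hv hd
      (ext0 ▸ ext3 _ _ _ _ _ _ (by linarith) (by linarith) (by linarith))
      (ext3 _ _ _ _ _ _ (by linarith) (by linarith) (by linarith))
      (by simp [modelConstants])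

theorem ip_comb {x : M} {q : Fin 4 → E4} {r : ℝ}
    (hq : ∀ i j, ip g x (q i) (q j) = if i = j then r else 0) (u w : Fin 3 → ℝ) :
    ip g x (∑ k, u k • q k.succ) (∑ k, w k • q k.succ) = r * (u ⬝ᵥ w) := by
  rw [← ipₗ_apply]
  simp only [map_sum, map_smul, LinearMap.sum_apply, LinearMap.smul_apply, ipₗ_apply, hq,
    Fin.succ_inj, smul_eq_mul, mul_ite, mul_zero, Finset.sum_ite_eq', Finset.mem_univ, if_true,
    dotProduct, Finset.mul_sum]
  exact Finset.sum_congr rfl fun k _ => by ring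

theorem ip_zero_comb {x : M} {q : Fin 4 → E4} {r : ℝ}
    (hq : ∀ i j, ip g x (q i) (q j) = if i = j then r else 0) (w : Fin 3 → ℝ) :
    ip g x (q 0) (∑ k, w k • q k.succ) = 0 := by
  rw [← ipₗ_apply]
  simp [ipₗ_apply, hq, (Fin.succ_ne_zero _).symm]

/-- A left-invariant metric which is conformally hyper-Kähler has a left-invariant orthogonal frame
in which the bracket is one of the five model brackets. -/
theorem IsLeftInvariant.exists_frame (hl : IsLeftInvariant H g) (hh : IsHyperKahler H h)
    {f : M → ℝ} (hf : ContMDiff 𝓘(ℝ, E4) 𝓘(ℝ, ℝ) ∞ f)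
    (hgf : ∀ x v w, ip g x v w = Real.exp (f x) * ip h x v w) :
    ∃ (v : Fin 4 → E4) (r : ℝ),
      (IsConformalFrame g f v r 0 ∧ IsDiagFrame M v 0 0) ∨
      (IsConformalFrame g f v r ![2, 0, 0, 0] ∧
        ∃ α β, IsDiagFrame M v α β ∧ (α, β) ∈ modelConstants) := by
  have hg := isHyperHermitian_of_conformal hh.1 hgf
  by_cases hgrad : ∃ v : E4, lieD (leftField v) f (1 : M) ≠ 0
  · obtain ⟨v, hv0, hv⟩ := exists_gradient_quatBasis H f hgrad
    have hc := hl.isQuatStruct hh hf hgf hv0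
    rw [funext hv] at hc
    set q := quatBasis H 1 v with hq
    have hip : ∀ i j, ip g 1 (q i) (q j) = if i = j then ip g 1 v v else 0 := ip_quatBasis hg 1 v
    obtain ⟨u, a, hu, hd⟩ := exists_diagFrame (linearIndependent_quatBasis hg 1 hv0) hc
    have hcf : IsConformalFrame g f ![q 0, ∑ k, u 0 k • q k.succ, ∑ k, u 1 k • q k.succ,
        ∑ k, u 2 k • q k.succ] (ip g 1 v v) ![2, 0, 0, 0] := by
      have hθ : ∀ w : Fin 3 → ℝ, lieD (leftField (∑ k, w k • q k.succ)) f (1 : M) = 0 := by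
        intro w
        have h1 := lieD_leftField_sum f (1 : M) (Fin.cons 0 w) q
        rw [Fin.sum_univ_succ] at h1
        simp only [Fin.cons_zero, zero_smul, zero_add, Fin.cons_succ] at h1
        rw [h1]
        simp only [hv]
        simp [Fin.sum_univ_succ]
      refine ⟨ip_pos g 1 hv0, fun i j => ?_, fun i => ?_⟩
      · fin_cases i <;> fin_cases j <;>
          simp [hip, ip_comb hip, ip_zero_comb hip, ip_comm g 1 _ (q 0), hu]
      · fin_cases i
        · simpa using hv 0
        · exact hθ (u 0)
        · exact hθ (u 1)
        · exact hθ (u 2)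
    obtain ⟨w, α, β, h1, h2, h3⟩ := hcf.exists_modelConstants hd
    exact ⟨w, _, Or.inr ⟨h1, α, β, h2, h3⟩⟩
  · push Not at hgrad
    obtain ⟨v, hv0, hv⟩ := hl.exists_parallel hh hf hgf hgrad
    have hc := hl.isQuatStruct hh hf hgf hv0
    rw [show (fun i => lieD (leftField (quatBasis H 1 v i)) f (1 : M)) = 0 from
      funext fun i => hgrad _] at hc
    have hbr : ∀ i j, lieBr M (quatBasis H 1 v i) (quatBasis H 1 v j) = 0 := fun i j => by
      rw [lieBr_eq_sum (linearIndependent_quatBasis hg 1 hv0)]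
      simp [hc.eq_zero hv]
    refine ⟨quatBasis H 1 v, ip g 1 v v, Or.inl ⟨⟨ip_pos g 1 hv0, ip_quatBasis hg 1 v,
      fun i => hgrad _⟩, ?_⟩⟩
    constructor <;> simp [hbr]

end Classification

/-! ### From a germ to a homothety -/

section Homothety

open Set Filter Topology

variable {M : Type*} [TopologicalSpace M] [ChartedSpace E4 M] [IsManifold 𝓘(ℝ, E4) ∞ M]

/-- A function whose derivatives along a frame vanish is locally constant. -/
theorem eventually_eq_of_lieD_eq_zero {e : Fin 4 → M → E4} {u : M → ℝ} {x₀ : M}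
    (hli : ∀ x, LinearIndependent ℝ (fun i => e i x))
    (hu : ∀ᶠ x in 𝓝 x₀, MDifferentiableAt 𝓘(ℝ, E4) 𝓘(ℝ, ℝ) u x)
    (h : ∀ᶠ x in 𝓝 x₀, ∀ i, lieD (e i) u x = 0) : ∀ᶠ x in 𝓝 x₀, u x = u x₀ := by
  set φ := extChartAt 𝓘(ℝ, E4) x₀ with hφ
  have ht : ∀ᶠ y in 𝓝 (φ x₀), y ∈ φ.target :=
    (isOpen_extChartAt_target x₀).mem_nhds (mem_extChartAt_target x₀)
  obtain ⟨r, hr, hball⟩ := Metric.eventually_nhds_iff_ball.1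
    (((tendsto_chart_symm x₀).eventually (hu.and h)).and ht)
  have hz : ∀ y ∈ Metric.ball (φ x₀) r, HasFDerivAt (fun y => u (φ.symm y)) (0 : E4 →L[ℝ] ℝ) y := by
    intro y hy
    obtain ⟨⟨h1, h2⟩, h3⟩ := hball y hy
    have h4 : mD E4 ℝ u (φ.symm y) = 0 := by
      ext1 w
      rw [eq_sum_of_linearIndependent (hli (φ.symm y)) w, map_sum]
      refine Finset.sum_eq_zero fun i _ => ?_
      have h5 : mD E4 ℝ u (φ.symm y) (e i (φ.symm y)) = 0 := h2 i
      rw [map_smul, h5, smul_zero]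
    have h6 : HasMFDerivAt 𝓘(ℝ, E4) 𝓘(ℝ, ℝ) (fun y => u (φ.symm y)) y (0 : E4 →L[ℝ] ℝ) := by
      refine hasMFDerivAt_comp_of_eq (g := u) (f := φ.symm) (L := mD E4 E4 φ.symm y) h1
        ((contMDiffAt_chart_symm h3).mdifferentiableAt (by simp)).hasMFDerivAt ?_
      rw [h4, ContinuousLinearMap.zero_comp]
    exact h6.hasFDerivAt
  filter_upwards [(continuousAt_extChartAt (I := 𝓘(ℝ, E4)) x₀).eventually (Metric.ball_mem_nhds _ hr),
    extChartAt_source_mem_nhds (I := 𝓘(ℝ, E4)) x₀] with x hx hxs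
  have h7 := (convex_ball (φ x₀) r).is_const_of_fderivWithin_eq_zero (𝕜 := ℝ)
    (f := fun y => u (φ.symm y)) (fun y hy => (hz y hy).differentiableAt.differentiableWithinAt)
    (fun y hy => (hz y hy).hasFDerivWithinAt.fderivWithin
      (Metric.isOpen_ball.uniqueDiffWithinAt hy)) hx (Metric.mem_ball_self hr)
  rw [φ.left_inv hxs] at h7
  rw [h7]
  congr 1
  exact extChartAt_to_inv x₀

/-- A function whose derivatives along a frame vanish is constant. -/
theorem eq_of_lieD_eq_zero [PreconnectedSpace M] {e : Fin 4 → M → E4} {u : M → ℝ}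
    (hli : ∀ x, LinearIndependent ℝ (fun i => e i x))
    (hu : MDifferentiable 𝓘(ℝ, E4) 𝓘(ℝ, ℝ) u) (h : ∀ x i, lieD (e i) u x = 0) (x y : M) :
    u x = u y := by
  have h1 : IsLocallyConstant u := (IsLocallyConstant.iff_eventually_eq u).2 fun x =>
    eventually_eq_of_lieD_eq_zero hli (Eventually.of_forall hu) (Eventually.of_forall h)
  exact h1.apply_eq_of_preconnectedSpace x y

/-- A map to `E4` given by its coordinates preserves frames if its coordinates have the right
derivatives. -/
theorem preservesFrame_of_coord {e : Fin 4 → M → E4} {ε : Fin 4 → E4 → E4} {u : Fin 4 → M → ℝ}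
    {x₀ : M} (hu : ∀ᶠ x in 𝓝 x₀, ∀ j, ContMDiffAt 𝓘(ℝ, E4) 𝓘(ℝ, ℝ) ∞ (u j) x)
    (h : ∀ᶠ x in 𝓝 x₀, ∀ i j, lieD (e i) (u j) x = ε i (WithLp.toLp 2 fun j => u j x) j) :
    PreservesFrame e ε (fun x => (WithLp.toLp 2 fun j => u j x : E4)) x₀ := by
  filter_upwards [hu, h] with x h1 h2
  have h3 : ContMDiffAt 𝓘(ℝ, E4) 𝓘(ℝ, E4) ∞ (fun x => (WithLp.toLp 2 fun j => u j x : E4)) x := by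
    have h4 : ContMDiffAt 𝓘(ℝ, E4) 𝓘(ℝ, Fin 4 → ℝ) ∞ (fun x j => u j x) x :=
      contMDiffAt_pi_space.2 h1
    exact ((EuclideanSpace.equiv (Fin 4) ℝ).symm.contDiff.contMDiff.contMDiffAt).comp x h4
  refine ⟨h3, fun i => ?_⟩
  ext j
  rw [← h2 i j]
  exact (lieD_clm (X := e i) (EuclideanSpace.proj j : E4 →L[ℝ] ℝ)
    (h3.mdifferentiableAt (by simp))).symm

/-- A model geometry: an open set `U` of `E4` with a homogeneous frame `ε` which is orthogonal for
the metric `k`, all vectors having square length `ρ`, where the logarithmic derivative of `ρ` along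
the frame is the constant `-θ`. -/
structure IsModel (U : Set E4) (k : E4 → E4 → E4 → ℝ) (ε : Fin 4 → E4 → E4) (ρ : E4 → ℝ)
    (θ : Fin 4 → ℝ) : Prop where
  frame : HomogeneousFrame U ε
  isPreconnected : IsPreconnected U
  bilinear : ∀ p, ∃ B : E4 →ₗ[ℝ] E4 →ₗ[ℝ] ℝ, ∀ u v, k p u v = B u v
  orthogonal : ∀ p ∈ U, ∀ i j, k p (ε i p) (ε j p) = if i = j then ρ p else 0
  pos : ∀ p ∈ U, 0 < ρ p
  differentiableAt : ∀ p ∈ U, DifferentiableAt ℝ ρ p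
  fderiv_eq : ∀ p ∈ U, ∀ i, fderiv ℝ ρ p (ε i p) = -(θ i * ρ p)

/-- A frame-preserving germ from a conformally related homogeneous frame to a model geometry gives
a global homothety. -/
theorem IsModel.isHomotheticTo.{u} {M : Type u} [TopologicalSpace M] [ChartedSpace E4 M]
    [IsManifold 𝓘(ℝ, E4) ∞ M] [T2Space M] [PreconnectedSpace M]
    {U : Set E4} {k : E4 → E4 → E4 → ℝ} {ε : Fin 4 → E4 → E4} {ρ : E4 → ℝ} {θ : Fin 4 → ℝ}
    (hU : IsModel U k ε ρ θ) (hUc : HasCoveringSections.{0, u} U)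
    {e : Fin 4 → M → E4} (he : HomogeneousFrame (univ : Set M) e)
    (hM : HasCoveringSections.{u, u} (univ : Set M)) {h : RiemMetric M} {f : M → ℝ}
    (hf : ContMDiff 𝓘(ℝ, E4) 𝓘(ℝ, ℝ) ∞ f) {r : ℝ} (hr : 0 < r)
    (heh : ∀ x i j, ip h x (e i x) (e j x) = if i = j then r * Real.exp (-f x) else 0)
    (hef : ∀ x i, lieD (e i) f x = θ i) {F₀ : M → E4} {x₀ : M}
    (h₀ : PreservesFrame e ε F₀ x₀) (hF₀ : F₀ x₀ ∈ U) : IsHomotheticTo h U k := by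
  obtain ⟨F, F', hF, hF'⟩ := he.exists_diffeomorphism hU.frame isPreconnected_univ
    hU.isPreconnected hM hUc (mem_univ x₀) h₀ hF₀
  have hFU : ∀ x, F x ∈ U := fun x => (hF x (mem_univ x)).1
  have hFe : ∀ x, PreservesFrame e ε F x := fun x => (hF x (mem_univ x)).2.1
  have hli : ∀ x, LinearIndependent ℝ (fun i => e i x) := fun x =>
    he.linearIndependent x (mem_univ x)
  -- the quotient of the two conformal factors is constant
  have hFd : ∀ x, MDifferentiableAt 𝓘(ℝ, E4) 𝓘(ℝ, E4) F x := fun x =>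
    (hFe x).self_of_nhds.1.mdifferentiableAt (by simp)
  have hρd : MDifferentiable 𝓘(ℝ, E4) 𝓘(ℝ, ℝ) (fun x => ρ (F x)) := fun x =>
    (hU.differentiableAt _ (hFU x)).mdifferentiableAt.comp x (hFd x)
  have hed : MDifferentiable 𝓘(ℝ, E4) 𝓘(ℝ, ℝ) (fun x => Real.exp (f x)) := fun x =>
    Real.differentiable_exp.differentiableAt.mdifferentiableAt.comp x (hf.mdifferentiable (by simp) x)
  have hconst : ∀ x, ρ (F x) * Real.exp (f x) = ρ (F x₀) * Real.exp (f x₀) := fun x => by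
    refine eq_of_lieD_eq_zero (u := fun x => ρ (F x) * Real.exp (f x)) hli (hρd.mul hed)
      (fun x i => ?_) x x₀
    rw [lieD_mul (hρd x) (hed x), lieD_comp_deriv (Real.hasDerivAt_exp (f x))
      (hf.mdifferentiable (by simp) x), hef, lieD_comp (hU.differentiableAt _ (hFU x)) (hFd x)]
    have h1 : lieD (e i) F x = ε i (F x) := (hFe x).self_of_nhds.2 i
    rw [h1, hU.fderiv_eq _ (hFU x)]
    ring
  refine ⟨F, F', ρ (F x₀) * Real.exp (f x₀) / r, fun x => (hFe x).self_of_nhds.1,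
    fun p hp => (hF' p hp).2.1.self_of_nhds.1.contMDiffWithinAt, hFU,
    fun x => (hF x (mem_univ x)).2.2, fun p hp => (hF' p hp).2.2,
    div_pos (mul_pos (hU.pos _ (hFU x₀)) (Real.exp_pos _)) hr, ?_⟩
  have key : ∀ (x : M) (v w : E4), k (F x) (mD E4 E4 F x v) (mD E4 E4 F x w)
      = ρ (F x₀) * Real.exp (f x₀) / r * ip h x v w := by
    intro x v w
    obtain ⟨B, hB⟩ := hU.bilinear (F x)
    rw [hB, ← ipₗ_apply, eq_sum_of_linearIndependent (hli x) v,
      eq_sum_of_linearIndependent (hli x) w]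
    have h1 : ∀ i, mD E4 E4 F x (e i x) = ε i (F x) := (hFe x).self_of_nhds.2
    simp only [map_sum, map_smul, LinearMap.sum_apply, LinearMap.smul_apply, h1, ← hB,
      hU.orthogonal _ (hFU x), ipₗ_apply, heh, smul_eq_mul, mul_ite, mul_zero,
      Finset.sum_ite_eq', Finset.mem_univ, if_true, Finset.mul_sum]
    refine Finset.sum_congr rfl fun i _ => ?_
    rw [← hconst x, Real.exp_neg]
    field_simp
  exact key

end Homothety

/-! ### The invariant frame -/

section InvariantFrame

open Set Filter Topology

theorem hasCoveringSections_univ.{u, v} (M : Type u) [TopologicalSpace M] [ChartedSpace E4 M]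
    [SimplyConnectedSpace M] : HasCoveringSections.{u, v} (univ : Set M) := by
  have : LocallyPathConnectedSpace M := ChartedSpace.locallyPathConnectedSpace E4 M
  exact (hasCoveringSections_of_simplyConnected M).of_homeomorph (Homeomorph.Set.univ M).symm

/-- The structure constants of a frame `e` with `[e 0, e a] = -α_a e a` and
`[e a, e b] = β_c e c` for `(a, b, c)` a cyclic permutation of `(1, 2, 3)`. -/
def diagConst (α β : Fin 3 → ℝ) : Fin 4 → Fin 4 → Fin 4 → ℝ :=
  ![![0, ![0, -α 0, 0, 0], ![0, 0, -α 1, 0], ![0, 0, 0, -α 2]],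
    ![![0, α 0, 0, 0], 0, ![0, 0, 0, β 2], ![0, 0, -β 1, 0]],
    ![![0, 0, α 1, 0], ![0, 0, 0, -β 2], 0, ![0, β 0, 0, 0]],
    ![![0, 0, 0, α 2], ![0, 0, β 1, 0], ![0, -β 0, 0, 0], 0]]

variable {M : Type*} [TopologicalSpace M] [ChartedSpace E4 M] [IsManifold 𝓘(ℝ, E4) ∞ M]
  [Group M] [LieGroup 𝓘(ℝ, E4) ∞ M]

theorem IsDiagFrame.isStructFrame {v : Fin 4 → E4} {α β : Fin 3 → ℝ} (h : IsDiagFrame M v α β)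
    (hv : LinearIndependent ℝ v) :
    IsStructFrame (M := M) (fun i => leftField (v i)) (diagConst α β) where
  smooth i := smoothVF_leftField _
  linearIndependent x := linearIndependent_leftField hv x
  bracket_eq i j x := by
    rw [bracket_leftField]
    simp only [← leftField_smul, ← leftField_sum]
    congr 1
    have h10 := lieBr_skew (M := M) (v 1) (v 0)
    have h20 := lieBr_skew (M := M) (v 2) (v 0)
    have h30 := lieBr_skew (M := M) (v 3) (v 0)
    have h21 := lieBr_skew (M := M) (v 2) (v 1)
    have h32 := lieBr_skew (M := M) (v 3) (v 2)
    have h13 := lieBr_skew (M := M) (v 1) (v 3)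
    fin_cases i <;> fin_cases j <;>
      simp [diagConst, Fin.sum_univ_four, lieBr_self, h10, h20, h30, h21, h32, h13, h.br01, h.br02,
        h.br03, h.br12, h.br23, h.br31]

theorem IsConformalFrame.linearIndependent {g : RiemMetric M} {f : M → ℝ} {v : Fin 4 → E4} {r : ℝ}
    {θ : Fin 4 → ℝ} (hv : IsConformalFrame g f v r θ) : LinearIndependent ℝ v :=
  linearIndependent_of_ip hv.pos hv.ip_eq

/-- If the invariant frame of a conformally hyper-Kähler metric matches the frame of a model near
the identity, the hyper-Kähler metric is homothetic to the model. -/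
theorem IsConformalFrame.isHomotheticTo.{u} {M : Type u} [TopologicalSpace M] [ChartedSpace E4 M]
    [IsManifold 𝓘(ℝ, E4) ∞ M] [T2Space M] [SimplyConnectedSpace M]
    [Group M] [LieGroup 𝓘(ℝ, E4) ∞ M]
    {H : HypercomplexStructure M} {g h : RiemMetric M} (hl : IsLeftInvariant H g)
    (hh : IsHyperKahler H h) {f : M → ℝ} (hf : ContMDiff 𝓘(ℝ, E4) 𝓘(ℝ, ℝ) ∞ f)
    (hgf : ∀ x v w, ip g x v w = Real.exp (f x) * ip h x v w)
    {v : Fin 4 → E4} {r : ℝ} {θ : Fin 4 → ℝ} (hv : IsConformalFrame g f v r θ)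
    {U : Set E4} {k : E4 → E4 → E4 → ℝ} {ε : Fin 4 → E4 → E4} {ρ : E4 → ℝ}
    (hU : IsModel U k ε ρ θ) (hUc : HasCoveringSections.{0, u} U) {F₀ : M → E4}
    (h₀ : PreservesFrame (fun i => leftField (v i)) ε F₀ 1) (hF₀ : F₀ 1 ∈ U) :
    IsHomotheticTo h U k := by
  refine hU.isHomotheticTo hUc (homogeneousFrame_leftField hv.linearIndependent)
    (hasCoveringSections_univ M) hf hv.pos (fun x i j => ?_) (fun x i => ?_) h₀ hF₀
  · have h1 : ip g x (leftField (v i) x) (leftField (v j) x) = if i = j then r else 0 := by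
      rw [hl.ip_leftField, hv.ip_eq]
    rw [hgf] at h1
    have h2 : ip h x (leftField (v i) x) (leftField (v j) x)
        = Real.exp (-f x) * if i = j then r else 0 := by
      rw [← h1, ← mul_assoc, ← Real.exp_add]; simp
    rw [h2]
    split_ifs <;> ring
  · rw [hl.lieD_eq hh hf hgf, hv.lieD_eq]

/-- A frame on an open subset of `E4` given by smooth vector-valued functions and invariant under
smooth maps acting simply transitively. -/
theorem homogeneousFrame_of_contDiff {U : Set E4} (hU : IsOpen U) {ε : Fin 4 → E4 → E4}
    (hε : ∀ i, ContDiff ℝ ∞ (ε i)) (hli : ∀ p ∈ U, LinearIndependent ℝ (fun i => ε i p))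
    {T : E4 → E4 → E4} (hT : ∀ p, ContDiff ℝ ∞ (T p))
    (hTU : ∀ p ∈ U, ∀ q ∈ U, T p q ∈ U)
    (hTε : ∀ p ∈ U, ∀ q ∈ U, ∀ i, fderiv ℝ (T p) q (ε i q) = ε i (T p q))
    (hTb : ∀ q ∈ U, ∀ p ∈ U, ∃! a, a ∈ U ∧ T a q = p) : HomogeneousFrame U ε where
  isOpen := hU
  smooth i := contMDiff_vectorSpace_iff_contDiff.2 (hε i)
  linearIndependent := hli
  exists_translations := by
    refine ⟨T, fun p hp q hq => ⟨hTU p hp q hq, ?_⟩, fun q hq => ⟨fun p hp => hTU p hp q hq,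
      fun a ha b hb hab => (hTb q hq _ (hTU b hb q hq)).unique ⟨ha, hab⟩ ⟨hb, rfl⟩,
      fun p hp => (hTb q hq p hp).exists⟩⟩
    filter_upwards [hU.mem_nhds hq] with y hy
    refine ⟨(hT p).contMDiff.contMDiffAt, fun i => ?_⟩
    rw [mD_eq_fderiv]
    exact hTε p hp y hy i

end InvariantFrame

/-! ### Models given by simply transitive groups of affine maps -/

section AffineModels

open Set Filter Topology Matrix

/-- A bilinear form for which the vectors `ε i` are orthogonal of equal positive square length
shows that they are linearly independent. -/
theorem linearIndependent_of_bilin {ε : Fin 4 → E4} {k : E4 → E4 → ℝ} {ρ : ℝ}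
    (hk : ∃ B : E4 →ₗ[ℝ] E4 →ₗ[ℝ] ℝ, ∀ u v, k u v = B u v) (hρ : 0 < ρ)
    (h : ∀ i j, k (ε i) (ε j) = if i = j then ρ else 0) : LinearIndependent ℝ ε := by
  obtain ⟨B, hB⟩ := hk
  rw [Fintype.linearIndependent_iff]
  intro t ht i
  have h1 := congrArg (fun w => B w (ε i)) ht
  simp only [map_sum, map_smul, LinearMap.sum_apply, LinearMap.smul_apply, ← hB, h,
    smul_eq_mul, mul_ite, mul_zero, Finset.sum_ite_eq', Finset.mem_univ, if_true, map_zero,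
    LinearMap.zero_apply] at h1
  exact (mul_eq_zero.1 h1).resolve_right hρ.ne'

/-- A model on which a group of affine maps `T p`, with linear parts `A p`, acts simply
transitively. The rows of the matrix `m p` are the frame at `p`, and `D q p` is the parameter of
the map taking `q` to `p`. -/
theorem isModel_of_affine {U : Set E4} {k : E4 → E4 → E4 → ℝ} {ρ : E4 → ℝ} {θ : Fin 4 → ℝ}
    {m A : E4 → Matrix (Fin 4) (Fin 4) ℝ} {T D : E4 → E4 → E4} (hU : IsOpen U)
    (hpre : IsPreconnected U) (hm : ∀ i j, ContDiff ℝ ∞ (fun p => m p i j))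
    (hT : ∀ p q j, T p q j = (A p *ᵥ q.ofLp) j + T p 0 j) (hTU : ∀ p ∈ U, ∀ q ∈ U, T p q ∈ U)
    (hTm : ∀ p ∈ U, ∀ q ∈ U, ∀ i j, (A p *ᵥ m q i) j = m (T p q) i j)
    (hD : ∀ q ∈ U, ∀ p ∈ U, D q p ∈ U ∧ T (D q p) q = p ∧ D q (T p q) = p)
    (hk : ∀ p, ∃ B : E4 →ₗ[ℝ] E4 →ₗ[ℝ] ℝ, ∀ u v, k p u v = B u v)
    (orthogonal : ∀ p ∈ U, ∀ i j, k p (WithLp.toLp 2 (m p i)) (WithLp.toLp 2 (m p j))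
      = if i = j then ρ p else 0)
    (pos : ∀ p ∈ U, 0 < ρ p) (hρ : ∀ p ∈ U, DifferentiableAt ℝ ρ p)
    (fderiv_eq : ∀ p ∈ U, ∀ i, fderiv ℝ ρ p (WithLp.toLp 2 (m p i)) = -(θ i * ρ p)) :
    IsModel U k (fun i p => WithLp.toLp 2 (m p i)) ρ θ := by
  refine ⟨?_, hpre, hk, orthogonal, pos, hρ, fderiv_eq⟩
  let L : E4 → E4 →L[ℝ] E4 := fun p =>
    LinearMap.toContinuousLinearMap (Matrix.toLpLin 2 2 (A p))
  have hTL : ∀ p, T p = fun q => L p q + T p 0 := fun p => by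
    ext q j
    exact hT p q j
  refine homogeneousFrame_of_contDiff (T := T) hU (fun i => contDiff_euclidean.2 fun j => hm i j)
    (fun p hp => linearIndependent_of_bilin (hk p) (pos p hp) (orthogonal p hp)) (fun p => ?_) hTU
    (fun p hp q hq i => ?_)
    (fun q hq p hp => ⟨D q p, ⟨(hD q hq p hp).1, (hD q hq p hp).2.1⟩, fun a ha => ?_⟩)
  · rw [hTL p]
    exact (L p).contDiff.add contDiff_const
  · have h1 : HasFDerivAt (T p) (L p) q := by
      rw [hTL p]
      exact (L p).hasFDerivAt.add_const _
    rw [h1.fderiv]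
    ext j
    exact hTm p hp q hq i j
  · rw [← ha.2, (hD q hq a ha.1).2.2]

theorem hasFDerivAt_comp_coord {R : ℝ → ℝ} {R' : ℝ} {p : E4} (m : Fin 4)
    (hR : HasDerivAt R R' (p m)) :
    HasFDerivAt (fun p : E4 => R (p m)) (R' • (EuclideanSpace.proj m : E4 →L[ℝ] ℝ)) p :=
  hR.comp_hasFDerivAt p (EuclideanSpace.proj m : E4 →L[ℝ] ℝ).hasFDerivAt

theorem exists_bilin_euclideanMetric (c : ℝ) (p : E4) :
    ∃ B : E4 →ₗ[ℝ] E4 →ₗ[ℝ] ℝ, ∀ u v, c * euclideanMetric p u v = B u v :=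
  ⟨LinearMap.mk₂ ℝ (fun u v => c * euclideanMetric p u v)
    (fun _ _ _ => by simp [euclideanMetric]; ring) (fun _ _ _ => by simp [euclideanMetric]; ring)
    (fun _ _ _ => by simp [euclideanMetric]; ring) (fun _ _ _ => by simp [euclideanMetric]; ring),
    fun _ _ => rfl⟩

theorem isModel_euclidean :
    IsModel univ euclideanMetric (fun i _ => WithLp.toLp 2 ((1 : Matrix (Fin 4) (Fin 4) ℝ) i))
      (fun _ => 1) 0 := by
  refine isModel_of_affine (m := fun _ => 1) (A := fun _ => 1) (T := fun p q => p + q)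
    (D := fun q p => p - q) isOpen_univ isPreconnected_univ (fun i j => contDiff_const)
    (fun p q j => by simp [add_comm]) (fun _ _ _ _ => mem_univ _) (fun _ _ _ _ _ _ => by simp)
    (fun q _ p _ => ⟨mem_univ _, by simp, by simp⟩)
    (fun p => by simpa using exists_bilin_euclideanMetric 1 p) (fun p _ i j => ?_)
    (fun _ _ => one_pos) (fun _ _ => differentiableAt_const _) (fun p _ i => by simp)
  fin_cases i <;> fin_cases j <;> simp [euclideanMetric, Matrix.one_apply]

theorem isOpen_halfSpace (m : Fin 4) : IsOpen {p : E4 | 0 < p m} :=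
  isOpen_lt continuous_const (by fun_prop)

theorem convex_halfSpace (m : Fin 4) : Convex ℝ {p : E4 | 0 < p m} :=
  convex_halfSpace_gt (f := fun p : E4 => p m) ⟨fun _ _ => rfl, fun _ _ => rfl⟩ 0

theorem hasCoveringSections_halfSpace (m : Fin 4) : HasCoveringSections {p : E4 | 0 < p m} := by
  have h1 : EuclideanSpace.single m (1 : ℝ) ∈ {p : E4 | 0 < p m} := by simp
  exact hasCoveringSections_of_starConvex (isOpen_halfSpace m)
    ((convex_halfSpace m).starConvex h1) ⟨_, h1⟩

/-- The frame `-s ∂_s, s ∂_x, s ∂_y, s ∂_z` on the half-space. -/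
def halfSpaceFrame (p : E4) : Matrix (Fin 4) (Fin 4) ℝ :=
  !![-p 0, 0, 0, 0; 0, p 0, 0, 0; 0, 0, p 0, 0; 0, 0, 0, p 0]

theorem isModel_halfSpace :
    IsModel {p : E4 | 0 < p 0} euclideanMetric (fun i p => WithLp.toLp 2 (halfSpaceFrame p i))
      (fun p => p 0 ^ 2) ![2, 0, 0, 0] := by
  refine isModel_of_affine (A := fun p => p 0 • 1)
    (T := fun p q => !₂[p 0 * q 0, p 1 + p 0 * q 1, p 2 + p 0 * q 2, p 3 + p 0 * q 3])
    (D := fun q p => !₂[p 0 / q 0, p 1 - p 0 / q 0 * q 1, p 2 - p 0 / q 0 * q 2,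
      p 3 - p 0 / q 0 * q 3])
    (isOpen_halfSpace 0) (convex_halfSpace 0).isPreconnected (fun i j => ?_) (fun p q j => ?_)
    (fun p hp q hq => by simpa using mul_pos hp hq) (fun p hp q hq i j => ?_)
    (fun q (hq : 0 < q 0) p (hp : 0 < p 0) => ⟨by simpa using div_pos hp hq, ?_, ?_⟩)
    (fun p => by simpa using exists_bilin_euclideanMetric 1 p) (fun p _ i j => ?_)
    (fun p hp => pow_pos hp 2)
    (fun p _ => (hasFDerivAt_comp_coord 0 (hasDerivAt_pow 2 (p 0))).differentiableAt)
    (fun p _ i => ?_)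
  · fin_cases i <;> fin_cases j <;> simp [halfSpaceFrame] <;> fun_prop
  · fin_cases j <;> simp [add_comm, smul_mulVec]
  · fin_cases i <;> fin_cases j <;> simp [halfSpaceFrame, smul_mulVec]
  · ext j; fin_cases j <;> simp; field_simp
  · ext j; fin_cases j <;> simp <;> field_simp <;> ring
  · fin_cases i <;> fin_cases j <;> simp [halfSpaceFrame, euclideanMetric] <;> ring
  · rw [(hasFDerivAt_comp_coord 0 (hasDerivAt_pow 2 (p 0))).fderiv]
    fin_cases i <;> simp [halfSpaceFrame]; ring

/-- The frame `s (cos t ∂_x + sin t ∂_y)`, `s (-sin t ∂_x + cos t ∂_y)`, `∂_t`, preceded by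
`-s ∂_s`, in the coordinates `(x, y, s, t)`. -/
noncomputable def coneFrame (p : E4) : Matrix (Fin 4) (Fin 4) ℝ :=
  !![0, 0, -p 2, 0; p 2 * Real.cos (p 3), p 2 * Real.sin (p 3), 0, 0;
    -(p 2 * Real.sin (p 3)), p 2 * Real.cos (p 3), 0, 0; 0, 0, 0, 1]

theorem isModel_cone :
    IsModel {p : E4 | 0 < p 2} planeTimesConeMetric (fun i p => WithLp.toLp 2 (coneFrame p i))
      (fun p => p 2 ^ 2) ![2, 0, 0, 0] := by
  refine isModel_of_affine
    (A := fun p => !![p 2 * Real.cos (p 3), -(p 2 * Real.sin (p 3)), 0, 0;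
      p 2 * Real.sin (p 3), p 2 * Real.cos (p 3), 0, 0; 0, 0, p 2, 0; 0, 0, 0, 1])
    (T := fun p q => !₂[p 0 + p 2 * (Real.cos (p 3) * q 0 - Real.sin (p 3) * q 1),
      p 1 + p 2 * (Real.sin (p 3) * q 0 + Real.cos (p 3) * q 1), p 2 * q 2, p 3 + q 3])
    (D := fun q p => !₂[
      p 0 - p 2 / q 2 * (Real.cos (p 3 - q 3) * q 0 - Real.sin (p 3 - q 3) * q 1),
      p 1 - p 2 / q 2 * (Real.sin (p 3 - q 3) * q 0 + Real.cos (p 3 - q 3) * q 1), p 2 / q 2,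
      p 3 - q 3])
    (isOpen_halfSpace 2) (convex_halfSpace 2).isPreconnected (fun i j => ?_) (fun p q j => ?_)
    (fun p hp q hq => by simpa using mul_pos hp hq) (fun p hp q hq i j => ?_)
    (fun q (hq : 0 < q 2) p (hp : 0 < p 2) => ⟨by simpa using div_pos hp hq, ?_, ?_⟩)
    (fun p => ?_) (fun p _ i j => ?_) (fun p hp => pow_pos hp 2)
    (fun p _ => (hasFDerivAt_comp_coord 2 (hasDerivAt_pow 2 (p 2))).differentiableAt)
    (fun p _ i => ?_)
  · fin_cases i <;> fin_cases j <;> simp [coneFrame] <;> fun_prop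
  · fin_cases j <;> simp [mulVec, dotProduct, Fin.sum_univ_four] <;> ring
  · fin_cases i <;> fin_cases j <;>
      simp [coneFrame, mulVec, dotProduct, Fin.sum_univ_four, Real.cos_add, Real.sin_add] <;> ring
  · ext j; fin_cases j <;> simp; field_simp
  · ext j; fin_cases j <;> simp <;> field_simp <;> ring
  · exact ⟨LinearMap.mk₂ ℝ (planeTimesConeMetric p)
      (fun _ _ _ => by simp [planeTimesConeMetric]; ring)
      (fun _ _ _ => by simp [planeTimesConeMetric]; ring)
      (fun _ _ _ => by simp [planeTimesConeMetric]; ring)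
      (fun _ _ _ => by simp [planeTimesConeMetric]; ring), fun _ _ => rfl⟩
  · have h1 := Real.sin_sq_add_cos_sq (p 3)
    fin_cases i <;> fin_cases j <;> simp [coneFrame, planeTimesConeMetric] <;>
      first | ring1 | linear_combination p 2 ^ 2 * h1
  · rw [(hasFDerivAt_comp_coord 2 (hasDerivAt_pow 2 (p 2))).fderiv]
    fin_cases i <;> simp [coneFrame]; ring

/-- The frame `-s ∂_s`, `s² ∂_z`, `s (∂_x - (y/2) ∂_z)`, `s (∂_y + (x/2) ∂_z)`, times `2/3`, in the
coordinates `(s, x, y, z)`. -/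
noncomputable def gibbonsHawkingFrame (p : E4) : Matrix (Fin 4) (Fin 4) ℝ :=
  !![-(2 / 3 * p 0), 0, 0, 0; 0, 0, 0, 2 / 3 * p 0 ^ 2;
    0, 2 / 3 * p 0, 0, -(1 / 3 * p 0 * p 2); 0, 0, 2 / 3 * p 0, 1 / 3 * p 0 * p 1]

theorem isModel_gibbonsHawking :
    IsModel {p : E4 | 0 < p 0} gibbonsHawkingMetric
      (fun i p => WithLp.toLp 2 (gibbonsHawkingFrame p i)) (fun p => 4 / 9 * p 0 ^ 3)
      ![2, 0, 0, 0] := by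
  refine isModel_of_affine
    (A := fun p => !![p 0, 0, 0, 0; 0, p 0, 0, 0; 0, 0, p 0, 0;
      0, -(1 / 2 * p 0 * p 2), 1 / 2 * p 0 * p 1, p 0 ^ 2])
    (T := fun p q => !₂[p 0 * q 0, p 1 + p 0 * q 1, p 2 + p 0 * q 2,
      p 3 + p 0 ^ 2 * q 3 + 1 / 2 * p 0 * (p 1 * q 2 - p 2 * q 1)])
    (D := fun q p => !₂[p 0 / q 0, p 1 - p 0 / q 0 * q 1, p 2 - p 0 / q 0 * q 2,
      p 3 - (p 0 / q 0) ^ 2 * q 3 - 1 / 2 * (p 0 / q 0) * (p 1 * q 2 - p 2 * q 1)])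
    (isOpen_halfSpace 0) (convex_halfSpace 0).isPreconnected (fun i j => ?_) (fun p q j => ?_)
    (fun p hp q hq => by simpa using mul_pos hp hq) (fun p hp q hq i j => ?_)
    (fun q (hq : 0 < q 0) p (hp : 0 < p 0) => ⟨by simpa using div_pos hp hq, ?_, ?_⟩)
    (fun p => ?_) (fun p (hp : 0 < p 0) i j => ?_)
    (fun p hp => mul_pos (by norm_num) (pow_pos hp 3))
    (fun p _ => (hasFDerivAt_comp_coord 0 ((hasDerivAt_pow 3 (p 0)).const_mul (4 / 9))).differentiableAt)
    (fun p _ i => ?_)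
  · fin_cases i <;> fin_cases j <;> simp [gibbonsHawkingFrame] <;> fun_prop
  · fin_cases j <;> simp [mulVec, dotProduct, Fin.sum_univ_four] <;> ring
  · fin_cases i <;> fin_cases j <;>
      simp [gibbonsHawkingFrame, mulVec, dotProduct, Fin.sum_univ_four] <;> ring
  · ext j; fin_cases j <;> simp <;> field_simp <;> ring
  · ext j; fin_cases j <;> simp <;> field_simp <;> ring
  · exact ⟨LinearMap.mk₂ ℝ (gibbonsHawkingMetric p)
      (fun _ _ _ => by simp [gibbonsHawkingMetric, connectionForm]; ring)
      (fun _ _ _ => by simp [gibbonsHawkingMetric, connectionForm]; ring)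
      (fun _ _ _ => by simp [gibbonsHawkingMetric, connectionForm]; ring)
      (fun _ _ _ => by simp [gibbonsHawkingMetric, connectionForm]; ring), fun _ _ => rfl⟩
  · fin_cases i <;> fin_cases j <;>
      simp [gibbonsHawkingFrame, gibbonsHawkingMetric, connectionForm] <;> field_simp <;>
      first | ring1 | simp
  · rw [(hasFDerivAt_comp_coord 0 ((hasDerivAt_pow 3 (p 0)).const_mul (4 / 9))).fderiv]
    fin_cases i <;> simp [gibbonsHawkingFrame]; ring

end AffineModels

/-! ### Frame-preserving germs into the affine models -/

section AffineGerms

open Set Filter Topology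

variable {M : Type*} [TopologicalSpace M] [ChartedSpace E4 M]

theorem lieD_zero (X : M → E4) (x : M) : lieD X (0 : M → ℝ) x = 0 := lieD_const X 0 x

theorem lieD_neg {X : M → E4} {f : M → ℝ} {x : M}
    (hf : MDifferentiableAt 𝓘(ℝ, E4) 𝓘(ℝ, ℝ) f x) : lieD X (fun y => -f y) x = -lieD X f x := by
  have h1 := lieD_const_mul (X := X) (-1) hf
  simpa using h1

variable [IsManifold 𝓘(ℝ, E4) ∞ M] {e : Fin 4 → M → E4} {α β : Fin 3 → ℝ} {f : M → ℝ} {x₀ : M}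

/-- A function `f` with constant derivatives along a frame has exponentials `s = e^{c f}`, which
are eigenfunctions of the frame. -/
theorem exists_exp_mul (hf : ContMDiff 𝓘(ℝ, E4) 𝓘(ℝ, ℝ) ∞ f) {θ : Fin 4 → ℝ}
    (hef : ∀ x i, lieD (e i) f x = θ i) (c : ℝ) : ∃ s : M → ℝ,
      ContMDiff 𝓘(ℝ, E4) 𝓘(ℝ, ℝ) ∞ s ∧ (∀ x, 0 < s x) ∧
      ∀ i x, lieD (e i) s x = c * θ i * s x := by
  refine ⟨fun y => Real.exp (c * f y), (Real.contDiff_exp.comp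
    (contDiff_const.mul contDiff_id)).contMDiff.comp hf, fun x => Real.exp_pos _, fun i x => ?_⟩
  rw [lieD_comp_deriv (g := fun t => Real.exp (c * t)) (g' := Real.exp (c * f x) * (c * 1))
    (((hasDerivAt_id (f x)).const_mul c).exp) (hf.mdifferentiable (by simp) x), hef]
  ring

theorem exists_germ_euclidean (he : IsStructFrame e (diagConst 0 0)) :
    ∃ F₀ : M → E4, PreservesFrame e
      (fun i _ => WithLp.toLp 2 ((1 : Matrix (Fin 4) (Fin 4) ℝ) i)) F₀ x₀ := by
  have h1 : ∀ m : Fin 4, ∃ u : M → ℝ, u x₀ = 0 ∧ ∀ᶠ x in 𝓝 x₀,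
      ContMDiffAt 𝓘(ℝ, E4) 𝓘(ℝ, ℝ) ∞ u x ∧
        ∀ i, lieD (e i) u x = (1 : Matrix (Fin 4) (Fin 4) ℝ) i m := fun m => by
    refine he.exists_local_primitive (a := fun i _ => (1 : Matrix (Fin 4) (Fin 4) ℝ) i m)
      (Eventually.of_forall fun x i => contMDiffAt_const) (Eventually.of_forall fun x i j => ?_) 0
    rw [lieD_const, lieD_const]
    fin_cases i <;> fin_cases j <;> simp [diagConst, Fin.sum_univ_four]
  choose u _ hu using h1
  have h2 := eventually_all.2 hu
  exact ⟨_, preservesFrame_of_coord (h2.mono fun x hx j => (hx j).1)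
    (h2.mono fun x hx i j => (hx j).2 i)⟩

theorem exists_germ_halfSpace (he : IsStructFrame e (diagConst ![1, 1, 1] 0))
    (hf : ContMDiff 𝓘(ℝ, E4) 𝓘(ℝ, ℝ) ∞ f) (hef : ∀ x i, lieD (e i) f x = ![2, 0, 0, 0] i) :
    ∃ F₀ : M → E4, F₀ x₀ ∈ {p : E4 | 0 < p 0} ∧
      PreservesFrame e (fun i p => WithLp.toLp 2 (halfSpaceFrame p i)) F₀ x₀ := by
  obtain ⟨s, hsm, hpos, hs⟩ := exists_exp_mul hf hef (-1 / 2)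
  have h1 : ∀ m : Fin 3, ∃ u : M → ℝ, u x₀ = 0 ∧ ∀ᶠ x in 𝓝 x₀,
      ContMDiffAt 𝓘(ℝ, E4) 𝓘(ℝ, ℝ) ∞ u x ∧
        ∀ i, lieD (e i) u x = (if i = m.succ then s else 0) x := fun m => by
    refine he.exists_local_primitive (a := fun i => if i = m.succ then s else 0)
      (Eventually.of_forall fun x i => ?_) (Eventually.of_forall fun x i j => ?_) 0
    · split_ifs
      · exact hsm x
      · exact contMDiffAt_const
    · fin_cases m <;> fin_cases i <;> fin_cases j <;>
        simp [diagConst, Fin.sum_univ_four, hs, lieD_zero]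
  choose u _ hu using h1
  have h2 := eventually_all.2 hu
  refine ⟨_, ?_, preservesFrame_of_coord (u := ![s, u 0, u 1, u 2]) (h2.mono fun x hx j => ?_)
    (h2.mono fun x hx i j => ?_)⟩
  · exact hpos x₀
  · fin_cases j
    exacts [hsm x, (hx 0).1, (hx 1).1, (hx 2).1]
  · have h3 := fun m => (hx m).2
    fin_cases i <;> fin_cases j <;> simp [halfSpaceFrame, hs, h3]

theorem exists_germ_cone (he : IsStructFrame e (diagConst ![1, 1, 0] ![1, 1, 0]))
    (hf : ContMDiff 𝓘(ℝ, E4) 𝓘(ℝ, ℝ) ∞ f) (hef : ∀ x i, lieD (e i) f x = ![2, 0, 0, 0] i) :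
    ∃ F₀ : M → E4, F₀ x₀ ∈ {p : E4 | 0 < p 2} ∧
      PreservesFrame e (fun i p => WithLp.toLp 2 (coneFrame p i)) F₀ x₀ := by
  obtain ⟨s, hsm, hpos, hs⟩ := exists_exp_mul hf hef (-1 / 2)
  have hsd := hsm.mdifferentiable (by simp)
  obtain ⟨t, -, ht⟩ : ∃ t : M → ℝ, t x₀ = 0 ∧ ∀ᶠ x in 𝓝 x₀,
      ContMDiffAt 𝓘(ℝ, E4) 𝓘(ℝ, ℝ) ∞ t x ∧ ∀ i, lieD (e i) t x = ![0, 0, 0, 1] i :=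
    he.exists_local_primitive (a := fun i _ => ![0, 0, 0, 1] i)
      (Eventually.of_forall fun x i => contMDiffAt_const) (Eventually.of_forall fun x i j => by
        rw [lieD_const, lieD_const]
        fin_cases i <;> fin_cases j <;> simp [diagConst, Fin.sum_univ_four]) 0
  -- the products of `s` with the cosine and the sine of `t`
  have hmul : ∀ {R : ℝ → ℝ} {R' : ℝ → ℝ}, ContDiff ℝ ∞ R → (∀ a, HasDerivAt R (R' a) a) →
      ∀ᶠ x in 𝓝 x₀, ContMDiffAt 𝓘(ℝ, E4) 𝓘(ℝ, ℝ) ∞ (fun y => s y * R (t y)) x ∧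
        ∀ i, lieD (e i) (fun y => s y * R (t y)) x
          = ![-(s x * R (t x)), 0, 0, s x * R' (t x)] i := fun {R R'} hR hR' => by
    filter_upwards [ht] with x hx
    have htd := hx.1.mdifferentiableAt (by simp : (∞ : WithTop ℕ∞) ≠ 0)
    refine ⟨(hsm x).mul (hR.contMDiff.contMDiffAt.comp x hx.1), fun i => ?_⟩
    rw [lieD_mul (g := fun y => R (t y)) (hsd x) ((hR' _).differentiableAt.mdifferentiableAt.comp x htd),
      lieD_comp_deriv (hR' _) htd, hs, hx.2]
    fin_cases i <;> simp <;> ring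
  have hcos := hmul Real.contDiff_cos Real.hasDerivAt_cos
  have hsin := hmul Real.contDiff_sin Real.hasDerivAt_sin
  have hnsin := hmul (R := fun a => -Real.sin a) Real.contDiff_sin.neg
    (fun a => (Real.hasDerivAt_sin a).neg)
  obtain ⟨u, -, hu⟩ := he.exists_local_primitive (x₀ := x₀)
    (a := ![0, fun y => s y * Real.cos (t y), fun y => s y * -Real.sin (t y), 0])
    (by
      filter_upwards [hcos, hnsin] with x h1 h2 i
      fin_cases i
      exacts [contMDiffAt_const, h1.1, h2.1, contMDiffAt_const])
    (by
      filter_upwards [hcos, hnsin] with x h1 h2 i j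
      have h1' := h1.2
      have h2' := h2.2
      fin_cases i <;> fin_cases j <;>
        simp [diagConst, Fin.sum_univ_four, lieD_zero, h1', h2', -mul_neg] <;>
        ring) 0
  obtain ⟨w, -, hw⟩ := he.exists_local_primitive (x₀ := x₀)
    (a := ![0, fun y => s y * Real.sin (t y), fun y => s y * Real.cos (t y), 0])
    (by
      filter_upwards [hcos, hsin] with x h1 h2 i
      fin_cases i
      exacts [contMDiffAt_const, h2.1, h1.1, contMDiffAt_const])
    (by
      filter_upwards [hcos, hsin] with x h1 h2 i j
      have h1' := h1.2
      have h2' := h2.2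
      fin_cases i <;> fin_cases j <;>
        simp [diagConst, Fin.sum_univ_four, lieD_zero, h1', h2']) 0
  refine ⟨_, ?_, preservesFrame_of_coord (u := ![u, w, s, t])
    ((ht.and (hu.and hw)).mono fun x hx j => ?_) ((ht.and (hu.and hw)).mono fun x hx i j => ?_)⟩
  · exact hpos x₀
  · fin_cases j
    exacts [hx.2.1.1, hx.2.2.1, hsm x, hx.1.1]
  · have h3 := hx.1.2
    have h4 := hx.2.1.2
    have h5 := hx.2.2.2
    fin_cases i <;> fin_cases j <;> simp [coneFrame, hs, h3, h4, h5]

theorem exists_germ_gibbonsHawking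
    (he : IsStructFrame e (diagConst ![4 / 3, 2 / 3, 2 / 3] ![2 / 3, 0, 0]))
    (hf : ContMDiff 𝓘(ℝ, E4) 𝓘(ℝ, ℝ) ∞ f) (hef : ∀ x i, lieD (e i) f x = ![2, 0, 0, 0] i) :
    ∃ F₀ : M → E4, F₀ x₀ ∈ {p : E4 | 0 < p 0} ∧
      PreservesFrame e (fun i p => WithLp.toLp 2 (gibbonsHawkingFrame p i)) F₀ x₀ := by
  obtain ⟨s, hsm, hpos, hs⟩ := exists_exp_mul hf hef (-1 / 3)
  have hsd := hsm.mdifferentiable (by simp)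
  have hc : ∀ i x, lieD (e i) (fun y => 2 / 3 * s y) x
      = 2 / 3 * (-1 / 3 * ![2, 0, 0, 0] i * s x) := fun i x => by
    rw [lieD_const_mul _ (hsd x), hs]
  have hcm : ContMDiff 𝓘(ℝ, E4) 𝓘(ℝ, ℝ) ∞ (fun y => 2 / 3 * s y) := contMDiff_const.mul hsm
  have h1 : ∀ m : Fin 2, ∃ u : M → ℝ, u x₀ = 0 ∧ ∀ᶠ x in 𝓝 x₀,
      ContMDiffAt 𝓘(ℝ, E4) 𝓘(ℝ, ℝ) ∞ u x ∧
        ∀ i, lieD (e i) u x = (if i = m.succ.succ then fun y => 2 / 3 * s y else 0) x := fun m => by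
    refine he.exists_local_primitive (a := fun i => if i = m.succ.succ then fun y => 2 / 3 * s y else 0)
      (Eventually.of_forall fun x i => ?_) (Eventually.of_forall fun x i j => ?_) 0
    · split_ifs
      · exact hcm x
      · exact contMDiffAt_const
    · fin_cases m <;> fin_cases i <;> fin_cases j <;>
        simp [diagConst, Fin.sum_univ_four, hc, lieD_zero] <;> ring
  choose u _ hu using h1
  have h2 := eventually_all.2 hu
  have hmul : ∀ m, ∀ᶠ x in 𝓝 x₀,
      ContMDiffAt 𝓘(ℝ, E4) 𝓘(ℝ, ℝ) ∞ (fun y => s y * u m y) x ∧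
      ∀ i, lieD (e i) (fun y => s y * u m y) x
        = s x * (if i = m.succ.succ then fun y => 2 / 3 * s y else 0) x
          + u m x * (-1 / 3 * ![2, 0, 0, 0] i * s x) := fun m => by
    filter_upwards [hu m] with x hx
    refine ⟨(hsm x).mul hx.1, fun i => ?_⟩
    rw [lieD_mul (hsd x) (hx.1.mdifferentiableAt (by simp)), hs, hx.2]
  have hss : ∀ i x, lieD (e i) (fun y => s y * s y) x
      = 2 * (s x * (-1 / 3 * ![2, 0, 0, 0] i * s x)) := fun i x => by
    rw [lieD_mul (hsd x) (hsd x), hs]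
    ring
  have hssm := hsm.mul hsm
  obtain ⟨w, -, hw⟩ := he.exists_local_primitive (x₀ := x₀)
    (a := ![0, fun y => 2 / 3 * (s y * s y), fun y => -1 / 3 * (s y * u 1 y),
      fun y => 3⁻¹ * (s y * u 0 y)])
    (by
      filter_upwards [hmul 0, hmul 1] with x h0 h1 i
      fin_cases i
      exacts [contMDiffAt_const, contMDiffAt_const.mul (hssm x), contMDiffAt_const.mul h1.1,
        contMDiffAt_const.mul h0.1])
    (by
      filter_upwards [hmul 0, hmul 1] with x h0 h1 i j
      have hd : MDifferentiableAt 𝓘(ℝ, E4) 𝓘(ℝ, ℝ) (fun y => s y * s y) x :=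
        hssm.mdifferentiable (by simp) x
      have h0d := h0.1.mdifferentiableAt (by simp : (∞ : WithTop ℕ∞) ≠ 0)
      have h1d := h1.1.mdifferentiableAt (by simp : (∞ : WithTop ℕ∞) ≠ 0)
      have hd' := fun i => lieD_const_mul (X := e i) (2 / 3) hd
      have h0d' := fun i => lieD_const_mul (X := e i) 3⁻¹ h0d
      have h1d' := fun i => lieD_const_mul (X := e i) (-1 / 3) h1d
      have h0' := h0.2
      have h1' := h1.2
      fin_cases i <;> fin_cases j <;>
        simp [diagConst, Fin.sum_univ_four, lieD_zero, hd', h0d', h1d', hss, h0', h1'] <;> ring) 0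
  refine ⟨_, ?_, preservesFrame_of_coord (u := ![s, u 0, u 1, w])
    ((h2.and hw).mono fun x hx j => ?_) ((h2.and hw).mono fun x hx i j => ?_)⟩
  · exact hpos x₀
  · fin_cases j
    exacts [hsm x, (hx.1 0).1, (hx.1 1).1, hx.2.1]
  · have h3 := fun m => (hx.1 m).2
    have h4 := hx.2.2
    fin_cases i <;> fin_cases j <;>
      simp [gibbonsHawkingFrame, hs, h3, h4] <;> ring

end AffineGerms

/-! ### The adjoint representation -/

section Adjoint

open Set Filter Topology

variable {M : Type*} [TopologicalSpace M] [ChartedSpace E4 M]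
  [Group M] [LieGroup 𝓘(ℝ, E4) ∞ M]

/-- The inverse of the adjoint representation: the differential of `y ↦ x⁻¹ y x` at the identity. -/
noncomputable def adInv (x : M) : E4 →L[ℝ] E4 := mD E4 E4 (fun y : M => x⁻¹ * y * x) 1

theorem contMDiff_conj : ContMDiff (𝓘(ℝ, E4).prod 𝓘(ℝ, E4)) 𝓘(ℝ, E4) ∞
    (fun p : M × M => p.1⁻¹ * p.2 * p.1) :=
  (contMDiff_fst.inv.mul contMDiff_snd).mul contMDiff_fst

theorem contMDiff_adInv [IsManifold 𝓘(ℝ, E4) ∞ M] :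
    ContMDiff 𝓘(ℝ, E4) 𝓘(ℝ, E4 →L[ℝ] E4) ∞ (adInv : M → E4 →L[ℝ] E4) := by
  intro x₀
  have h1 := ContMDiffAt.mfderiv (x₀ := x₀) (fun x y : M => x⁻¹ * y * x) (fun _ : M => (1 : M))
    (m := ∞) (n := ∞) (contMDiff_conj.contMDiffAt) contMDiffAt_const (by simp)
  refine h1.congr_of_eventuallyEq (Eventually.of_forall fun x => ?_)
  have h2 : x⁻¹ * 1 * x = 1 := by group
  have h3 : x₀⁻¹ * 1 * x₀ = 1 := by group
  have h4 := inTangentCoordinates_eq (I := 𝓘(ℝ, E4)) (I' := 𝓘(ℝ, E4)) (fun _ : M => (1 : M))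
    (fun x : M => x⁻¹ * 1 * x) (fun x => adInv x) (x₀ := x₀) (x := x) (mem_chart_source _ _)
    (by rw [h2, h3]; exact mem_chart_source _ _)
  refine Eq.trans ?_ h4.symm
  rw [h2, h3]
  have h5 : ∀ w : E4, (tangentBundleCore 𝓘(ℝ, E4) M).coordChange (achart E4 1) (achart E4 1) 1 w
      = w := fun w =>
    (tangentBundleCore 𝓘(ℝ, E4) M).coordChange_self _ _ (mem_achart_source E4 (1 : M)) w
  ext1 w
  simp only [ContinuousLinearMap.comp_apply, h5]

theorem adInv_one (v : E4) : adInv (1 : M) v = v := by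
  have h1 : adInv (1 : M) = ContinuousLinearMap.id ℝ E4 := by
    rw [adInv, ← mD_id (N₁ := M) (x := 1)]
    congr 1
    ext y
    simp
  rw [h1]
  rfl

theorem mdifferentiable_conj (x : M) :
    MDifferentiable 𝓘(ℝ, E4) 𝓘(ℝ, E4) (fun y : M => x⁻¹ * y * x) := fun y =>
  ((contMDiff_conj (M := M)).comp (contMDiff_const.prodMk contMDiff_id)).mdifferentiable
    (by simp) y

theorem adInv_mul (x y : M) (v : E4) : adInv (x * y) v = adInv y (adInv x v) := by
  have h1 : (fun z : M => (x * y)⁻¹ * z * (x * y))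
      = fun z => (fun z => y⁻¹ * z * y) (x⁻¹ * z * x) := by
    ext z
    group
  have h2 : x⁻¹ * 1 * x = 1 := by group
  rw [adInv, h1, mD_comp (mdifferentiable_conj y _) (mdifferentiable_conj x _), h2]
  rfl

/-- The right-invariant field generated by `v`, in terms of left-invariant fields. -/
theorem mD_mul_right (x : M) (v : E4) :
    mD E4 E4 (fun y : M => y * x) 1 v = leftField (adInv x v) x := by
  have h1 : (fun y : M => y * x) = fun y => (fun z => x * z) (x⁻¹ * y * x) := by
    ext y
    group
  have h2 : x⁻¹ * 1 * x = 1 := by group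
  rw [h1, mD_comp (mdifferentiable_leftMul x _) (mdifferentiable_conj x _), h2]
  rfl

theorem fderiv_mk_left {Θ : E4 × E4 → ℝ} {a b : E4} (h : DifferentiableAt ℝ Θ (a, b)) (v : E4) :
    fderiv ℝ (fun a => Θ (a, b)) a v = fderiv ℝ Θ (a, b) (v, 0) := by
  have h1 : HasFDerivAt (fun a => Θ (a, b)) _ a :=
    HasFDerivAt.comp (g := Θ) a h.hasFDerivAt (hasFDerivAt_prodMk_left a b)
  rw [h1.fderiv]
  rfl

theorem fderiv_mk_right {Θ : E4 × E4 → ℝ} {a b : E4} (h : DifferentiableAt ℝ Θ (a, b)) (v : E4) :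
    fderiv ℝ (fun b => Θ (a, b)) b v = fderiv ℝ Θ (a, b) (0, v) := by
  have h1 : HasFDerivAt (fun b => Θ (a, b)) _ b :=
    HasFDerivAt.comp (g := Θ) b h.hasFDerivAt (hasFDerivAt_prodMk_right a b)
  rw [h1.fderiv]
  rfl

/-- Left-invariant fields commute with right-invariant fields, on functions at the identity: this
is the symmetry of the second derivative of `u (x * y)`. -/
theorem lieD_lieD_adInv [IsManifold 𝓘(ℝ, E4) ∞ M] {u : M → ℝ}
    (hu : ContMDiffAt 𝓘(ℝ, E4) 𝓘(ℝ, ℝ) ∞ u 1)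
    (hu' : ∀ᶠ x in 𝓝 1, MDifferentiableAt 𝓘(ℝ, E4) 𝓘(ℝ, ℝ) u x) (v w : E4) :
    lieD (leftField w) (fun x => lieD (leftField (adInv x v)) u x) (1 : M)
      = lieD (leftField v) (lieD (leftField w) u) 1 := by
  obtain ⟨φ, ψ, hφs, hψ, hψφ⟩ : ∃ (φ : M → E4) (ψ : E4 → M),
      ContMDiffAt 𝓘(ℝ, E4) 𝓘(ℝ, E4) ∞ φ 1 ∧ ContMDiffAt 𝓘(ℝ, E4) 𝓘(ℝ, E4) ∞ ψ (φ 1) ∧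
      ∀ᶠ x in 𝓝 1, ψ (φ x) = x :=
    ⟨extChartAt 𝓘(ℝ, E4) 1, (extChartAt 𝓘(ℝ, E4) 1).symm, contMDiffAt_extChartAt,
      contMDiffAt_chart_symm (mem_extChartAt_target 1),
      (show ∀ᶠ x in 𝓝 (1 : M), x ∈ (extChartAt 𝓘(ℝ, E4) 1).source from
        extChartAt_source_mem_nhds 1).mono fun x hx => PartialEquiv.left_inv _ hx⟩
  set c := φ 1 with hc
  have hc1 : ψ c = 1 := hψφ.self_of_nhds
  have hφd : MDifferentiableAt 𝓘(ℝ, E4) 𝓘(ℝ, E4) φ 1 := hφs.mdifferentiableAt (by simp)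
  have hψd : MDifferentiableAt 𝓘(ℝ, E4) 𝓘(ℝ, E4) ψ c := hψ.mdifferentiableAt (by simp)
  have hid : ∀ v : E4, mD E4 E4 ψ c (mD E4 E4 φ 1 v) = v := fun v =>
    congrArg (fun L : E4 →L[ℝ] E4 => L v) (mD_comp_eq_id hψd hφd hψφ)
  set Θ : E4 × E4 → ℝ := fun p => u (ψ p.1 * ψ p.2) with hΘ
  have hΘs : ContDiffAt ℝ ∞ Θ (c, c) := by
    rw [← contMDiffAt_iff_contDiffAt]
    have h1 : ContMDiffAt 𝓘(ℝ, E4 × E4) 𝓘(ℝ, E4) ∞ (fun p : E4 × E4 => ψ p.1 * ψ p.2) (c, c) :=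
      (ContMDiffAt.comp (c, c) (g := ψ) (f := Prod.fst) hψ contDiffAt_fst.contMDiffAt).mul
        (ContMDiffAt.comp (c, c) (g := ψ) (f := Prod.snd) hψ contDiffAt_snd.contMDiffAt)
    refine ContMDiffAt.comp (c, c) (g := u) ?_ h1
    simpa [hc1] using hu
  have hΘd : ∀ᶠ p in 𝓝 (c, c), DifferentiableAt ℝ Θ p :=
    ((hΘs.of_le (m := 1) (by simp)).eventually (by simp)).mono
      fun p hp => hp.differentiableAt (by simp)
  have hΘ2 : DifferentiableAt ℝ (fderiv ℝ Θ) (c, c) :=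
    (hΘs.fderiv_right (m := ∞) (by simp)).differentiableAt (by simp)
  have hsymm : IsSymmSndFDerivAt ℝ Θ (c, c) := hΘs.isSymmSndFDerivAt (by
    rw [minSmoothness_of_isRCLikeNormedField]
    exact WithTop.coe_le_coe.2 le_top)
  have hφc : Tendsto φ (𝓝 (1 : M)) (𝓝 c) := hφs.continuousAt
  -- the two first derivatives of `Θ` are derivatives along right- and left-invariant fields
  have e1 : ∀ᶠ x in 𝓝 (1 : M), lieD (leftField (adInv x v)) u x
      = fderiv ℝ Θ (c, φ x) (mD E4 E4 φ 1 v, 0) := by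
    filter_upwards [hu', (tendsto_const_nhds.prodMk_nhds hφc).eventually hΘd, hψφ] with x h1 h2 h3
    have hm : MDifferentiableAt 𝓘(ℝ, E4) 𝓘(ℝ, E4) (fun y : M => y * x) 1 :=
      (contMDiff_mul_right (I := 𝓘(ℝ, E4)) (n := ∞)).mdifferentiable (by simp) _
    have hux : MDifferentiableAt 𝓘(ℝ, E4) 𝓘(ℝ, ℝ) u (1 * x) := by rwa [one_mul]
    have h4 : mD E4 ℝ (fun y : M => u (y * x)) 1 v = lieD (leftField (adInv x v)) u x := by
      rw [mD_comp (g := u) (f := fun y => y * x) hux hm, ContinuousLinearMap.comp_apply, mD_mul_right, one_mul]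
      rfl
    have hux1 : MDifferentiableAt 𝓘(ℝ, E4) 𝓘(ℝ, ℝ) (fun y : M => u (y * x)) (ψ c) := by
      rw [hc1]
      exact MDifferentiableAt.comp (g := u) (f := fun y => y * x) _ hux hm
    have h5 : (fun a => Θ (a, φ x)) = fun a => (fun y => u (y * x)) (ψ a) := by
      simp only [hΘ, h3]
    rw [← fderiv_mk_left h2, ← mD_eq_fderiv, h5, mD_comp hux1 hψd,
      ContinuousLinearMap.comp_apply, hid, hc1, h4]
  have e2 : ∀ᶠ x in 𝓝 (1 : M), lieD (leftField w) u x
      = fderiv ℝ Θ (φ x, c) (0, mD E4 E4 φ 1 w) := by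
    filter_upwards [hu', (hφc.prodMk_nhds tendsto_const_nhds).eventually hΘd, hψφ] with x h1 h2 h3
    have hm : MDifferentiableAt 𝓘(ℝ, E4) 𝓘(ℝ, E4) (fun y : M => x * y) 1 :=
      mdifferentiable_leftMul x 1
    have hux : MDifferentiableAt 𝓘(ℝ, E4) 𝓘(ℝ, ℝ) u (x * 1) := by rwa [mul_one]
    have h4 : mD E4 ℝ (fun y : M => u (x * y)) 1 w = lieD (leftField w) u x := by
      rw [mD_comp (g := u) (f := fun y => x * y) hux hm, mul_one]
      rfl
    have hux1 : MDifferentiableAt 𝓘(ℝ, E4) 𝓘(ℝ, ℝ) (fun y : M => u (x * y)) (ψ c) := by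
      rw [hc1]
      exact MDifferentiableAt.comp (g := u) (f := fun y => x * y) _ hux hm
    have h5 : (fun b => Θ (φ x, b)) = fun b => (fun y => u (x * y)) (ψ b) := by
      simp only [hΘ, h3]
    rw [← fderiv_mk_right h2, ← mD_eq_fderiv, h5, mD_comp hux1 hψd,
      ContinuousLinearMap.comp_apply, hid, hc1, h4]
  have d1 : HasFDerivAt (fun b => fderiv ℝ Θ (c, b) (mD E4 E4 φ 1 v, 0))
      ((ContinuousLinearMap.apply ℝ ℝ ((mD E4 E4 φ 1 v, 0) : E4 × E4)).comp
        ((fderiv ℝ (fderiv ℝ Θ) (c, c)).comp (ContinuousLinearMap.inr ℝ E4 E4))) c :=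
    (ContinuousLinearMap.apply ℝ ℝ ((mD E4 E4 φ 1 v, 0) : E4 × E4)).hasFDerivAt.comp c
      (HasFDerivAt.comp (g := fderiv ℝ Θ) c hΘ2.hasFDerivAt (hasFDerivAt_prodMk_right c c))
  have d2 : HasFDerivAt (fun a => fderiv ℝ Θ (a, c) (0, mD E4 E4 φ 1 w))
      ((ContinuousLinearMap.apply ℝ ℝ ((0, mD E4 E4 φ 1 w) : E4 × E4)).comp
        ((fderiv ℝ (fderiv ℝ Θ) (c, c)).comp (ContinuousLinearMap.inl ℝ E4 E4))) c :=
    (ContinuousLinearMap.apply ℝ ℝ ((0, mD E4 E4 φ 1 w) : E4 × E4)).hasFDerivAt.comp c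
      (HasFDerivAt.comp (g := fderiv ℝ Θ) c hΘ2.hasFDerivAt (hasFDerivAt_prodMk_left c c))
  have h1 : ∀ v : E4, lieD (leftField v) φ (1 : M) = mD E4 E4 φ 1 v := fun v => by
    rw [lieD, leftField_one]
  rw [lieD_congr e1, lieD_congr e2,
    lieD_comp (g := fun b => fderiv ℝ Θ (c, b) (mD E4 E4 φ 1 v, 0)) d1.differentiableAt hφd,
    lieD_comp (g := fun a => fderiv ℝ Θ (a, c) (0, mD E4 E4 φ 1 w)) d2.differentiableAt hφd,
    d1.fderiv, d2.fderiv, h1, h1]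
  exact hsymm _ _

theorem lieD_sum {N : Type*} [TopologicalSpace N] [ChartedSpace E4 N] {ι : Type*} [Fintype ι]
    {X : N → E4} {F : ι → N → ℝ} {x : N}
    (h : ∀ i, MDifferentiableAt 𝓘(ℝ, E4) 𝓘(ℝ, ℝ) (F i) x) :
    lieD X (fun y => ∑ i, F i y) x = ∑ i, lieD X (F i) x := by
  classical
  suffices ∀ s : Finset ι, MDifferentiableAt 𝓘(ℝ, E4) 𝓘(ℝ, ℝ) (fun y => ∑ i ∈ s, F i y) x ∧
      lieD X (fun y => ∑ i ∈ s, F i y) x = ∑ i ∈ s, lieD X (F i) x from (this _).2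
  intro s
  induction s using Finset.induction_on with
  | empty => exact ⟨mdifferentiableAt_const, lieD_const _ _ _⟩
  | insert i s hi ih =>
    simp only [Finset.sum_insert hi]
    exact ⟨(h i).add ih.1, by rw [lieD_add (h i) ih.1, ih.2]⟩

theorem lieD_leftField_add (u : M → ℝ) (x : M) (v w : E4) :
    lieD (leftField (v + w)) u x = lieD (leftField v) u x + lieD (leftField w) u x := by
  rw [lieD, leftField_add, map_add]
  rfl

variable [IsManifold 𝓘(ℝ, E4) ∞ M]

theorem lieD_adInv_one (v w : E4) :
    lieD (leftField w) (fun x => adInv x v) (1 : M) = -lieBr M w v := by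
  set b : Fin 4 → E4 := fun i => EuclideanSpace.single i 1 with hb
  have hbs : ∀ w : E4, w = ∑ i, w i • b i := fun w => by
    simpa [hb] using ((EuclideanSpace.basisFun (Fin 4) ℝ).sum_repr w).symm
  have hA : ContMDiff 𝓘(ℝ, E4) 𝓘(ℝ, E4) ∞ (fun x : M => adInv x v) := fun x =>
    ((ContinuousLinearMap.apply ℝ E4 v).contDiff.contMDiff.contMDiffAt).comp x (contMDiff_adInv x)
  have hAd : MDifferentiableAt 𝓘(ℝ, E4) 𝓘(ℝ, E4) (fun x : M => adInv x v) 1 :=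
    hA.mdifferentiable (by simp) 1
  have hA1 : lieD (leftField w) (fun x => adInv x v) (1 : M)
      = ∑ i, lieD (leftField w) (fun x => adInv x v i) (1 : M) • b i := by
    rw [hbs (lieD (leftField w) (fun x => adInv x v) (1 : M))]
    refine Finset.sum_congr rfl fun i _ => ?_
    congr 1
    exact (lieD_clm (EuclideanSpace.proj i : E4 →L[ℝ] ℝ) hAd).symm
  have hAi : ∀ i, MDifferentiableAt 𝓘(ℝ, E4) 𝓘(ℝ, ℝ) (fun x : M => adInv x v i) 1 := fun i =>
    ((EuclideanSpace.proj i : E4 →L[ℝ] ℝ).differentiableAt.mdifferentiableAt).comp 1 hAd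
  -- both sides act in the same way on functions
  have key : ∀ u : M → ℝ, (∀ᶠ x in 𝓝 1, ContMDiffAt 𝓘(ℝ, E4) 𝓘(ℝ, ℝ) ∞ u x) →
      lieD (leftField (lieD (leftField w) (fun x => adInv x v) (1 : M))) u 1
        = -lieD (leftField (lieBr M w v)) u 1 := by
    intro u hu
    have hu1 := hu.self_of_nhds
    have hud : ∀ a : E4, MDifferentiableAt 𝓘(ℝ, E4) 𝓘(ℝ, ℝ) (lieD (leftField a) u) (1 : M) :=
      fun a => (contMDiffAt_lieD (smoothVF_leftField a) hu1).mdifferentiableAt (by simp)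
    have h1 := lieD_lieD_adInv hu1 (hu.mono fun x hx => hx.mdifferentiableAt (by simp)) v w
    have h2 := lieD_bracket (smoothVF_leftField (M := M) w) (smoothVF_leftField v) hu1
    have h3 : lieD (leftField (lieBr M w v)) u (1 : M)
        = lieD (bracket (leftField w) (leftField v)) u 1 := by
      rw [lieD, lieD, bracket_leftField]
    have h4 : ∀ x : M, lieD (leftField (adInv x v)) u x
        = ∑ i, adInv x v i * lieD (leftField (b i)) u x := fun x => by
      rw [← lieD_leftField_sum, ← hbs]
    have h5 : lieD (leftField v) u = fun x : M => ∑ i, v i * lieD (leftField (b i)) u x := by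
      ext x
      rw [← lieD_leftField_sum, ← hbs]
    have hm : ∀ i, MDifferentiableAt 𝓘(ℝ, E4) 𝓘(ℝ, ℝ)
        (fun x : M => adInv x v i * lieD (leftField (b i)) u x) 1 := fun i => (hAi i).mul (hud (b i))
    have hc : ∀ i, MDifferentiableAt 𝓘(ℝ, E4) 𝓘(ℝ, ℝ)
        (fun x : M => v i * lieD (leftField (b i)) u x) 1 := fun i =>
      mdifferentiableAt_const.mul (hud (b i))
    have h6 : lieD (leftField w) (fun x => lieD (leftField (adInv x v)) u x) (1 : M)
        = lieD (leftField (lieD (leftField w) (fun x => adInv x v) (1 : M))) u 1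
          + lieD (leftField w) (lieD (leftField v) u) 1 := by
      rw [hA1, lieD_leftField_sum, h5]
      simp only [h4]
      rw [lieD_sum hm, lieD_sum hc, ← Finset.sum_add_distrib]
      refine Finset.sum_congr rfl fun i _ => ?_
      rw [lieD_mul (hAi i) (hud _), lieD_const_mul _ (hud _), adInv_one]
      ring
    rw [h3, h2]
    linarith
  have h7 : ∀ j, (mD E4 E4 (extChartAt 𝓘(ℝ, E4) (1 : M)) 1
      (lieD (leftField w) (fun x => adInv x v) (1 : M) + lieBr M w v)) j = 0 := by
    intro j
    have hch : ∀ᶠ x in 𝓝 (1 : M), ContMDiffAt 𝓘(ℝ, E4) 𝓘(ℝ, E4) ∞ (extChartAt 𝓘(ℝ, E4) (1 : M)) x :=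
      (show ∀ᶠ x in 𝓝 (1 : M), x ∈ (extChartAt 𝓘(ℝ, E4) 1).source from
        extChartAt_source_mem_nhds 1).mono fun x hx => contMDiffAt_chart hx
    have h8 := key (fun x => (extChartAt 𝓘(ℝ, E4) (1 : M) x) j) (hch.mono fun x hx =>
      ((EuclideanSpace.proj j : E4 →L[ℝ] ℝ).contDiff.contMDiff.contMDiffAt).comp x hx)
    rw [← add_eq_zero_iff_eq_neg, ← lieD_leftField_add] at h8
    have h9 := lieD_clm (X := leftField (lieD (leftField w) (fun x => adInv x v) (1 : M)
      + lieBr M w v)) (EuclideanSpace.proj j : E4 →L[ℝ] ℝ)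
      (hch.self_of_nhds.mdifferentiableAt (by simp))
    have h10 := h9.symm.trans h8
    rw [lieD, leftField_one] at h10
    exact h10
  rw [← add_eq_zero_iff_eq_neg]
  refine (isInvertible_mD_chart (1 : M)).injective ?_
  rw [map_zero]
  ext j
  exact h7 j

/-- The adjoint representation is a solution of the linear system given by the Lie algebra. -/
theorem lieD_adInv (v w : E4) (x : M) :
    lieD (leftField w) (fun x => adInv x v) x = -lieBr M w (adInv x v) := by
  have hA : MDifferentiableAt 𝓘(ℝ, E4) 𝓘(ℝ, E4) (fun x : M => adInv x v) (x * 1) :=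
    (((ContinuousLinearMap.apply ℝ E4 v).contDiff.contMDiff.contMDiffAt).comp _
      (contMDiff_adInv (x * 1))).mdifferentiableAt (n := ∞) (by simp)
  have h1 := mD_comp (g := fun x : M => adInv x v) (f := fun y => x * y) hA
    (mdifferentiable_leftMul x 1)
  have h2 : (fun y : M => adInv (x * y) v) = fun y => adInv y (adInv x v) := by
    ext1 y
    exact adInv_mul x y v
  rw [h2, mul_one] at h1
  have h3 := lieD_adInv_one (M := M) (adInv x v) w
  rw [lieD, h1, leftField_one] at h3
  exact h3

end Adjoint

/-! ### The group of non-zero quaternions -/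

section Quaternions

open Set Filter Topology Matrix

/-- The rows are the quaternions `q`, `q i`, `q j`, `q k`. -/
def quatRows (q : Fin 4 → ℝ) : Matrix (Fin 4) (Fin 4) ℝ :=
  !![q 0, q 1, q 2, q 3; -q 1, q 0, q 3, -q 2; -q 2, -q 3, q 0, q 1; -q 3, q 2, -q 1, q 0]

theorem norm_sq_eq_coord (p : E4) : ‖p‖ ^ 2 = p 0 ^ 2 + p 1 ^ 2 + p 2 ^ 2 + p 3 ^ 2 := by
  simp [EuclideanSpace.norm_sq_eq, Fin.sum_univ_four]

theorem coord_sq_pos {p : E4} (hp : p ≠ 0) : 0 < p 0 ^ 2 + p 1 ^ 2 + p 2 ^ 2 + p 3 ^ 2 := by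
  rw [← norm_sq_eq_coord]
  positivity

theorem ne_zero_of_coord_sq_pos {p : E4} (hp : 0 < p 0 ^ 2 + p 1 ^ 2 + p 2 ^ 2 + p 3 ^ 2) :
    p ≠ 0 := by
  rintro rfl
  simp at hp

theorem hasFDerivAt_inv_norm_sq {p : E4} (hp : p ≠ 0) :
    HasFDerivAt (fun p : E4 => (p 0 ^ 2 + p 1 ^ 2 + p 2 ^ 2 + p 3 ^ 2)⁻¹)
      ((-((p 0 ^ 2 + p 1 ^ 2 + p 2 ^ 2 + p 3 ^ 2) ^ 2)⁻¹) •
        (∑ m, (2 * p m) • (EuclideanSpace.proj m : E4 →L[ℝ] ℝ))) p := by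
  have h1 : ∀ m, HasFDerivAt (fun p : E4 => p m ^ 2)
      ((2 * p m) • (EuclideanSpace.proj m : E4 →L[ℝ] ℝ)) p := fun m => by
    simpa using hasFDerivAt_comp_coord m (hasDerivAt_pow 2 (p m))
  rw [Fin.sum_univ_four]
  exact (hasDerivAt_inv (coord_sq_pos hp).ne').comp_hasFDerivAt p
    ((((h1 0).add (h1 1)).add (h1 2)).add (h1 3))

/-- The group of non-zero quaternions, acting on itself by left multiplication; the parameter of the
translation from `q` to `p` is `p q⁻¹`. -/
theorem isModel_inverted :
    IsModel {p : E4 | p ≠ 0} invertedMetric (fun i p => WithLp.toLp 2 (quatRows p.ofLp i))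
      (fun p => (p 0 ^ 2 + p 1 ^ 2 + p 2 ^ 2 + p 3 ^ 2)⁻¹) ![2, 0, 0, 0] := by
  refine isModel_of_affine
    (A := fun p => !![p 0, -p 1, -p 2, -p 3; p 1, p 0, -p 3, p 2; p 2, p 3, p 0, -p 1;
      p 3, -p 2, p 1, p 0])
    (T := fun p q => !₂[p 0 * q 0 - p 1 * q 1 - p 2 * q 2 - p 3 * q 3,
      p 0 * q 1 + p 1 * q 0 + p 2 * q 3 - p 3 * q 2,
      p 0 * q 2 - p 1 * q 3 + p 2 * q 0 + p 3 * q 1,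
      p 0 * q 3 + p 1 * q 2 - p 2 * q 1 + p 3 * q 0])
    (D := fun q p => !₂[
      (p 0 * q 0 + p 1 * q 1 + p 2 * q 2 + p 3 * q 3) / (q 0 ^ 2 + q 1 ^ 2 + q 2 ^ 2 + q 3 ^ 2),
      (-p 0 * q 1 + p 1 * q 0 - p 2 * q 3 + p 3 * q 2) / (q 0 ^ 2 + q 1 ^ 2 + q 2 ^ 2 + q 3 ^ 2),
      (-p 0 * q 2 + p 1 * q 3 + p 2 * q 0 - p 3 * q 1) / (q 0 ^ 2 + q 1 ^ 2 + q 2 ^ 2 + q 3 ^ 2),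
      (-p 0 * q 3 - p 1 * q 2 + p 2 * q 1 + p 3 * q 0) / (q 0 ^ 2 + q 1 ^ 2 + q 2 ^ 2 + q 3 ^ 2)])
    isOpen_ne ?_ (fun i j => ?_) (fun p q j => ?_) (fun p hp q hq => ?_) (fun p hp q hq i j => ?_)
    (fun q hq p hp => ⟨?_, ?_, ?_⟩) (fun p => exists_bilin_euclideanMetric _ p)
    (fun p hp i j => ?_) (fun p hp => inv_pos.2 (coord_sq_pos hp))
    (fun p hp => (hasFDerivAt_inv_norm_sq hp).differentiableAt) (fun p hp i => ?_)
  · exact (isConnected_compl_singleton_of_one_lt_rank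
      (Module.lt_rank_of_lt_finrank (by simp)) (0 : E4)).isPreconnected
  · fin_cases i <;> fin_cases j <;> simp [quatRows] <;> fun_prop
  · fin_cases j <;> simp [mulVec, dotProduct, Fin.sum_univ_four] <;> ring
  · refine ne_zero_of_coord_sq_pos ?_
    have h1 := mul_pos (coord_sq_pos hp) (coord_sq_pos hq)
    simp
    nlinarith [h1]
  · fin_cases i <;> fin_cases j <;>
      simp [quatRows, mulVec, dotProduct, Fin.sum_univ_four] <;> ring
  · refine ne_zero_of_coord_sq_pos ?_
    have h1 := div_pos (coord_sq_pos hp) (coord_sq_pos hq)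
    have h2 := (coord_sq_pos hq).ne'
    refine h1.trans_eq ?_
    simp
    field_simp
    ring
  · have h2 := (coord_sq_pos hq).ne'
    ext j; fin_cases j <;> simp <;> field_simp <;> ring
  · have h2 := (coord_sq_pos hq).ne'
    ext j; fin_cases j <;> simp <;> field_simp <;> ring
  · have h2 := (coord_sq_pos hp).ne'
    have h3 : ‖p‖ ^ 4 = (p 0 ^ 2 + p 1 ^ 2 + p 2 ^ 2 + p 3 ^ 2) ^ 2 := by
      rw [← norm_sq_eq_coord]; ring
    rw [invertedMetric, h3]
    fin_cases i <;> fin_cases j <;> simp [quatRows, euclideanMetric] <;> field_simp <;>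
      first | ring1 | simp
  · have h2 := (coord_sq_pos hp).ne'
    rw [(hasFDerivAt_inv_norm_sq hp).fderiv]
    fin_cases i <;> simp [quatRows, Fin.sum_univ_four] <;> field_simp <;> ring

/-- The map `κ ↦ -2 u × κ`, where `u` is the `i`-th of the quaternions `1`, `i`, `j`, `k`, and where
the product with `1` is zero. -/
def rotDer (i : Fin 4) (κ : Fin 3 → ℝ) : Fin 3 → ℝ :=
  (![![0, 0, 0], ![0, 2 * κ 2, -(2 * κ 1)], ![-(2 * κ 2), 0, 2 * κ 0],
    ![2 * κ 1, -(2 * κ 0), 0]] : Fin 4 → Fin 3 → ℝ) i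

/-- The quaternion `c - i κ₁ - j κ₂ - k κ₃` for a triple of imaginary quaternions `κ`. -/
def quatTrace (c : ℝ) (κ : Fin 3 → Fin 3 → ℝ) : Fin 4 → ℝ :=
  ![c + κ 0 0 + κ 1 1 + κ 2 2, κ 2 1 - κ 1 2, κ 0 2 - κ 2 0, κ 1 0 - κ 0 1]

/-- If `κ_a = q⁻¹ i_a q` for a unit quaternion `q`, then `quatTrace 1 κ = 4 (re q) q`. This is the
derivative of `q` along `q u`, expressed through `T = quatTrace 1 κ`. -/
theorem quatTrace_identity {κ : Matrix (Fin 3) (Fin 3) ℝ} (h : κ * κᵀ = 1)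
    (hc : ∀ a, κ a ⨯₃ κ (a + 1) = κ (a + 2)) (i : Fin 3) (m : Fin 4) :
    2 * quatTrace 1 κ 0 * quatTrace 0 (fun a => rotDer i.succ (κ a)) m
      - quatTrace 1 κ m * quatTrace 0 (fun a => rotDer i.succ (κ a)) 0
      = 2 * quatTrace 1 κ 0 * quatRows (quatTrace 1 κ) i.succ m := by
  have h' : κᵀ * κ = 1 := mul_eq_one_comm.1 h
  have c := fun a b => congrFun (congrFun h a) b
  have w := fun a b => congrFun (congrFun h' a) b
  have x := fun a j => congrFun (hc a) j
  simp only [mul_apply, transpose_apply, Fin.sum_univ_three] at c w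
  have c00 := c 0 0
  have c01 := c 0 1
  have c02 := c 0 2
  have c11 := c 1 1
  have c12 := c 1 2
  have c22 := c 2 2
  have w00 := w 0 0
  have w01 := w 0 1
  have w02 := w 0 2
  have w11 := w 1 1
  have w12 := w 1 2
  have x20 := x 0 0
  have x21 := x 0 1
  have x22 := x 0 2
  have x00 := x 1 0
  have x01 := x 1 1
  have x02 := x 1 2
  have x10 := x 2 0
  have x11 := x 2 1
  have x12 := x 2 2
  simp [cross_apply] at c00 c01 c02 c11 c12 c22 w00 w01 w02 w11 w12 x00 x01 x02 x10 x11 x12 x20 x21 x22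
  fin_cases i <;> fin_cases m <;> simp [quatTrace, rotDer, quatRows]
  · ring
  · linear_combination 2 * c11 + 2 * c22 - 2 * w00 + 4 * x00
  · linear_combination -2 * c01 - 2 * w01 + 2 * x01 + 2 * x10
  · linear_combination -2 * c02 - 2 * w02 + 2 * x02 + 2 * x20
  · ring
  · linear_combination -2 * c01 - 2 * w01 + 2 * x01 + 2 * x10
  · linear_combination 2 * c00 + 2 * c22 - 2 * w11 + 4 * x11
  · linear_combination -2 * c12 - 2 * w12 + 2 * x12 + 2 * x21
  · ring
  · linear_combination -2 * c02 - 2 * w02 + 2 * x02 + 2 * x20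
  · linear_combination -2 * c12 - 2 * w12 + 2 * x12 + 2 * x21
  · linear_combination -2 * c22 + 2 * w00 + 2 * w11 + 4 * x22

end Quaternions

/-! ### The quaternionic germ -/

section QuaternionicGerm

open Set Filter Topology Matrix

variable {M : Type*} [TopologicalSpace M] [ChartedSpace E4 M]

theorem lieD_sub {X : M → E4} {f g : M → ℝ} {x : M}
    (hf : MDifferentiableAt 𝓘(ℝ, E4) 𝓘(ℝ, ℝ) f x) (hg : MDifferentiableAt 𝓘(ℝ, E4) 𝓘(ℝ, ℝ) g x) :
    lieD X (fun y => f y - g y) x = lieD X f x - lieD X g x := by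
  have h1 : MDifferentiableAt 𝓘(ℝ, E4) 𝓘(ℝ, ℝ) (fun y => -g y) x := hg.neg
  simp only [sub_eq_add_neg]
  rw [lieD_add hf h1, lieD_neg hg]

/-- A field of imaginary quaternions `κ` whose derivative along `e i` is `-2 u × κ` for the `i`-th
unit `u`. -/
structure IsRotating (e : Fin 4 → M → E4) (κ : M → Fin 3 → ℝ) : Prop where
  smooth : ∀ l, ContMDiff 𝓘(ℝ, E4) 𝓘(ℝ, ℝ) ∞ (fun x => κ x l)
  lieD_eq : ∀ i l x, lieD (e i) (fun x => κ x l) x = rotDer i (κ x) l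

variable {e : Fin 4 → M → E4} {κ μ : M → Fin 3 → ℝ}

theorem IsRotating.mdifferentiableAt (h : IsRotating e κ) (l : Fin 3) (x : M) :
    MDifferentiableAt 𝓘(ℝ, E4) 𝓘(ℝ, ℝ) (fun x => κ x l) x :=
  (h.smooth l).mdifferentiable (by simp) x

theorem IsRotating.sub (hκ : IsRotating e κ) (hμ : IsRotating e μ) :
    IsRotating e (fun x => κ x - μ x) where
  smooth l := (hκ.smooth l).sub (hμ.smooth l)
  lieD_eq i l x := by
    have h1 := lieD_sub (X := e i) (hκ.mdifferentiableAt l x) (hμ.mdifferentiableAt l x)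
    rw [hκ.lieD_eq, hμ.lieD_eq] at h1
    refine h1.trans ?_
    fin_cases i <;> fin_cases l <;> simp [rotDer] <;> ring

theorem IsRotating.cross (hκ : IsRotating e κ) (hμ : IsRotating e μ) :
    IsRotating e (fun x => κ x ⨯₃ μ x) := by
  have hm : ∀ l m x, MDifferentiableAt 𝓘(ℝ, E4) 𝓘(ℝ, ℝ) (fun x => κ x l * μ x m) x :=
    fun l m x => (hκ.mdifferentiableAt l x).mul (hμ.mdifferentiableAt m x)
  have hd : ∀ i l m x, lieD (e i) (fun x => κ x l * μ x m) x
      = κ x l * rotDer i (μ x) m + μ x m * rotDer i (κ x) l := fun i l m x => by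
    rw [lieD_mul (hκ.mdifferentiableAt l x) (hμ.mdifferentiableAt m x), hκ.lieD_eq, hμ.lieD_eq]
  refine ⟨fun l => ?_, fun i l x => ?_⟩
  · have h1 := fun l m => (hκ.smooth l).mul (hμ.smooth m)
    fin_cases l
    exacts [(h1 1 2).sub (h1 2 1), (h1 2 0).sub (h1 0 2), (h1 0 1).sub (h1 1 0)]
  · fin_cases l
    · refine (lieD_sub (hm 1 2 x) (hm 2 1 x)).trans ?_
      rw [hd, hd]
      fin_cases i <;> simp [rotDer, cross_apply] <;> ring
    · refine (lieD_sub (hm 2 0 x) (hm 0 2 x)).trans ?_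
      rw [hd, hd]
      fin_cases i <;> simp [rotDer, cross_apply] <;> ring
    · refine (lieD_sub (hm 0 1 x) (hm 1 0 x)).trans ?_
      rw [hd, hd]
      fin_cases i <;> simp [rotDer, cross_apply] <;> ring

variable [IsManifold 𝓘(ℝ, E4) ∞ M] [PreconnectedSpace M]

theorem IsRotating.dot_eq (hli : ∀ x, LinearIndependent ℝ (fun i => e i x)) (hκ : IsRotating e κ)
    (hμ : IsRotating e μ) (x y : M) : ∑ l, κ x l * μ x l = ∑ l, κ y l * μ y l := by
  have hm : ∀ l x, MDifferentiableAt 𝓘(ℝ, E4) 𝓘(ℝ, ℝ) (fun x => κ x l * μ x l) x :=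
    fun l x => (hκ.mdifferentiableAt l x).mul (hμ.mdifferentiableAt l x)
  refine eq_of_lieD_eq_zero (u := fun x => ∑ l, κ x l * μ x l) hli (fun x => ?_) (fun x i => ?_) x y
  · simp only [Fin.sum_univ_three]
    exact ((hm 0 x).add (hm 1 x)).add (hm 2 x)
  · rw [lieD_sum fun l => hm l x]
    simp only [lieD_mul (hκ.mdifferentiableAt _ x) (hμ.mdifferentiableAt _ x), hκ.lieD_eq,
      hμ.lieD_eq, Fin.sum_univ_three]
    fin_cases i <;> simp [rotDer] <;> ring

theorem IsRotating.eq_of_eq (hli : ∀ x, LinearIndependent ℝ (fun i => e i x))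
    (hκ : IsRotating e κ) (hμ : IsRotating e μ) {x₀ : M} (h : κ x₀ = μ x₀) (x : M) :
    κ x = μ x := by
  have h1 := (hκ.sub hμ).dot_eq hli (hκ.sub hμ) x x₀
  simp only [h, sub_self, mul_zero, Finset.sum_const_zero, Pi.sub_apply] at h1
  ext l
  have h2 := (Finset.sum_eq_zero_iff_of_nonneg fun l _ => mul_self_nonneg (κ x l - μ x l)).1 h1 l
    (Finset.mem_univ l)
  exact sub_eq_zero.1 (mul_self_eq_zero.1 h2)

/-- The quaternionic germ: if `κ_a = q⁻¹ i_a q`, then `q` is a multiple of `quatTrace 1 κ`, and its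
norm is prescribed by the conformal factor. -/
theorem exists_germ_quaternion (hli : ∀ x, LinearIndependent ℝ (fun i => e i x))
    {κ : M → Matrix (Fin 3) (Fin 3) ℝ} (hκ : ∀ a, IsRotating e (fun x => κ x a)) {x₀ : M}
    (hκ₀ : κ x₀ = 1) {f : M → ℝ} (hf : ContMDiff 𝓘(ℝ, E4) 𝓘(ℝ, ℝ) ∞ f)
    (hef : ∀ x i, lieD (e i) f x = ![2, 0, 0, 0] i) :
    ∃ F₀ : M → E4, F₀ x₀ ∈ {p : E4 | p ≠ 0} ∧
      PreservesFrame e (fun i p => WithLp.toLp 2 (quatRows p.ofLp i)) F₀ x₀ := by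
  obtain ⟨s, hsm, hpos, hs⟩ := exists_exp_mul hf hef (1 / 2)
  have hsd := hsm.mdifferentiable (by simp)
  have horth : ∀ x, κ x * (κ x)ᵀ = 1 := fun x => by
    ext a b
    have h1 := (hκ a).dot_eq hli (hκ b) x x₀
    rw [mul_apply]
    simp only [transpose_apply]
    rw [h1, hκ₀]
    fin_cases a <;> fin_cases b <;> simp [Matrix.one_apply]
  have hcross : ∀ x a, κ x a ⨯₃ κ x (a + 1) = κ x (a + 2) := fun x a => by
    refine ((hκ a).cross (hκ (a + 1))).eq_of_eq hli (hκ (a + 2)) (x₀ := x₀) ?_ x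
    simp only [hκ₀]
    ext l
    fin_cases a <;> fin_cases l <;> simp [cross_apply, Matrix.one_apply]
  -- the quaternion `T`, a multiple of the solution
  set T : M → Fin 4 → ℝ := fun x => quatTrace 1 (κ x) with hT
  have hTs : ∀ m, ContMDiff 𝓘(ℝ, E4) 𝓘(ℝ, ℝ) ∞ (fun x => T x m) := fun m => by
    have h1 := fun a => (hκ a).smooth
    fin_cases m
    exacts [((contMDiff_const.add (h1 0 0)).add (h1 1 1)).add (h1 2 2), (h1 2 1).sub (h1 1 2),
      (h1 0 2).sub (h1 2 0), (h1 1 0).sub (h1 0 1)]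
  have hTd := fun m => (hTs m).mdifferentiable (by simp : (∞ : WithTop ℕ∞) ≠ 0)
  have hTD : ∀ i m x, lieD (e i) (fun x => T x m) x
      = quatTrace 0 (fun a => rotDer i (κ x a)) m := fun i m x => by
    have h1 := fun a l => (hκ a).mdifferentiableAt l x
    have h2 := fun a l => (hκ a).lieD_eq i l x
    fin_cases m
    · have m1 : MDifferentiableAt 𝓘(ℝ, E4) 𝓘(ℝ, ℝ) (fun x => 1 + κ x 0 0) x :=
        mdifferentiableAt_const.add (h1 0 0)
      have m2 : MDifferentiableAt 𝓘(ℝ, E4) 𝓘(ℝ, ℝ) (fun x => 1 + κ x 0 0 + κ x 1 1) x :=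
        m1.add (h1 1 1)
      refine (lieD_add m2 (h1 2 2)).trans ?_
      rw [lieD_add m1 (h1 1 1), lieD_add mdifferentiableAt_const (h1 0 0), lieD_const, h2, h2, h2]
      rfl
    · exact (lieD_sub (h1 2 1) (h1 1 2)).trans (by rw [h2, h2]; rfl)
    · exact (lieD_sub (h1 0 2) (h1 2 0)).trans (by rw [h2, h2]; rfl)
    · exact (lieD_sub (h1 1 0) (h1 0 1)).trans (by rw [h2, h2]; rfl)
  have hT₀ : T x₀ = ![4, 0, 0, 0] := by
    ext m
    fin_cases m <;> simp [hT, quatTrace, hκ₀]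
    norm_num
  have hTpos : ∀ᶠ x in 𝓝 x₀, 0 < T x 0 := by
    refine ((hTs 0).continuous.tendsto x₀).eventually (lt_mem_nhds ?_)
    simp [hT₀]
  set R : ℝ → ℝ := fun t => Real.exp (-1 / 2 * Real.log t) with hR
  have hR' : ∀ {t : ℝ}, 0 < t → HasDerivAt R (R t * (-1 / 2 * t⁻¹)) t := fun ht =>
    ((Real.hasDerivAt_log ht.ne').const_mul _).exp
  have hRs : ∀ {t : ℝ}, 0 < t → ContDiffAt ℝ ∞ R t := fun ht =>
    Real.contDiff_exp.contDiffAt.comp _ (contDiffAt_const.mul (Real.contDiffAt_log.2 ht.ne'))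
  refine ⟨_, ?_, preservesFrame_of_coord (u := fun m x => s x * (T x m * R (T x 0)))
    (hTpos.mono fun x hx m => ?_) (hTpos.mono fun x hx i m => ?_)⟩
  · intro h0
    have h1 : s x₀ * (T x₀ 0 * R (T x₀ 0)) = 0 := congrFun (congrArg WithLp.ofLp h0) 0
    refine (mul_pos (hpos x₀) (mul_pos ?_ (Real.exp_pos _))).ne' h1
    simp [hT₀]
  · exact (hsm x).mul ((hTs m x).mul
      (ContMDiffAt.comp (g := R) (f := fun x => T x 0) x (hRs hx).contMDiffAt (hTs 0 x)))
  · have hRd : MDifferentiableAt 𝓘(ℝ, E4) 𝓘(ℝ, ℝ) (fun x => R (T x 0)) x :=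
      MDifferentiableAt.comp (g := R) (f := fun x => T x 0) x
        (hR' hx).differentiableAt.mdifferentiableAt (hTd 0 x)
    have hTR : MDifferentiableAt 𝓘(ℝ, E4) 𝓘(ℝ, ℝ) (fun x => T x m * R (T x 0)) x :=
      (hTd m x).mul hRd
    show lieD (e i) (fun x => s x * (T x m * R (T x 0))) x
      = quatRows (fun j => s x * (T x j * R (T x 0))) i m
    rw [lieD_mul (hsd x) hTR, hs, lieD_mul (hTd m x) hRd,
      lieD_comp_deriv (f := fun x => T x 0) (hR' hx) (hTd 0 x), hTD, hTD]
    have h2 : ∀ q : Fin 4 → ℝ, ∀ t : ℝ, quatRows (fun j => s x * (q j * t)) i m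
        = s x * (quatRows q i m * t) := fun q t => by
      fin_cases i <;> fin_cases m <;> simp [quatRows]
    simp only [h2]
    refine Fin.cases ?_ (fun i => ?_) i
    · have h3 : quatTrace 0 (fun a => rotDer 0 (κ x a)) = 0 := by
        ext m
        fin_cases m <;> simp [quatTrace, rotDer]
      have h4 : quatRows (T x) 0 m = T x m := by fin_cases m <;> simp [quatRows]
      rw [h3, h4]
      simp
      ring
    · have h3 := quatTrace_identity (horth x) (hcross x) i m
      have h5 : (![2, 0, 0, 0] : Fin 4 → ℝ) i.succ = 0 := by fin_cases i <;> rfl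
      rw [h5]
      have h6 : T x 0 ≠ 0 := hx.ne'
      field_simp
      linear_combination (s x * R (T x 0)) * h3

end QuaternionicGerm

/-! ### The classification -/

section Classification

open Set Filter Topology Matrix

variable {M : Type*} [TopologicalSpace M] [ChartedSpace E4 M] [IsManifold 𝓘(ℝ, E4) ∞ M]
  [Group M] [LieGroup 𝓘(ℝ, E4) ∞ M]

/-- For the Lie algebra of the non-zero quaternions, the components of the inverse of the adjoint
representation are rotating fields. -/
theorem IsDiagFrame.exists_rotating {v : Fin 4 → E4} (h : IsDiagFrame M v 0 ![2, 2, 2])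
    (hv : LinearIndependent ℝ v) : ∃ κ : M → Matrix (Fin 3) (Fin 3) ℝ,
      (∀ a, IsRotating (fun i => leftField (v i)) (fun x => κ x a)) ∧ κ 1 = 1 := by
  let L : Fin 4 → E4 →L[ℝ] ℝ := fun j =>
    (EuclideanSpace.proj j : E4 →L[ℝ] ℝ).comp (frameMap v).inverse
  have hL : ∀ w : E4, w = ∑ j, L j w • v j := eq_sum_of_linearIndependent hv
  have hLv : ∀ i j, L j (v i) = if i = j then 1 else 0 := fun i j => by
    have h1 : ∑ j, (L j (v i) - if i = j then 1 else 0) • v j = 0 := by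
      simp only [sub_smul, Finset.sum_sub_distrib, ← hL (v i), ite_smul, one_smul, zero_smul,
        Finset.sum_ite_eq, Finset.mem_univ, if_true, sub_self]
    exact sub_eq_zero.1 (Fintype.linearIndependent_iff.1 hv _ h1 j)
  refine ⟨fun x => Matrix.of fun a l => L l.succ (adInv x (v a.succ)), fun a => ⟨fun l => ?_,
    fun i l x => ?_⟩, ?_⟩
  · intro x
    exact ((L l.succ).contDiff.contMDiff.contMDiffAt).comp x
      (((ContinuousLinearMap.apply ℝ E4 (v a.succ)).contDiff.contMDiff.contMDiffAt).comp x
        (contMDiff_adInv x))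
  · have hA : MDifferentiableAt 𝓘(ℝ, E4) 𝓘(ℝ, E4) (fun x : M => adInv x (v a.succ)) x :=
      (((ContinuousLinearMap.apply ℝ E4 (v a.succ)).contDiff.contMDiff.contMDiffAt).comp x
        (contMDiff_adInv x)).mdifferentiableAt (n := ∞) (by simp)
    refine (lieD_clm (L l.succ) hA).trans ?_
    rw [lieD_adInv]
    show L l.succ (-lieBr M (v i) (adInv x (v a.succ)))
      = rotDer i (fun m => L m.succ (adInv x (v a.succ))) l
    generalize adInv x (v a.succ) = w
    have h1 : lieBr M (v i) w = ∑ j, L j w • lieBr M (v i) (v j) := by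
      have h2 : lieBrₗ M (v i) w = lieBrₗ M (v i) (∑ j, L j w • v j) := by rw [← hL]
      rw [map_sum] at h2
      simp only [map_smul] at h2
      exact h2
    have h10 := lieBr_skew (M := M) (v 1) (v 0)
    have h20 := lieBr_skew (M := M) (v 2) (v 0)
    have h30 := lieBr_skew (M := M) (v 3) (v 0)
    have h21 := lieBr_skew (M := M) (v 2) (v 1)
    have h32 := lieBr_skew (M := M) (v 3) (v 2)
    have h13 := lieBr_skew (M := M) (v 1) (v 3)
    rw [h1]
    fin_cases i <;> fin_cases l <;>
      simp [Fin.sum_univ_four, rotDer, lieBr_self, h10, h20, h30, h21, h32, h13, h.br01, h.br02,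
        h.br03, h.br12, h.br23, h.br31, hLv] <;> ring
  · ext a l
    simp only [of_apply, adInv_one, hLv, Fin.succ_inj, Matrix.one_apply]

/-- The theorem for a metric which is invariant under the left translations of a group structure
on the manifold itself. -/
theorem IsLeftInvariant.classification [T2Space M] [SimplyConnectedSpace M]
    {H : HypercomplexStructure M} {g h : RiemMetric M} (hl : IsLeftInvariant H g)
    (hh : IsHyperKahler H h) {f : M → ℝ} (hf : ContMDiff 𝓘(ℝ, E4) 𝓘(ℝ, ℝ) ∞ f)
    (hgf : ∀ x v w, ip g x v w = Real.exp (f x) * ip h x v w) :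
    IsHomotheticTo h univ euclideanMetric ∨
    IsHomotheticTo h {p : E4 | p ≠ 0} invertedMetric ∨
    IsHomotheticTo h {p : E4 | 0 < p 2} planeTimesConeMetric ∨
    IsHomotheticTo h {p : E4 | 0 < p 0} euclideanMetric ∨
    IsHomotheticTo h {p : E4 | 0 < p 0} gibbonsHawkingMetric := by
  obtain ⟨v, r, ⟨hv, hd⟩ | ⟨hv, α, β, hd, hαβ⟩⟩ := hl.exists_frame hh hf hgf
  · obtain ⟨F₀, hF₀⟩ := exists_germ_euclidean (x₀ := (1 : M))
      (hd.isStructFrame hv.linearIndependent)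
    exact Or.inl (hv.isHomotheticTo hl hh hf hgf isModel_euclidean
      (hasCoveringSections_univ E4) hF₀ (mem_univ _))
  · have hef : ∀ x i, lieD (leftField (v i)) f x = ![2, 0, 0, 0] i := fun x i => by
      rw [hl.lieD_eq hh hf hgf, hv.lieD_eq]
    have he := hd.isStructFrame hv.linearIndependent
    rcases hαβ with hαβ | hαβ | hαβ | hαβ <;> obtain ⟨rfl, rfl⟩ := Prod.mk.inj hαβ
    · obtain ⟨F₀, hF, hF₀⟩ := exists_germ_halfSpace (x₀ := (1 : M)) he hf hef
      exact Or.inr (Or.inr (Or.inr (Or.inl (hv.isHomotheticTo hl hh hf hgf isModel_halfSpace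
        (hasCoveringSections_halfSpace 0) hF₀ hF))))
    · obtain ⟨F₀, hF, hF₀⟩ := exists_germ_gibbonsHawking (x₀ := (1 : M)) he hf hef
      exact Or.inr (Or.inr (Or.inr (Or.inr (hv.isHomotheticTo hl hh hf hgf isModel_gibbonsHawking
        (hasCoveringSections_halfSpace 0) hF₀ hF))))
    · obtain ⟨F₀, hF, hF₀⟩ := exists_germ_cone (x₀ := (1 : M)) he hf hef
      exact Or.inr (Or.inr (Or.inl (hv.isHomotheticTo hl hh hf hgf isModel_cone
        (hasCoveringSections_halfSpace 2) hF₀ hF)))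
    · obtain ⟨κ, hκ, hκ1⟩ := hd.exists_rotating hv.linearIndependent
      obtain ⟨F₀, hF, hF₀⟩ := exists_germ_quaternion
        (linearIndependent_leftField hv.linearIndependent) hκ hκ1 hf hef
      exact Or.inr (Or.inl (hv.isHomotheticTo hl hh hf hgf isModel_inverted
        hasCoveringSections_compl_zero hF₀ hF))

end Classification

theorem mainTheorem2
    {M : Type*} [TopologicalSpace M] [ChartedSpace E4 M] [IsManifold 𝓘(ℝ, E4) ∞ M]
    [T2Space M] [SecondCountableTopology M] [SimplyConnectedSpace M]
    (H : HypercomplexStructure M) (h : RiemMetric M) (hh : IsHyperKahler H h)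
    (g : RiemMetric M) (hg : IsConformalTo g h)
    {E : Type*} [NormedAddCommGroup E] [NormedSpace ℝ E] [FiniteDimensional ℝ E]
    {G : Type*} [TopologicalSpace G] [ChartedSpace E G] [Group G] [LieGroup 𝓘(ℝ, E) ∞ G]
    [T2Space G] [SecondCountableTopology G] [MulAction G M]
    (hG : ActsSimplyTransitivelyByHypercomplexIsometries (E := E) H g G) :
    IsHomotheticTo h Set.univ euclideanMetric ∨
    IsHomotheticTo h {p : E4 | p ≠ 0} invertedMetric ∨
    IsHomotheticTo h {p : E4 | 0 < p 2} planeTimesConeMetric ∨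
    IsHomotheticTo h {p : E4 | 0 < p 0} euclideanMetric ∨
    IsHomotheticTo h {p : E4 | 0 < p 0} gibbonsHawkingMetric := by
  obtain ⟨f, hf, hgf⟩ := hg
  obtain ⟨x₀⟩ : Nonempty M := inferInstance
  obtain ⟨_, _, hmul⟩ := exists_lieGroup_of_simplyTransitive hG.smooth hG.simplyTransitive x₀
  have hl : IsLeftInvariant H g := by
    refine ⟨fun a => ?_, fun a => ?_⟩
    · obtain ⟨b, hb⟩ := hmul a
      rw [funext hb]
      exact hG.isometric b
    · obtain ⟨b, hb⟩ := hmul a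
      rw [funext hb]
      exact hG.hypercomplex b
  exact hl.classification hh hf hgf
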